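/- Let $\Delta$ be a connected finite-dimensional smooth Finsler manifold (Hausdorff, second countable, without boundary; each tangent space carries a norm $\|\cdot\|_x$ varying continuously with the base point), let $d(x,y)$ be the infimum of the lengths of $C^1$ paths from $x$ to $y$, let $B(x,\epsilon)$ be the open balls of $d$, and let $\mathrm{Leb}$ be a Borel measure on $\Delta$. Assume that $(\Delta,\mathrm{Leb})$ is a *John domain*: $\Delta$ is bounded for $d$; there are $C_0,\epsilon_0>0$ such that for all $0<\epsilon<\epsilon_0$ and all $x\in\Delta$ there is $x'\in\Delta$ with $d(x,x')\le C_0\epsilon$ and $B(x',\epsilon)$ compactly contained in $\Delta$; $\mathrm{Leb}$ is finite and fully supported; and for every $C>0$ there is $A>0$ such that $\mathrm{Leb}(B(x,C\rho))\le A\,\mathrm{Leb}(B(x,\rho))$ whenever $B(x,\rho)$ is compactly contained in $\Delta$. For a real normed space $V$, let $C^1(\Delta,V)$ be the set of bounded continuously differentiable functions $u:\Delta\to V$ with $\sup_x\|Du(x)\|<\infty$, where $\|Du(x)\|$ is the operator norm with respect to $\|\cdot\|_x$. Let $\{\Delta^{(l)}\}_{l\in L}$ ($L$ finite or countable) be a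 partition into open sets of a full measure subset of $\Delta$, and let $T:\bigcup_l\Delta^{(l)}\to\Delta$ be a *uniformly expanding Markov map*: $T$ restricts to a $C^1$ diffeomorphism from each $\Delta^{(l)}$ onto $\Delta$, with inverse branch $h_l:\Delta\to\Delta^{(l)}$; there are $\kappa>1$ and constants $C_{(l)}$ with $\kappa\|v\|\le\|DT(x)v\|\le C_{(l)}\|v\|$ for all $x\in\Delta^{(l)}$ and all tangent vectors $v$ at $x$; $T$ has a positive Jacobian with respect to $\mathrm{Leb}$ on each $\Delta^{(l)}$, whose inverse is denoted by $J$ (that is, $\mathrm{Leb}(T(A))=\int_A J^{-1}\,d\mathrm{Leb}$ for every Borel set $A\subset\Delta^{(l)}$); $\log J$ is $C^1$ on each $\Delta^{(l)}$; and $\sup_{l}\sup_{x\in\Delta}\|D((\log J)\circ h_l)(x)\|<\infty$. Let $r:\bigcup_l\Delta^{(l)}\to\mathbb R$ be a *good roof function*: $r\ge\epsilon_1$ for some $\epsilon_1>0$; $r$ is $C^1$ on each $\Delta^{(l)}$ and $\sup_l\sup_{x\in\Delta}\|D(r\circ h_l)(x)\|<\infty$; and it is not possible to write $r=\psi+\phi\circ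 T-\phi$ on $\bigcup_l\Delta^{(l)}$ with $\psi:\Delta\to\mathbb R$ constant on each $\Delta^{(l)}$ and $\phi\in C^1(\Delta,\mathbb R)$. Assume that $r$ has *exponential tails*: $\int_\Delta e^{\sigma_0 r}\,d\mathrm{Leb}<\infty$ for some $\sigma_0>0$, which is fixed. For $s\in\mathbb C$ and $u:\Delta\to\mathbb C$, define the transfer operator $$L_su(x)=\sum_{Ty=x}e^{-sr(y)}J(y)u(y),$$ and for $t\in\mathbb R$ and $u\in C^1(\Delta,\mathbb C)$ let $$\|u\|_{1,t}=\sup_{x\in\Delta}|u(x)|+\frac1{\max(1,|t|)}\sup_{x\in\Delta}\|Du(x)\|.$$ Then there exist $0<\sigma_0'\le\sigma_0$, $T_0>0$, $C>0$ and $0<\beta<1$ such that, for all $s=\sigma+it$ with $\sigma,t\in\mathbb R$, $|\sigma|\le\sigma_0'$ and $|t|\ge T_0$, all $u\in C^1(\Delta,\mathbb C)$ and all $k\in\mathbb N=\{0,1,2,\dots\}$, the function $L_s^ku$ is well defined and belongs to $L^2(\mathrm{Leb})$, the series defining $L_s(L_s^ku)(x)$ converges absolutely for every $x\in\Delta$,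 and $$\|L_s^ku\|_{L^2(\mathrm{Leb})}\le C\,\beta^k\,\|u\|_{1,t}.$$ -/

import Mathlib

open scoped Manifold ContDiff ENNReal
open MeasureTheory

/-- A Finsler metric on a (boundaryless, finite-dimensional) smooth manifold `M` modelled on `E`:
a norm on each tangent space, depending continuously on the base point, i.e. such that
`(x, v) ↦ ‖v‖ₓ` is continuous on the tangent bundle. -/
structure FinslerMetric (E : Type*) [NormedAddCommGroup E] [NormedSpace ℝ E]
    (M : Type*) [TopologicalSpace M] [ChartedSpace E M] [IsManifold 𝓘(ℝ, E) ∞ M] where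
  norm : ∀ x : M, Seminorm ℝ (TangentSpace 𝓘(ℝ, E) x)
  eq_zero_of_norm_eq_zero : ∀ (x : M) (v : TangentSpace 𝓘(ℝ, E) x), norm x v = 0 → v = 0
  continuous_norm : Continuous fun p : TangentBundle 𝓘(ℝ, E) M => norm p.proj p.snd

namespace FinslerMetric

variable {E : Type*} [NormedAddCommGroup E] [NormedSpace ℝ E]
  {M : Type*} [TopologicalSpace M] [ChartedSpace E M] [IsManifold 𝓘(ℝ, E) ∞ M]

/-- The Finsler distance: the infimum of the Finsler lengths of the `C^1` paths from `x` to `y`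
(Mathlib's `riemannianEDist` makes sense for an arbitrary family of norms on the tangent
spaces). -/
noncomputable def edist (F : FinslerMetric E M) (x y : M) : ℝ≥0∞ :=
  letI : ∀ z : M, ENorm (TangentSpace 𝓘(ℝ, E) z) := fun z => ⟨fun v => ENNReal.ofReal (F.norm z v)⟩
  Manifold.riemannianEDist 𝓘(ℝ, E) x y

/-- The open ball `B(x, ε)` for the Finsler distance. -/
def ball (F : FinslerMetric E M) (x : M) (ε : ℝ) : Set M :=
  {y | F.edist x y < ENNReal.ofReal ε}

/-- The dual norm `‖Du(x)‖` of the differential of `u : M → V` at `x`: the least `c ≥ 0` such that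
`‖Du(x)·v‖ ≤ c ‖v‖ₓ` for all tangent vectors `v` at `x`. -/
noncomputable def derivNorm (F : FinslerMetric E M) {V : Type*} [NormedAddCommGroup V]
    [NormedSpace ℝ V] (u : M → V) (x : M) : ℝ :=
  sInf {c : ℝ | 0 ≤ c ∧ ∀ v : TangentSpace 𝓘(ℝ, E) x,
    Norm.norm (E := V) (mfderiv 𝓘(ℝ, E) 𝓘(ℝ, V) u x v) ≤ c * F.norm x v}

/-- `u ∈ C^1(M, V)`: `u` is bounded, continuously differentiable, and `x ↦ ‖Du(x)‖` is
bounded. -/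
structure MemC1 (F : FinslerMetric E M) {V : Type*} [NormedAddCommGroup V] [NormedSpace ℝ V]
    (u : M → V) : Prop where
  contMDiff : ContMDiff 𝓘(ℝ, E) 𝓘(ℝ, V) 1 u
  bdd : BddAbove (Set.range fun x => ‖u x‖)
  bdd_deriv : BddAbove (Set.range fun x => F.derivNorm u x)

/-- `‖u‖_{1,t} = sup ‖u‖ + (1 / max(1,|t|)) sup ‖Du‖` (used for `u ∈ C^1(M, ℂ)` only). -/
noncomputable def normOne (F : FinslerMetric E M) (t : ℝ) (u : M → ℂ) : ℝ :=
  (⨆ x, ‖u x‖) + 1 / max 1 |t| * ⨆ x, F.derivNorm u x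

/-- `(M, Leb)` is a John domain for the Finsler metric `F`. A ball is compactly contained in `M`
when its closure in `M` is compact. -/
structure IsJohnDomain [MeasurableSpace M] [BorelSpace M] (F : FinslerMetric E M)
    (Leb : Measure M) : Prop where
  connected : ConnectedSpace M
  bounded : ∃ D : ℝ, ∀ x y : M, F.edist x y ≤ ENNReal.ofReal D
  john : ∃ C₀ > (0 : ℝ), ∃ ε₀ > (0 : ℝ), ∀ ε, 0 < ε → ε < ε₀ → ∀ x : M, ∃ x' : M,
    F.edist x x' ≤ ENNReal.ofReal (C₀ * ε) ∧ IsCompact (closure (F.ball x' ε))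
  finite : IsFiniteMeasure Leb
  full_support : Leb.IsOpenPosMeasure
  doubling : ∀ C > (0 : ℝ), ∃ A > (0 : ℝ), ∀ (x : M) (ρ : ℝ), 0 < ρ →
    IsCompact (closure (F.ball x ρ)) →
    Leb (F.ball x (C * ρ)) ≤ ENNReal.ofReal A * Leb (F.ball x ρ)

end FinslerMetric

/-- A uniformly expanding Markov map on `(M, Leb)`, with pieces indexed by `L`.

`toFun` and `J` are only relevant on the union of the pieces. `branch l` is the inverse branch
`M → piece l`, the inverse of the restriction of `T` to `piece l`, hence determined by `T`.
`J` is the inverse of the Jacobian of `T` with respect to `Leb`; since `J` is continuous on the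
pieces and `Leb` has full support, it is determined by `T` and `Leb` on the union of the pieces. -/
structure ExpandingMarkovMap {E : Type*} [NormedAddCommGroup E] [NormedSpace ℝ E]
    {M : Type*} [TopologicalSpace M] [ChartedSpace E M] [IsManifold 𝓘(ℝ, E) ∞ M]
    [MeasurableSpace M] [BorelSpace M]
    (F : FinslerMetric E M) (Leb : Measure M) (L : Type*) where
  piece : L → Set M
  toFun : M → M
  branch : L → M → M
  J : M → ℝ
  -- the pieces are open, pairwise disjoint, and cover a set of full measure
  isOpen_piece : ∀ l, IsOpen (piece l)
  disjoint_piece : Pairwise fun l l' => Disjoint (piece l) (piece l')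
  ae_mem_piece : Leb (⋃ l, piece l)ᶜ = 0
  -- `T` is a `C^1` diffeomorphism from each piece onto `M`
  branch_mem : ∀ l x, branch l x ∈ piece l
  toFun_branch : ∀ l x, toFun (branch l x) = x
  branch_toFun : ∀ l, ∀ y ∈ piece l, branch l (toFun y) = y
  contMDiffOn_toFun : ∀ l, ContMDiffOn 𝓘(ℝ, E) 𝓘(ℝ, E) 1 toFun (piece l)
  contMDiff_branch : ∀ l, ContMDiff 𝓘(ℝ, E) 𝓘(ℝ, E) 1 (branch l)
  -- uniform expansion, and boundedness of the derivative on each piece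
  expanding : ∃ κ > (1 : ℝ), ∀ l, ∀ x ∈ piece l, ∀ v : TangentSpace 𝓘(ℝ, E) x,
    κ * F.norm x v ≤ F.norm (toFun x) (mfderiv 𝓘(ℝ, E) 𝓘(ℝ, E) toFun x v)
  bounded_deriv : ∀ l, ∃ C : ℝ, ∀ x ∈ piece l, ∀ v : TangentSpace 𝓘(ℝ, E) x,
    F.norm (toFun x) (mfderiv 𝓘(ℝ, E) 𝓘(ℝ, E) toFun x v) ≤ C * F.norm x v
  -- `1 / J` is the Jacobian of `T`, `log J` is `C^1` on the pieces, with bounded distortion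
  J_pos : ∀ l, ∀ x ∈ piece l, 0 < J x
  jacobian : ∀ l, ∀ A : Set M, MeasurableSet A → A ⊆ piece l →
    Leb (toFun '' A) = ∫⁻ x in A, ENNReal.ofReal (J x)⁻¹ ∂Leb
  contMDiffOn_log_J : ∀ l, ContMDiffOn 𝓘(ℝ, E) 𝓘(ℝ, ℝ) 1 (fun x => Real.log (J x)) (piece l)
  distortion : ∃ C : ℝ, ∀ l x, F.derivNorm (fun z => Real.log (J (branch l z))) x ≤ C

namespace ExpandingMarkovMap

variable {E : Type*} [NormedAddCommGroup E] [NormedSpace ℝ E]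
  {M : Type*} [TopologicalSpace M] [ChartedSpace E M] [IsManifold 𝓘(ℝ, E) ∞ M]
  [MeasurableSpace M] [BorelSpace M]
  {F : FinslerMetric E M} {Leb : Measure M} {L : Type*}

/-- `r` is a good roof function for `T` (only its values on the union of the pieces matter). -/
structure IsGoodRoof (T : ExpandingMarkovMap F Leb L) (r : M → ℝ) : Prop where
  lower_bound : ∃ ε₁ > (0 : ℝ), ∀ l, ∀ x ∈ T.piece l, ε₁ ≤ r x
  contMDiffOn : ∀ l, ContMDiffOn 𝓘(ℝ, E) 𝓘(ℝ, ℝ) 1 r (T.piece l)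
  bounded_deriv : ∃ C : ℝ, ∀ l x, F.derivNorm (fun z => r (T.branch l z)) x ≤ C
  not_cohomologous : ¬ ∃ ψ φ : M → ℝ, (∀ l, ∃ c, ∀ x ∈ T.piece l, ψ x = c) ∧ F.MemC1 φ ∧
    ∀ l, ∀ x ∈ T.piece l, r x = ψ x + φ (T.toFun x) - φ x

/-- The set `{y | T y = x}` of preimages of `x` (in the domain of `T`, the union of the pieces). -/
def fiber (T : ExpandingMarkovMap F Leb L) (x : M) : Set M :=
  {y | y ∈ ⋃ l, T.piece l ∧ T.toFun y = x}

/-- The term `e^{-s r(y)} J(y) u(y)` of the sum defining `L_s u`. -/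
noncomputable def transferTerm (T : ExpandingMarkovMap F Leb L) (r : M → ℝ) (s : ℂ) (u : M → ℂ)
    (y : M) : ℂ :=
  Complex.exp (-s * (r y : ℂ)) * (T.J y : ℂ) * u y

/-- The transfer operator `L_s u(x) = ∑_{T y = x} e^{-s r(y)} J(y) u(y)`. -/
noncomputable def transfer (T : ExpandingMarkovMap F Leb L) (r : M → ℝ) (s : ℂ) (u : M → ℂ) :
    M → ℂ :=
  fun x => ∑' y : T.fiber x, T.transferTerm r s u y

end ExpandingMarkovMap

/-! This is Dolgopyat's argument. Since `L_s` sums over inverse branches, the analysis takes place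
in an abstract `BranchSystem` on a bounded pseudometric space: branches contract, and `log J` and
`r` are Lipschitz along them, with constants uniform over all iterates.

Instead of an iterate v alone one follows a pair (u, v), where log u is Lipschitz with constant of
order |t| and u dominates both v and its variations (`LogLip`, `Dominated`). A block of n steps
replaces v by L_s^n v and u by the sum of the moduli of the terms, lowered by a cutoff where the
terms of two chosen branches h, k point in different directions. Such places exist at scale 1/|t|:
if r_h - r_k oscillates by a definite fraction of ρ in every small ball of radius ρ, then for ρ =
R/|t| the relative phase t(r_h - r_k) turns by a definite angle, while v∘h and v∘k hardly turn,
because long branches contract strongly (`exists_point_of_oscillation`, `exists_cancellation`). The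
John and doubling properties make these places carry a fixed share of the mass
(`exists_cancellation_set`).

The contraction is measured by ∫ u²/g. By Cauchy-Schwarz, (∑ e^{-σr} J u)² ≤ (∑ e^{-2σr} J g)(∑ J
u²/g). The second factor has the same integral as u²/g, since the weights J preserve integrals; the
first is at most Λg for a suitable positive g with Λ close to 1, and smaller by a definite amount
where the cutoff acts. The gain η₀ of `dolgopyat_step` depends neither on g nor on Λ, so Λ can be
brought close to 1 afterwards (`exists_superSol`, `SuperSol.perturb`, `exists_decay`).

The oscillation comes from the failure of the cohomological equation. Summing r along the backward
orbit that always uses branch i gives a C^1 `phase`. If all phases agreed, r would be locally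
constant up to a C^1 coboundary (`exists_phase_ne`). So two phases differ, their difference has a
nonzero differential somewhere, and it oscillates at all small scales near that point. A cylinder
inside this region transports the oscillation to the whole space
(`uniformNonIntegrability_of_phase`). -/

/-! ### Systems of inverse branches and their iterates -/

/-- Words of length `n` in the alphabet `ι`. -/
def Word.{u} (ι : Type u) : ℕ → Type u
  | 0 => PUnit.{u + 1}
  | n + 1 => ι × Word ι n

instance Word.instCountable {ι : Type*} [Countable ι] : ∀ n, Countable (Word ι n)
  | 0 => inferInstanceAs (Countable PUnit)
  | n + 1 => by
    have := Word.instCountable (ι := ι) n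
    exact inferInstanceAs (Countable (ι × Word ι n))

/-- Inverse branches together with their weights `J` and the roof function `r` along them. -/
structure BranchSystem (X ι : Type*) where
  branch : ι → X → X
  J : ι → X → ℝ
  r : ι → X → ℝ

namespace BranchSystem

variable {X ι κ : Type*}

/-- The real weight `e^{-σ r} J`. -/
noncomputable def wt (S : BranchSystem X ι) (σ : ℝ) (i : ι) (x : X) : ℝ :=
  Real.exp (-σ * S.r i x) * S.J i x

/-- The complex weight `e^{-s r} J`. -/
noncomputable def coeff (S : BranchSystem X ι) (s : ℂ) (i : ι) (x : X) : ℂ :=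
  Complex.exp (-s * (S.r i x : ℂ)) * (S.J i x : ℂ)

/-- The transfer operator of a system of branches. -/
noncomputable def transfer (S : BranchSystem X ι) (s : ℂ) (v : X → ℂ) (x : X) : ℂ :=
  ∑' i, S.coeff s i x * v (S.branch i x)

/-- The system of branches of the `n`-th iterate. -/
def pow (S : BranchSystem X ι) : ∀ n : ℕ, BranchSystem X (Word ι n)
  | 0 => ⟨fun _ x => x, fun _ _ => 1, fun _ _ => 0⟩
  | n + 1 =>
    { branch := fun w x => (S.pow n).branch w.2 (S.branch w.1 x)
      J := fun w x => S.J w.1 x * (S.pow n).J w.2 (S.branch w.1 x)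
      r := fun w x => S.r w.1 x + (S.pow n).r w.2 (S.branch w.1 x) }

lemma wt_pow_succ (S : BranchSystem X ι) (σ : ℝ) (n : ℕ) (w : Word ι (n + 1)) (x : X) :
    (S.pow (n + 1)).wt σ w x = S.wt σ w.1 x * (S.pow n).wt σ w.2 (S.branch w.1 x) := by
  simp only [wt, pow, mul_add, Real.exp_add]
  ring

lemma coeff_pow_succ (S : BranchSystem X ι) (s : ℂ) (n : ℕ) (w : Word ι (n + 1)) (x : X) :
    (S.pow (n + 1)).coeff s w x = S.coeff s w.1 x * (S.pow n).coeff s w.2 (S.branch w.1 x) := by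
  simp only [coeff, pow, Complex.ofReal_add, Complex.ofReal_mul, mul_add, Complex.exp_add]
  ring

/-- Uniform regularity of a system of branches. -/
structure IsRegular [PseudoMetricSpace X] (S : BranchSystem X ι) (θ C₁ C₂ : ℝ) : Prop where
  J_pos : ∀ i x, 0 < S.J i x
  r_nonneg : ∀ i x, 0 ≤ S.r i x
  contr : ∀ i x y, dist (S.branch i x) (S.branch i y) ≤ θ * dist x y
  J_le : ∀ i x y, S.J i x ≤ S.J i y * Real.exp (C₁ * dist x y)
  r_lip : ∀ i x y, |S.r i x - S.r i y| ≤ C₂ * dist x y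

namespace IsRegular

variable [PseudoMetricSpace X] {S : BranchSystem X ι} {θ C₁ C₂ : ℝ}

lemma wt_pos (hS : S.IsRegular θ C₁ C₂) (σ : ℝ) (i : ι) (x : X) : 0 < S.wt σ i x :=
  mul_pos (Real.exp_pos _) (hS.J_pos i x)

lemma norm_coeff (hS : S.IsRegular θ C₁ C₂) (s : ℂ) (i : ι) (x : X) :
    ‖S.coeff s i x‖ = S.wt s.re i x := by
  simp [coeff, wt, Complex.norm_exp, abs_of_pos (hS.J_pos i x)]

lemma wt_mono (hS : S.IsRegular θ C₁ C₂) {σ σ' : ℝ} (h : σ ≤ σ') (i : ι) (x : X) :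
    S.wt σ' i x ≤ S.wt σ i x := by
  unfold wt
  have := hS.r_nonneg i x
  have := (hS.J_pos i x).le
  gcongr

/-- The constants do not depend on `n`: the distortions along an orbit form a geometric series, and
C/(1-θ) is the fixed point of D ↦ C + θD. This lets every later constant be chosen before the block
length. -/
lemma pow (hS : S.IsRegular θ C₁ C₂) (hθ : 0 ≤ θ) (hθ1 : θ < 1) (hC₁ : 0 ≤ C₁) (hC₂ : 0 ≤ C₂)
    (n : ℕ) : (S.pow n).IsRegular (θ ^ n) (C₁ / (1 - θ)) (C₂ / (1 - θ)) := by
  have h1 : 0 < 1 - θ := by linarith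
  have key : ∀ C : ℝ, C + C / (1 - θ) * θ = C / (1 - θ) := by
    intro C; field_simp; ring
  have hD1 : 0 ≤ C₁ / (1 - θ) := by positivity
  have hD2 : 0 ≤ C₂ / (1 - θ) := by positivity
  induction n with
  | zero =>
    refine ⟨fun _ _ => one_pos, fun _ _ => le_rfl, fun _ x y => by simp [BranchSystem.pow],
      fun _ x y => ?_, fun _ x y => ?_⟩
    · simp only [BranchSystem.pow, one_mul]
      exact Real.one_le_exp (by positivity)
    · simp only [BranchSystem.pow, sub_self, abs_zero]
      positivity
  | succ n ih =>
    refine ⟨fun w x => mul_pos (hS.J_pos _ _) (ih.J_pos _ _),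
      fun w x => add_nonneg (hS.r_nonneg _ _) (ih.r_nonneg _ _), fun w x y => ?_, fun w x y => ?_,
      fun w x y => ?_⟩
    · calc dist _ _ ≤ θ ^ n * dist (S.branch w.1 x) (S.branch w.1 y) := ih.contr _ _ _
        _ ≤ θ ^ n * (θ * dist x y) := by gcongr; exact hS.contr _ _ _
        _ = _ := by ring
    · have e : dist (S.branch w.1 x) (S.branch w.1 y) ≤ θ * dist x y := hS.contr _ _ _
      have p1 := (hS.J_pos w.1 x).le
      have p2 := (hS.J_pos w.1 y).le
      have p3 := (ih.J_pos w.2 (S.branch w.1 x)).le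
      have p4 := (ih.J_pos w.2 (S.branch w.1 y)).le
      calc S.J w.1 x * (S.pow n).J w.2 (S.branch w.1 x)
          ≤ (S.J w.1 y * Real.exp (C₁ * dist x y)) * ((S.pow n).J w.2 (S.branch w.1 y) *
            Real.exp (C₁ / (1 - θ) * (θ * dist x y))) := by
            refine mul_le_mul (hS.J_le _ _ _) ((ih.J_le _ _ (S.branch w.1 y)).trans ?_) p3 (by positivity)
            gcongr
        _ = S.J w.1 y * (S.pow n).J w.2 (S.branch w.1 y) *
            Real.exp (C₁ / (1 - θ) * dist x y) := by
            conv_rhs => rw [← key C₁, add_mul, Real.exp_add]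
            ring_nf
    · have e : dist (S.branch w.1 x) (S.branch w.1 y) ≤ θ * dist x y := hS.contr _ _ _
      have e1 := hS.r_lip w.1 x y
      have e2 := ih.r_lip w.2 (S.branch w.1 x) (S.branch w.1 y)
      have e3 : C₂ / (1 - θ) * dist (S.branch w.1 x) (S.branch w.1 y)
        ≤ C₂ / (1 - θ) * (θ * dist x y) := by gcongr
      have e4 : C₂ / (1 - θ) * dist x y
          = C₂ * dist x y + C₂ / (1 - θ) * (θ * dist x y) := by
        conv_lhs => rw [← key C₂]
        ring
      simp only [BranchSystem.pow]
      rw [e4]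
      rw [abs_le] at e1 e2 ⊢
      constructor <;> linarith [e1.1, e1.2, e2.1, e2.2]

end IsRegular

/-- `∑ wt σ · g ∘ h ≤ Λ g` as an inequality in `[0, ∞]`. -/
def SuperSol (S : BranchSystem X ι) (σ Λ : ℝ) (g : X → ℝ) : Prop :=
  ∀ x, ∑' i, ENNReal.ofReal (S.wt σ i x * g (S.branch i x)) ≤ ENNReal.ofReal (Λ * g x)

lemma summable_of_tsum_ofReal_le {α : Type*} {f : α → ℝ} (hf : ∀ a, 0 ≤ f a) {c : ℝ≥0∞}
    (hc : c ≠ ⊤) (h : ∑' a, ENNReal.ofReal (f a) ≤ c) : Summable f := by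
  have := ENNReal.summable_toReal (ne_top_of_le_ne_top hc h)
  simpa [ENNReal.toReal_ofReal (hf _)] using this

lemma tsum_le_of_tsum_ofReal_le {α : Type*} {f : α → ℝ} (hf : ∀ a, 0 ≤ f a) {c : ℝ}
    (hc : 0 ≤ c) (h : ∑' a, ENNReal.ofReal (f a) ≤ ENNReal.ofReal c) : ∑' a, f a ≤ c := by
  have hs := summable_of_tsum_ofReal_le hf ENNReal.ofReal_ne_top h
  rwa [← ENNReal.ofReal_tsum_of_nonneg hf hs, ENNReal.ofReal_le_ofReal_iff hc] at h

section SuperSol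

variable [PseudoMetricSpace X] {S : BranchSystem X ι} {θ C₁ C₂ σ Λ : ℝ} {g : X → ℝ}

lemma SuperSol.summable (h : S.SuperSol σ Λ g) (hS : S.IsRegular θ C₁ C₂) (hg : ∀ x, 0 ≤ g x)
    (x : X) : Summable fun i => S.wt σ i x * g (S.branch i x) :=
  summable_of_tsum_ofReal_le (fun _ => mul_nonneg (hS.wt_pos _ _ _).le (hg _))
    ENNReal.ofReal_ne_top (h x)

lemma SuperSol.tsum_le (h : S.SuperSol σ Λ g) (hS : S.IsRegular θ C₁ C₂) (hg : ∀ x, 0 ≤ g x)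
    (hΛ : 0 ≤ Λ) (x : X) : ∑' i, S.wt σ i x * g (S.branch i x) ≤ Λ * g x :=
  tsum_le_of_tsum_ofReal_le (fun _ => mul_nonneg (hS.wt_pos _ _ _).le (hg _))
    (mul_nonneg hΛ (hg x)) (h x)

/-- Working with sums in [0, ∞] allows Tonelli over words without any prior summability; summability
for the iterates is then read off from the bound. -/
lemma SuperSol.pow (h : S.SuperSol σ Λ g) (hS : S.IsRegular θ C₁ C₂)
    (hΛ : 0 ≤ Λ) (n : ℕ) : (S.pow n).SuperSol σ (Λ ^ n) g := by
  induction n with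
  | zero =>
    intro x
    have : Unique (Word ι 0) := inferInstanceAs (Unique PUnit)
    rw [tsum_eq_single (default : Word ι 0) (fun b hb => absurd (Subsingleton.elim _ _) hb)]
    simp [wt, BranchSystem.pow]
  | succ n ih =>
    intro x
    have e : ∑' w : Word ι (n + 1), ENNReal.ofReal ((S.pow (n + 1)).wt σ w x *
        g ((S.pow (n + 1)).branch w x)) = ∑' i, ENNReal.ofReal (S.wt σ i x) *
        ∑' w : Word ι n, ENNReal.ofReal ((S.pow n).wt σ w (S.branch i x) *
        g ((S.pow n).branch w (S.branch i x))) := by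
      simp_rw [← ENNReal.tsum_mul_left]
      refine Eq.trans ?_ (ENNReal.tsum_prod' (f := fun p : ι × Word ι n =>
        ENNReal.ofReal (S.wt σ p.1 x) * ENNReal.ofReal ((S.pow n).wt σ p.2 (S.branch p.1 x) *
        g ((S.pow n).branch p.2 (S.branch p.1 x)))))
      refine tsum_congr fun w => ?_
      rw [← ENNReal.ofReal_mul (hS.wt_pos _ _ _).le, wt_pow_succ, mul_assoc]
      rfl
    rw [e]
    calc _ ≤ ∑' i, ENNReal.ofReal (S.wt σ i x) * ENNReal.ofReal (Λ ^ n * g (S.branch i x)) := by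
          gcongr with i
          exact ih _
      _ = ENNReal.ofReal (Λ ^ n) * ∑' i, ENNReal.ofReal (S.wt σ i x * g (S.branch i x)) := by
          rw [← ENNReal.tsum_mul_left]
          refine tsum_congr fun i => ?_
          rw [ENNReal.ofReal_mul (by positivity), ENNReal.ofReal_mul (hS.wt_pos _ _ _).le]
          ring
      _ ≤ ENNReal.ofReal (Λ ^ n) * ENNReal.ofReal (Λ * g x) := by
          gcongr; exact h x
      _ = _ := by
          rw [← ENNReal.ofReal_mul (by positivity)]
          ring_nf

/-- A pointwise bound on the complex transfer operator. -/
lemma IsRegular.summable_transfer (hS : S.IsRegular θ C₁ C₂) {s : ℂ}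
    (hs : ∀ x, Summable fun i => S.wt s.re i x) {v : X → ℂ} {B : ℝ} (hv : ∀ x, ‖v x‖ ≤ B) (x : X) :
    Summable fun i => S.coeff s i x * v (S.branch i x) := by
  refine Summable.of_norm_bounded ((hs x).mul_right B) fun i => ?_
  rw [norm_mul, hS.norm_coeff]
  have := (hS.wt_pos s.re i x).le
  gcongr
  exact hv _

lemma IsRegular.norm_transfer_le (hS : S.IsRegular θ C₁ C₂) {s : ℂ}
    (hs : S.SuperSol s.re Λ 1) (hΛ : 0 ≤ Λ) {v : X → ℂ} {B : ℝ} (hv : ∀ x, ‖v x‖ ≤ B) (x : X) :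
    ‖S.transfer s v x‖ ≤ Λ * B := by
  have hs' : Summable fun i => S.wt s.re i x := by
    simpa using hs.summable hS (fun _ => zero_le_one) x
  have hB : 0 ≤ B := (norm_nonneg _).trans (hv x)
  refine (tsum_of_norm_bounded (hs'.mul_right B).hasSum fun i => ?_).trans ?_
  · rw [norm_mul, hS.norm_coeff]
    have := (hS.wt_pos s.re i x).le
    gcongr
    exact hv _
  · rw [tsum_mul_right]
    gcongr
    simpa using hs.tsum_le hS (fun _ => zero_le_one) hΛ x

lemma IsRegular.norm_iterate_transfer_le (hS : S.IsRegular θ C₁ C₂) {s : ℂ}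
    (hs : S.SuperSol s.re Λ 1) (hΛ : 0 ≤ Λ) {v : X → ℂ} {B : ℝ} (hv : ∀ x, ‖v x‖ ≤ B) (n : ℕ) :
    ∀ x, ‖(S.transfer s)^[n] v x‖ ≤ Λ ^ n * B := by
  induction n with
  | zero => simpa using hv
  | succ n ih =>
    intro x
    rw [Function.iterate_succ_apply', pow_succ', mul_assoc]
    exact hS.norm_transfer_le hs hΛ ih x

/-- Identifies a block of `n` steps with a single step of `S.pow n`, so that the one-step estimates
apply to blocks. Boundedness of `v` provides the absolute convergence that the regrouping needs. -/
lemma IsRegular.transfer_pow (hS : S.IsRegular θ C₁ C₂) (hθ : 0 ≤ θ) (hθ1 : θ < 1) (hC₁ : 0 ≤ C₁)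
    (hC₂ : 0 ≤ C₂) {s : ℂ}
    (hs : S.SuperSol s.re Λ 1) (hΛ : 0 ≤ Λ) {v : X → ℂ} {B : ℝ} (hv : ∀ x, ‖v x‖ ≤ B) (n : ℕ) :
    (S.pow n).transfer s v = (S.transfer s)^[n] v := by
  induction n with
  | zero =>
    ext x
    have : Unique (Word ι 0) := inferInstanceAs (Unique PUnit)
    rw [transfer, tsum_eq_single (default : Word ι 0)
      (fun b hb => absurd (Subsingleton.elim _ _) hb)]
    simp [coeff, BranchSystem.pow]
  | succ n ih =>
    ext x
    rw [Function.iterate_succ_apply', ← ih]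
    have hsum := (hS.pow hθ hθ1 hC₁ hC₂ (n + 1)).summable_transfer (s := s) (fun x => by
      simpa using (hs.pow hS hΛ (n + 1)).summable (hS.pow hθ hθ1 hC₁ hC₂ (n + 1))
        (fun _ => zero_le_one) x) hv x
    refine (Summable.tsum_prod (α := ℂ) (β := ι) (γ := Word ι n) (f := fun p =>
      (S.pow (n + 1)).coeff s p x * v ((S.pow (n + 1)).branch p x)) hsum).trans ?_
    refine tsum_congr fun i => ?_
    rw [transfer, ← tsum_mul_left]
    refine tsum_congr fun w => ?_
    exact (congrArg (· * v ((S.pow n).branch w (S.branch i x)))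
      (coeff_pow_succ S s n (i, w) x)).trans (mul_assoc _ _ _)

end SuperSol

end BranchSystem

/-! ### Elementary inequalities -/

lemma Complex.norm_exp_sub_one_le_exp_norm (z : ℂ) :
    ‖Complex.exp z - 1‖ ≤ Real.exp ‖z‖ - 1 := by
  simpa using Complex.norm_exp_sub_sum_le_exp_norm_sub_sum z 1

/-- Doubling the exponent pays for a factor 2; this compensates a cutoff that is only bounded below
by 1/2. -/
lemma Real.two_mul_exp_sub_one_le {a : ℝ} (ha : 0 ≤ a) :
    2 * (Real.exp a - 1) ≤ Real.exp (2 * a) - 1 := by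
  have h := Real.one_le_exp ha
  rw [two_mul a, Real.exp_add]
  nlinarith

/-- Jordan's inequality: a phase that has not wrapped past π gives a proportional gap on the unit
circle. -/
lemma Complex.two_div_pi_mul_abs_le_norm_exp_sub_one {x : ℝ} (hx : |x| ≤ Real.pi) :
    2 / Real.pi * |x| ≤ ‖Complex.exp (Complex.I * x) - 1‖ := by
  rw [Complex.norm_exp_I_mul_ofReal_sub_one, Real.norm_eq_abs, abs_mul]
  have := Real.mul_abs_le_abs_sin (x := x / 2) (by rw [abs_div]; norm_num; linarith)
  rw [abs_div] at this
  norm_num at this ⊢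
  calc 2 / Real.pi * |x| = 2 * (|x| / Real.pi) := by ring
    _ ≤ _ := by gcongr

/-- The squared Cauchy-Schwarz inequality for series, in the form `m² ≤ p q`. -/
lemma sq_tsum_le_tsum_mul_tsum {ι : Type*} {m p q : ι → ℝ} (hm : ∀ i, 0 ≤ m i)
    (hp : ∀ i, 0 ≤ p i) (hq : ∀ i, 0 ≤ q i)
    (h : ∀ i, m i ^ 2 ≤ p i * q i) (sp : Summable p) (sq : Summable q) :
    (∑' i, m i) ^ 2 ≤ (∑' i, p i) * ∑' i, q i := by
  have key : ∀ (c : ℝ) i, 2 * c * m i ≤ c * c * p i + q i := by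
    intro c i
    refine (le_abs_self _).trans (abs_le_of_sq_le_sq ?_ ?_)
    · nlinarith [sq_nonneg (c * c * p i - q i), mul_le_mul_of_nonneg_left (h i) (sq_nonneg c)]
    · exact add_nonneg (mul_nonneg (mul_self_nonneg c) (hp i)) (hq i)
  have sm : Summable m := by
    refine Summable.of_nonneg_of_le hm (fun i => ?_) (sp.add sq)
    have := key 1 i
    nlinarith [hm i, hp i, hq i]
  -- A quadratic polynomial in `c` that is nonnegative everywhere has nonpositive discriminant.
  have hd : ∀ c : ℝ, 0 ≤ (∑' i, p i) * (c * c) + (-2 * ∑' i, m i) * c + ∑' i, q i := by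
    intro c
    have h1 : ∑' i, 2 * c * m i ≤ ∑' i, (c * c * p i + q i) :=
      (sm.mul_left _).tsum_le_tsum (key c) ((sp.mul_left _).add sq)
    rw [tsum_mul_left, Summable.tsum_add (sp.mul_left _) sq, tsum_mul_left] at h1
    linarith
  have := discrim_le_zero hd
  unfold discrim at this
  nlinarith

/-! ### Log-Lipschitz majorants and the functions they dominate -/

section LogLip

variable {X : Type*} [PseudoMetricSpace X]

/-- `u ≥ 0` and `log u` is `a`-Lipschitz. -/
structure LogLip (a : ℝ) (u : X → ℝ) : Prop where
  nonneg : ∀ x, 0 ≤ u x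
  le : ∀ x y, u x ≤ u y * Real.exp (a * dist x y)

/-- `v` is bounded by `u` and its variations are controlled by `a u`, in an integrated form. -/
structure Dominated (a : ℝ) (u : X → ℝ) (v : X → ℂ) : Prop where
  norm_le : ∀ x, ‖v x‖ ≤ u x
  norm_sub_le : ∀ x y, ‖v x - v y‖ ≤ u x * (Real.exp (a * dist x y) - 1)

lemma LogLip.mono {a b : ℝ} {u : X → ℝ} (h : LogLip a u) (hab : a ≤ b) : LogLip b u :=
  ⟨h.nonneg, fun x y => (h.le x y).trans (by have := h.nonneg y; gcongr)⟩

lemma Dominated.mono {a b : ℝ} {u : X → ℝ} {v : X → ℂ} (h : Dominated a u v) (hab : a ≤ b) :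
    Dominated b u v :=
  ⟨h.norm_le, fun x y => (h.norm_sub_le x y).trans (by
    have := (norm_nonneg _).trans (h.norm_le x); gcongr)⟩

lemma LogLip.mul {a b : ℝ} {u v : X → ℝ} (hu : LogLip a u) (hv : LogLip b v) :
    LogLip (a + b) (fun x => u x * v x) := by
  refine ⟨fun x => mul_nonneg (hu.nonneg x) (hv.nonneg x), fun x y => ?_⟩
  rw [add_mul, Real.exp_add]
  calc u x * v x ≤ (u y * Real.exp (a * dist x y)) * (v y * Real.exp (b * dist x y)) :=
        mul_le_mul (hu.le x y) (hv.le x y) (hv.nonneg x) (by have := hu.nonneg y; positivity)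
    _ = _ := by ring

lemma LogLip.div {a b : ℝ} {u v : X → ℝ} (hu : LogLip a u) (hv : LogLip b v)
    (hv0 : ∀ x, 0 < v x) : LogLip (a + b) (fun x => u x / v x) := by
  refine hu.mul (v := fun x => (v x)⁻¹) ⟨fun x => (inv_pos.2 (hv0 x)).le, fun x y => ?_⟩
  rw [inv_eq_one_div, inv_mul_eq_div, div_le_div_iff₀ (hv0 x) (hv0 y), one_mul, mul_comm,
    dist_comm]
  exact hv.le y x

lemma LogLip.comp {a θ : ℝ} {u : X → ℝ} (hu : LogLip a u) (ha : 0 ≤ a) {f : X → X}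
    (hf : ∀ x y, dist (f x) (f y) ≤ θ * dist x y) : LogLip (a * θ) (fun x => u (f x)) := by
  refine ⟨fun x => hu.nonneg _, fun x y => (hu.le _ (f y)).trans ?_⟩
  have := hu.nonneg (f y)
  rw [mul_assoc]
  gcongr
  exact hf x y

lemma Dominated.comp {a θ : ℝ} {u : X → ℝ} {v : X → ℂ} (h : Dominated a u v) (ha : 0 ≤ a)
    {f : X → X} (hf : ∀ x y, dist (f x) (f y) ≤ θ * dist x y) :
    Dominated (a * θ) (fun x => u (f x)) (fun x => v (f x)) := by
  refine ⟨fun x => h.norm_le _, fun x y => (h.norm_sub_le _ _).trans ?_⟩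
  have := (norm_nonneg _).trans (h.norm_le (f x))
  rw [mul_assoc]
  gcongr
  exact hf x y

/-- With variations measured by e^{ad} - 1, the constants simply add under products, since (e^a - 1)
+ (e^b - 1)e^a = e^{a+b} - 1. -/
lemma Dominated.mul {a b : ℝ} {u A : X → ℝ} {v c : X → ℂ} (hc : Dominated b A c)
    (hA : ∀ x, ‖c x‖ = A x) (h : Dominated a u v) (hu : LogLip a u) (hb : 0 ≤ b) :
    Dominated (b + a) (fun x => A x * u x) (fun x => c x * v x) := by
  have hA0 : ∀ x, 0 ≤ A x := fun x => (hA x) ▸ norm_nonneg _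
  refine ⟨fun x => ?_, fun x y => ?_⟩
  · rw [norm_mul, hA]
    exact mul_le_mul_of_nonneg_left (h.norm_le x) (hA0 x)
  · have e : c x * v x - c y * v y = c x * (v x - v y) + (c x - c y) * v y := by ring
    rw [e]
    have hE : 0 ≤ Real.exp (b * dist x y) - 1 := by
      have := Real.one_le_exp (x := b * dist x y) (by positivity); linarith
    have hvy : ‖v y‖ ≤ u x * Real.exp (a * dist x y) := by
      refine (h.norm_le y).trans ((hu.le y x).trans_eq ?_)
      rw [dist_comm]
    calc _ ≤ ‖c x‖ * ‖v x - v y‖ + ‖c x - c y‖ * ‖v y‖ := by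
          refine (norm_add_le _ _).trans_eq ?_
          rw [norm_mul, norm_mul]
      _ ≤ A x * (u x * (Real.exp (a * dist x y) - 1)) +
          (A x * (Real.exp (b * dist x y) - 1)) * (u x * Real.exp (a * dist x y)) := by
          refine add_le_add ?_ ?_
          · rw [hA]
            exact mul_le_mul_of_nonneg_left (h.norm_sub_le x y) (hA0 x)
          · exact mul_le_mul (hc.norm_sub_le x y) hvy (norm_nonneg _) (mul_nonneg (hA0 x) hE)
      _ = _ := by rw [add_mul b, Real.exp_add]; ring

end LogLip

namespace BranchSystem.IsRegular

variable {X ι : Type*} [PseudoMetricSpace X] {S : BranchSystem X ι} {θ C₁ C₂ : ℝ}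

lemma logLip_J (hS : S.IsRegular θ C₁ C₂) (i : ι) : LogLip C₁ (S.J i) :=
  ⟨fun x => (hS.J_pos i x).le, hS.J_le i⟩

lemma abs_log_J_sub_le (hS : S.IsRegular θ C₁ C₂) (i : ι) (x y : X) :
    |Real.log (S.J i x) - Real.log (S.J i y)| ≤ C₁ * dist x y := by
  have key : ∀ x y, Real.log (S.J i x) - Real.log (S.J i y) ≤ C₁ * dist x y := by
    intro x y
    have := Real.log_le_log (hS.J_pos i x) (hS.J_le i x y)
    rw [Real.log_mul (hS.J_pos i y).ne' (Real.exp_pos _).ne', Real.log_exp] at this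
    linarith
  rw [abs_sub_le_iff]
  exact ⟨key x y, by rw [dist_comm]; exact key y x⟩

lemma logLip_wt (hS : S.IsRegular θ C₁ C₂) (σ : ℝ) (i : ι) :
    LogLip (C₁ + |σ| * C₂) (S.wt σ i) := by
  have h : LogLip (|σ| * C₂) (fun x => Real.exp (-σ * S.r i x)) := by
    refine ⟨fun x => (Real.exp_pos _).le, fun x y => ?_⟩
    rw [← Real.exp_add, Real.exp_le_exp]
    have h1 : |σ * (S.r i y - S.r i x)| ≤ |σ| * (C₂ * dist x y) := by
      rw [abs_mul, dist_comm]
      gcongr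
      exact hS.r_lip i y x
    have := (abs_le.1 h1).2
    nlinarith
  rw [add_comm]
  exact h.mul (hS.logLip_J i)

/-- The coefficient is an exponential whose exponent is Lipschitz of constant C₁ + ‖s‖C₂. The
quotient of two of its values is therefore exp ζ with ζ small, and |e^ζ - 1| ≤ e^{|ζ|} - 1. -/
lemma dominated_coeff (hS : S.IsRegular θ C₁ C₂) (s : ℂ) (i : ι) :
    Dominated (C₁ + ‖s‖ * C₂) (S.wt s.re i) (S.coeff s i) := by
  refine ⟨fun x => (hS.norm_coeff s i x).le, fun x y => ?_⟩
  set ζ : ℂ := -s * ((S.r i y - S.r i x : ℝ) : ℂ) +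
    ((Real.log (S.J i y) - Real.log (S.J i x) : ℝ) : ℂ) with hζ
  have e : S.coeff s i y = S.coeff s i x * Complex.exp ζ := by
    have hx : (S.J i x : ℂ) = Complex.exp (Real.log (S.J i x) : ℂ) := by
      rw [← Complex.ofReal_exp, Real.exp_log (hS.J_pos i x)]
    have hy : (S.J i y : ℂ) = Complex.exp (Real.log (S.J i y) : ℂ) := by
      rw [← Complex.ofReal_exp, Real.exp_log (hS.J_pos i y)]
    rw [coeff, coeff, hx, hy, ← Complex.exp_add, ← Complex.exp_add, ← Complex.exp_add, hζ]
    congr 1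
    push_cast
    ring
  have hn : ‖ζ‖ ≤ (C₁ + ‖s‖ * C₂) * dist x y := by
    have h1 := hS.r_lip i y x
    have h2 := hS.abs_log_J_sub_le i y x
    rw [dist_comm] at h1 h2
    calc ‖ζ‖ ≤ ‖s‖ * |S.r i y - S.r i x| + |Real.log (S.J i y) - Real.log (S.J i x)| := by
          refine (norm_add_le _ _).trans_eq ?_
          rw [norm_mul, norm_neg, Complex.norm_real, Complex.norm_real, Real.norm_eq_abs,
            Real.norm_eq_abs]
      _ ≤ ‖s‖ * (C₂ * dist x y) + C₁ * dist x y := by gcongr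
      _ = _ := by ring
  rw [e, show S.coeff s i x - S.coeff s i x * Complex.exp ζ
    = -(S.coeff s i x * (Complex.exp ζ - 1)) by ring, norm_neg, norm_mul, hS.norm_coeff]
  have := (hS.wt_pos s.re i x).le
  gcongr
  exact (Complex.norm_exp_sub_one_le_exp_norm ζ).trans (by gcongr)

lemma logLip_term (hS : S.IsRegular θ C₁ C₂) (σ : ℝ) (i : ι) {a : ℝ} (ha : 0 ≤ a) {u : X → ℝ}
    (hu : LogLip a u) :
    LogLip (C₁ + |σ| * C₂ + a * θ) (fun x => S.wt σ i x * u (S.branch i x)) :=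
  (hS.logLip_wt σ i).mul (hu.comp ha (hS.contr i))

/-- The factor θ in front of `a` is what makes the cone invariant: for `a` a large multiple of |t|
and θ small, the new constant is at most a/2, and the other half is left for the cutoff. -/
lemma dominated_term (hS : S.IsRegular θ C₁ C₂) (hC₁ : 0 ≤ C₁) (hC₂ : 0 ≤ C₂) (s : ℂ) (i : ι)
    {a : ℝ} (ha : 0 ≤ a) {u : X → ℝ} (hu : LogLip a u) {v : X → ℂ} (hv : Dominated a u v) :
    Dominated (C₁ + ‖s‖ * C₂ + a * θ) (fun x => S.wt s.re i x * u (S.branch i x))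
      (fun x => S.coeff s i x * v (S.branch i x)) :=
  (hS.dominated_coeff s i).mul (hS.norm_coeff s i) (hv.comp ha (hS.contr i))
    (hu.comp ha (hS.contr i)) (by positivity)

end BranchSystem.IsRegular

/-! ### Cancellation between two complex terms -/

lemma Complex.norm_div_norm_self {z : ℂ} (hz : z ≠ 0) : ‖z / (‖z‖ : ℂ)‖ = 1 := by
  rw [norm_div, Complex.norm_real, norm_norm, div_self (norm_ne_zero_iff.2 hz)]

lemma Complex.norm_div_norm_sub_le {z w : ℂ} (hz : z ≠ 0) (hw : w ≠ 0) :
    ‖z / (‖z‖ : ℂ) - w / (‖w‖ : ℂ)‖ ≤ 2 * ‖z - w‖ / ‖z‖ := by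
  have hz' : (‖z‖ : ℂ) ≠ 0 := by simpa using hz
  have hw' : (‖w‖ : ℂ) ≠ 0 := by simpa using hw
  have e : z / (‖z‖ : ℂ) - w / (‖w‖ : ℂ)
      = ((z - w) + w / (‖w‖ : ℂ) * ((‖w‖ - ‖z‖ : ℝ) : ℂ)) / (‖z‖ : ℂ) := by
    field_simp
    push_cast
    ring
  rw [e, norm_div, Complex.norm_real, norm_norm]
  gcongr
  refine (norm_add_le _ _).trans ?_
  rw [norm_mul, Complex.norm_div_norm_self hw, Complex.norm_real, Real.norm_eq_abs, two_mul, one_mul]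
  gcongr
  rw [norm_sub_rev]
  exact abs_norm_sub_norm_le w z

/-- Two complex numbers with different arguments do not add up. -/
lemma Complex.norm_add_le_of_le_norm_sub {z w : ℂ} {γ : ℝ} (hγ : 0 ≤ γ) (hz : z ≠ 0) (hw : w ≠ 0)
    (hzw : ‖z‖ ≤ 2 * ‖w‖) (h : γ ≤ ‖z / (‖z‖ : ℂ) - w / (‖w‖ : ℂ)‖) :
    ‖z + w‖ ≤ (1 - γ ^ 2 / 8) * ‖z‖ + ‖w‖ := by
  have hz' : (‖z‖ : ℂ) ≠ 0 := by simpa using hz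
  have hw' : (‖w‖ : ℂ) ≠ 0 := by simpa using hw
  set e := z / (‖z‖ : ℂ) with he
  set f := w / (‖w‖ : ℂ) with hf
  have e1 : ‖e‖ = 1 := Complex.norm_div_norm_self hz
  have f1 : ‖f‖ = 1 := Complex.norm_div_norm_self hw
  have hp := parallelogram_law_with_norm ℝ e f
  rw [e1, f1] at hp
  have hef : ‖e - f‖ ≤ 2 := by
    refine (norm_sub_le _ _).trans ?_
    rw [e1, f1]; norm_num
  -- The parallelogram law gives ‖e + f‖² = 4 - ‖e - f‖² ≤ 4 - γ², which is at most (2 - γ²/4)².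
  have hs : ‖e + f‖ ≤ 2 - γ ^ 2 / 4 := by
    have h4 : γ ^ 2 ≤ 4 := by nlinarith
    refine (le_abs_self _).trans (abs_le_of_sq_le_sq ?_ (by linarith))
    nlinarith [sq_nonneg (γ ^ 2), mul_self_le_mul_self hγ h]
  have ez : z = (‖z‖ : ℂ) * e := by rw [he]; field_simp
  have ew : w = (‖w‖ : ℂ) * f := by rw [hf]; field_simp
  -- Only half of z is paired with an equal length of w; by ‖z‖ ≤ 2‖w‖ the remaining coefficient of
  -- f is nonnegative.
  have dec : z + w = ((‖z‖ / 2 : ℝ) : ℂ) * (e + f) + ((‖z‖ / 2 : ℝ) : ℂ) * e +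
      ((‖w‖ - ‖z‖ / 2 : ℝ) : ℂ) * f := by
    conv_lhs => rw [ez, ew]
    push_cast
    ring
  have hpos : 0 ≤ ‖w‖ - ‖z‖ / 2 := by linarith
  calc ‖z + w‖ ≤ ‖z‖ / 2 * ‖e + f‖ + ‖z‖ / 2 * ‖e‖ + (‖w‖ - ‖z‖ / 2) * ‖f‖ := by
        rw [dec]
        refine (norm_add₃_le).trans_eq ?_
        rw [norm_mul, norm_mul, norm_mul, Complex.norm_of_nonneg hpos,
          Complex.norm_of_nonneg (by positivity)]
    _ ≤ ‖z‖ / 2 * (2 - γ ^ 2 / 4) + ‖z‖ / 2 * 1 + (‖w‖ - ‖z‖ / 2) * 1 := by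
        rw [e1, f1]; gcongr
    _ = _ := by ring

section Local

variable {X : Type*} [PseudoMetricSpace X]

/-- On a ball where neither A nor z can vary much relative to A, a defect of size 1/2 at the centre
persists as a defect of size 1/4. -/
lemma Dominated.norm_le_of_le_half {b ρ : ℝ} {A : X → ℝ} {z : X → ℂ}
    (hz : Dominated b A z) (hA : LogLip b A) (hb : 0 ≤ b) (hρ : Real.exp (b * ρ) - 1 ≤ 1 / 16)
    {p x : X} (hp : ‖z p‖ ≤ A p / 2) (hx : dist x p < ρ) : ‖z x‖ ≤ 3 / 4 * A x := by
  have hE : Real.exp (b * dist p x) ≤ 17 / 16 := by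
    have : Real.exp (b * dist p x) ≤ Real.exp (b * ρ) := by
      rw [dist_comm]; gcongr
    linarith
  have h1 := hz.norm_sub_le p x
  have h2 := hA.le p x
  have h3 := norm_sub_norm_le (z x) (z p)
  rw [norm_sub_rev] at h3
  have h4 := hA.nonneg x
  have h5 := hA.nonneg p
  have h6 : A p ≤ A x * (17 / 16) := h2.trans (by gcongr)
  nlinarith

/-- Local cancellation between two terms, away from coinciding arguments. -/
lemma exists_cancellation {b ρ γ : ℝ} (hb : 0 ≤ b) (hγ : 0 ≤ γ) (hγ1 : γ ≤ 1)
    (hρ : Real.exp (b * ρ) - 1 ≤ γ / 16) {A₁ A₂ : X → ℝ} {z₁ z₂ : X → ℂ}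
    (hA₁ : LogLip b A₁) (hA₂ : LogLip b A₂) (hz₁ : Dominated b A₁ z₁) (hz₂ : Dominated b A₂ z₂)
    (p : X) (hp : ‖z₁ p‖ ≤ A₁ p / 2 ∨ ‖z₂ p‖ ≤ A₂ p / 2 ∨
      γ ≤ ‖z₁ p / (‖z₁ p‖ : ℂ) - z₂ p / (‖z₂ p‖ : ℂ)‖) :
    (∀ x, dist x p < ρ → ‖z₁ x + z₂ x‖ ≤ (1 - γ ^ 2 / 32) * A₁ x + A₂ x) ∨
    (∀ x, dist x p < ρ → ‖z₁ x + z₂ x‖ ≤ A₁ x + (1 - γ ^ 2 / 32) * A₂ x) := by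
  have hγ2 : γ ^ 2 / 32 ≤ 1 / 4 := by nlinarith
  by_cases c1 : ‖z₁ p‖ ≤ A₁ p / 2
  · left
    intro x hx
    have h1 := hz₁.norm_le_of_le_half hA₁ hb (by linarith) c1 hx
    have h2 := norm_add_le (z₁ x) (z₂ x)
    nlinarith [hz₂.norm_le x, hA₁.nonneg x]
  by_cases c2 : ‖z₂ p‖ ≤ A₂ p / 2
  · right
    intro x hx
    have h1 := hz₂.norm_le_of_le_half hA₂ hb (by linarith) c2 hx
    have h2 := norm_add_le (z₁ x) (z₂ x)
    nlinarith [hz₁.norm_le x, hA₂.nonneg x]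
  have c3 : γ ≤ ‖z₁ p / (‖z₁ p‖ : ℂ) - z₂ p / (‖z₂ p‖ : ℂ)‖ := by tauto
  -- When z p is at least half of its majorant, the variations allowed by A are also small relative
  -- to z p, so the direction of z is almost constant on the ball.
  have near : ∀ (A : X → ℝ) (z : X → ℂ), LogLip b A → Dominated b A z → A p / 2 < ‖z p‖ →
      0 < ‖z p‖ ∧ ∀ x, dist x p < ρ → ‖z x - z p‖ ≤ γ / 8 * ‖z p‖ := by
    intro A z hA hz hc
    have := hA.nonneg p
    have hpos : 0 < ‖z p‖ := by linarith
    refine ⟨hpos, fun x hx => ?_⟩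
    have h1 := hz.norm_sub_le p x
    have : Real.exp (b * dist p x) ≤ Real.exp (b * ρ) := by
      rw [dist_comm]; gcongr
    rw [norm_sub_rev]
    calc _ ≤ _ := h1
      _ ≤ A p * (γ / 16) := by gcongr; linarith
      _ ≤ _ := by nlinarith
  obtain ⟨p1, n1⟩ := near A₁ z₁ hA₁ hz₁ (not_le.1 c1)
  obtain ⟨p2, n2⟩ := near A₂ z₂ hA₂ hz₂ (not_le.1 c2)
  have main : ∀ x, dist x p < ρ → 7 / 8 * ‖z₁ p‖ ≤ ‖z₁ x‖ ∧ ‖z₁ x‖ ≤ 9 / 8 * ‖z₁ p‖ ∧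
      7 / 8 * ‖z₂ p‖ ≤ ‖z₂ x‖ ∧ ‖z₂ x‖ ≤ 9 / 8 * ‖z₂ p‖ ∧
      γ / 2 ≤ ‖z₁ x / (‖z₁ x‖ : ℂ) - z₂ x / (‖z₂ x‖ : ℂ)‖ := by
    intro x hx
    have m1 := n1 x hx
    have m2 := n2 x hx
    have a1 := abs_le.1 ((abs_norm_sub_norm_le (z₁ x) (z₁ p)).trans m1)
    have a2 := abs_le.1 ((abs_norm_sub_norm_le (z₂ x) (z₂ p)).trans m2)
    have l1 : 7 / 8 * ‖z₁ p‖ ≤ ‖z₁ x‖ := by nlinarith [a1.1]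
    have l2 : 7 / 8 * ‖z₂ p‖ ≤ ‖z₂ x‖ := by nlinarith [a2.1]
    refine ⟨l1, by nlinarith [a1.2], l2, by nlinarith [a2.2], ?_⟩
    have d1 := Complex.norm_div_norm_sub_le (norm_pos_iff.1 p1)
      (norm_pos_iff.1 (show 0 < ‖z₁ x‖ by linarith))
    have d2 := Complex.norm_div_norm_sub_le (norm_pos_iff.1 p2)
      (norm_pos_iff.1 (show 0 < ‖z₂ x‖ by linarith))
    have d1' : 2 * ‖z₁ p - z₁ x‖ / ‖z₁ p‖ ≤ γ / 4 := by
      rw [div_le_iff₀ p1, norm_sub_rev]; linarith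
    have d2' : 2 * ‖z₂ p - z₂ x‖ / ‖z₂ p‖ ≤ γ / 4 := by
      rw [div_le_iff₀ p2, norm_sub_rev]; linarith
    set e := z₁ p / (‖z₁ p‖ : ℂ)
    set f := z₂ p / (‖z₂ p‖ : ℂ)
    set e' := z₁ x / (‖z₁ x‖ : ℂ)
    set f' := z₂ x / (‖z₂ x‖ : ℂ)
    have : ‖e - f‖ ≤ ‖e - e'‖ + ‖e' - f'‖ + ‖f - f'‖ := by
      rw [norm_sub_rev f f', show e - f = (e - e') + (e' - f') + (f' - f) by ring]
      exact norm_add₃_le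
    linarith
  have gg : (γ / 2) ^ 2 / 8 = γ ^ 2 / 32 := by ring
  -- The loss is charged to the term that is smaller at the centre. On the ball that term stays
  -- below twice the other one, since 9/7 ≤ 2, so the same alternative holds at all its points.
  rcases le_total ‖z₁ p‖ ‖z₂ p‖ with hle | hle
  · left
    intro x hx
    obtain ⟨l1, u1, l2, u2, hd⟩ := main x hx
    have := Complex.norm_add_le_of_le_norm_sub (by positivity : 0 ≤ γ / 2)
      (norm_pos_iff.1 (show 0 < ‖z₁ x‖ by linarith))
      (norm_pos_iff.1 (show 0 < ‖z₂ x‖ by linarith)) (by linarith) hd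
    rw [gg] at this
    have t1 := hz₁.norm_le x
    have t2 := hz₂.norm_le x
    nlinarith
  · right
    intro x hx
    obtain ⟨l1, u1, l2, u2, hd⟩ := main x hx
    rw [norm_sub_rev] at hd
    have := Complex.norm_add_le_of_le_norm_sub (by positivity : 0 ≤ γ / 2)
      (norm_pos_iff.1 (show 0 < ‖z₂ x‖ by linarith))
      (norm_pos_iff.1 (show 0 < ‖z₁ x‖ by linarith)) (by linarith) hd
    rw [gg, add_comm] at this
    have t1 := hz₁.norm_le x
    have t2 := hz₂.norm_le x
    nlinarith

end Local

/-! ### From oscillation of the roof function to different arguments -/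

namespace BranchSystem

variable {X ι : Type*} [PseudoMetricSpace X] {S : BranchSystem X ι} {θ C₁ C₂ : ℝ}

lemma coeff_mul_div_norm (hS : S.IsRegular θ C₁ C₂) (σ t : ℝ) (i : ι) (x : X) (w : ℂ) :
    (S.coeff (σ + t * Complex.I) i x * w) / (‖S.coeff (σ + t * Complex.I) i x * w‖ : ℂ)
      = Complex.exp (Complex.I * ((-t * S.r i x : ℝ) : ℂ)) * (w / (‖w‖ : ℂ)) := by
  have hJ := (hS.J_pos i x)
  have hw := hS.wt_pos σ i x
  have e : S.coeff (σ + t * Complex.I) i x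
      = (S.wt σ i x : ℂ) * Complex.exp (Complex.I * ((-t * S.r i x : ℝ) : ℂ)) := by
    rw [coeff, wt, Complex.ofReal_mul, Complex.ofReal_exp, mul_right_comm, ← Complex.exp_add]
    congr 2
    push_cast
    ring
  have hw' : (S.wt σ i x : ℂ) ≠ 0 := by exact_mod_cast hw.ne'
  rw [e, norm_mul, norm_mul, Complex.norm_exp_I_mul_ofReal, mul_one, Complex.norm_of_nonneg hw.le]
  push_cast
  field_simp

/-- Oscillation of the phase produces points where the arguments of two terms differ. -/
lemma exists_point_of_oscillation (hS : S.IsRegular θ C₁ C₂) {a c γ R : ℝ} (ha : 0 ≤ a)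
    (hθ : 0 ≤ θ) (hγ : 4 * γ ≤ 2 / Real.pi * (c * R)) (hR : 4 * C₂ * R ≤ Real.pi) (hC₂ : 0 ≤ C₂)
    {σ t : ℝ} (ht : 0 < |t|)
    (hE : 8 * (Real.exp (a * θ * (2 * R / |t|)) - 1) ≤ 2 * γ)
    {u : X → ℝ} {v : X → ℂ} (hv : Dominated a u v) {h k : ι} {x x₁ x₂ : X}
    (hx₁ : dist x₁ x < R / |t|) (hx₂ : dist x₂ x < R / |t|)
    (hosc : c * (R / |t|) ≤ |(S.r h x₁ - S.r k x₁) - (S.r h x₂ - S.r k x₂)|) :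
    ∃ p, dist p x < R / |t| ∧
      (‖S.coeff (σ + t * Complex.I) h p * v (S.branch h p)‖
        ≤ S.wt σ h p * u (S.branch h p) / 2 ∨
      ‖S.coeff (σ + t * Complex.I) k p * v (S.branch k p)‖
        ≤ S.wt σ k p * u (S.branch k p) / 2 ∨
      γ ≤ ‖(S.coeff (σ + t * Complex.I) h p * v (S.branch h p)) /
            (‖S.coeff (σ + t * Complex.I) h p * v (S.branch h p)‖ : ℂ) -
          (S.coeff (σ + t * Complex.I) k p * v (S.branch k p)) /
            (‖S.coeff (σ + t * Complex.I) k p * v (S.branch k p)‖ : ℂ)‖) := by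
  have hu0 : ∀ x, 0 ≤ u x := fun x => (norm_nonneg _).trans (hv.norm_le x)
  have hre : ((σ : ℂ) + t * Complex.I).re = σ := by simp
  have conv : ∀ i p, ‖v (S.branch i p)‖ ≤ u (S.branch i p) / 2 →
      ‖S.coeff (σ + t * Complex.I) i p * v (S.branch i p)‖
        ≤ S.wt σ i p * u (S.branch i p) / 2 := by
    intro i p hp
    rw [norm_mul, hS.norm_coeff, hre, mul_div_assoc]
    exact mul_le_mul_of_nonneg_left hp (hS.wt_pos _ _ _).le
  by_cases b1 : ‖v (S.branch h x₁)‖ ≤ u (S.branch h x₁) / 2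
  · exact ⟨x₁, hx₁, Or.inl (conv _ _ b1)⟩
  by_cases b2 : ‖v (S.branch k x₁)‖ ≤ u (S.branch k x₁) / 2
  · exact ⟨x₁, hx₁, Or.inr (Or.inl (conv _ _ b2))⟩
  by_cases b3 : ‖v (S.branch h x₂)‖ ≤ u (S.branch h x₂) / 2
  · exact ⟨x₂, hx₂, Or.inl (conv _ _ b3)⟩
  by_cases b4 : ‖v (S.branch k x₂)‖ ≤ u (S.branch k x₂) / 2
  · exact ⟨x₂, hx₂, Or.inr (Or.inl (conv _ _ b4))⟩
  simp only [coeff_mul_div_norm hS]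
  set d := dist x₁ x₂ with hd
  have hd2 : d ≤ 2 * R / |t| := by
    have := dist_triangle_right x₁ x₂ x
    have e : 2 * R / |t| = R / |t| + R / |t| := by ring
    linarith
  -- The factor 4 is 2 from the normalization and 2 from ‖v‖ > u/2. The contraction θ of the branch
  -- makes the change of direction of v small although the points are at distance of order R/|t|.
  have near : ∀ i, ¬ ‖v (S.branch i x₁)‖ ≤ u (S.branch i x₁) / 2 →
      ¬ ‖v (S.branch i x₂)‖ ≤ u (S.branch i x₂) / 2 →
      ‖v (S.branch i x₁) / (‖v (S.branch i x₁)‖ : ℂ) -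
        v (S.branch i x₂) / (‖v (S.branch i x₂)‖ : ℂ)‖
        ≤ 4 * (Real.exp (a * θ * (2 * R / |t|)) - 1) ∧
      ‖v (S.branch i x₁) / (‖v (S.branch i x₁)‖ : ℂ)‖ = 1 ∧
      ‖v (S.branch i x₂) / (‖v (S.branch i x₂)‖ : ℂ)‖ = 1 := by
    intro i h1 h2
    rw [not_le] at h1 h2
    have p1 : 0 < ‖v (S.branch i x₁)‖ := lt_of_le_of_lt (by have := hu0 (S.branch i x₁); positivity) h1
    have p2 : 0 < ‖v (S.branch i x₂)‖ := lt_of_le_of_lt (by have := hu0 (S.branch i x₂); positivity) h2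
    refine ⟨?_, Complex.norm_div_norm_self (norm_pos_iff.1 p1),
      Complex.norm_div_norm_self (norm_pos_iff.1 p2)⟩
    refine (Complex.norm_div_norm_sub_le (norm_pos_iff.1 p1) (norm_pos_iff.1 p2)).trans ?_
    have hD := (hv.comp ha (hS.contr i)).norm_sub_le x₁ x₂
    have hexp : Real.exp (a * θ * d) ≤ Real.exp (a * θ * (2 * R / |t|)) := by
      have : 0 ≤ a * θ := by positivity
      gcongr
    have h0 : 1 ≤ Real.exp (a * θ * d) := Real.one_le_exp (by positivity)
    rw [div_le_iff₀ p1]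
    nlinarith
  obtain ⟨nh, oh1, oh2⟩ := near h b1 b3
  obtain ⟨nk, ok1, ok2⟩ := near k b2 b4
  set V := v (S.branch h x₁) / (‖v (S.branch h x₁)‖ : ℂ)
  set V' := v (S.branch h x₂) / (‖v (S.branch h x₂)‖ : ℂ)
  set W := v (S.branch k x₁) / (‖v (S.branch k x₁)‖ : ℂ)
  set W' := v (S.branch k x₂) / (‖v (S.branch k x₂)‖ : ℂ)
  -- If the arguments were γ-close at both points, the relative phase between them would be small
  -- too. `F α - 1` is written as four errors: two below γ, and two from the changes of direction of
  -- v, which add up to at most 2γ. This contradicts 4γ ≤ ‖F α - 1‖.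
  by_contra hcon
  push Not at hcon
  have q1 := (hcon x₁ hx₁).2.2
  have q2 := (hcon x₂ hx₂).2.2
  -- the phase differences at the two points
  set F : ℝ → ℂ := fun y => Complex.exp (Complex.I * (y : ℂ)) with hF
  have F1 : ∀ y, ‖F y‖ = 1 := fun y => Complex.norm_exp_I_mul_ofReal y
  have Fadd : ∀ y z, F (y + z) = F y * F z := by
    intro y z
    simp only [hF, ← Complex.exp_add]
    push_cast
    ring_nf
  set α := -t * ((S.r h x₁ - S.r k x₁) - (S.r h x₂ - S.r k x₂)) with hα
  have hα1 : c * R ≤ |α| := by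
    rw [hα, abs_mul, abs_neg]
    calc c * R = |t| * (c * (R / |t|)) := by field_simp
      _ ≤ _ := by gcongr
  -- The condition on R prevents the phase from wrapping around the circle.
  have hα2 : |α| ≤ Real.pi := by
    have e1 := abs_le.1 (hS.r_lip h x₁ x₂)
    have e2 := abs_le.1 (hS.r_lip k x₁ x₂)
    have : |(S.r h x₁ - S.r k x₁) - (S.r h x₂ - S.r k x₂)| ≤ 2 * C₂ * d := by
      rw [abs_le]
      constructor <;> linarith [e1.1, e1.2, e2.1, e2.2]
    rw [hα, abs_mul, abs_neg]
    calc _ ≤ |t| * (2 * C₂ * (2 * R / |t|)) := by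
          have := this.trans (show 2 * C₂ * d ≤ 2 * C₂ * (2 * R / |t|) by gcongr)
          gcongr
      _ = 4 * C₂ * R := by field_simp; ring
      _ ≤ _ := hR
  have hlow := Complex.two_div_pi_mul_abs_le_norm_exp_sub_one hα2
  have hlow' : 4 * γ ≤ ‖F α - 1‖ := hγ.trans (le_trans (by gcongr) hlow)
  have e1 : F (-t * S.r h x₁) = F α * F (-t * S.r k x₁) * F (-t * S.r h x₂) * F (t * S.r k x₂) := by
    rw [← Fadd, ← Fadd, ← Fadd]
    congr 1
    rw [hα]; ring
  have e2 : F (-t * S.r k x₂) * F (t * S.r k x₂) = 1 := by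
    rw [← Fadd]; simp [hF]
  -- combine
  set G := F (-t * S.r k x₁) * F (-t * S.r h x₂) * F (t * S.r k x₂) with hG
  have G1 : ‖G‖ = 1 := by simp [hG, F1]
  have comb : (F α - 1) * (G * V) = (F (-t * S.r h x₁) * V - F (-t * S.r k x₁) * W)
      - F (-t * S.r k x₁) * F (t * S.r k x₂) *
        (F (-t * S.r h x₂) * V' - F (-t * S.r k x₂) * W')
      + F (-t * S.r k x₁) * (W - W') - G * (V - V') := by
    linear_combination -V * e1 + F (-t * S.r k x₁) * W' * (-e2)
  have n1 : ‖(F α - 1) * (G * V)‖ = ‖F α - 1‖ := by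
    rw [norm_mul, norm_mul, G1, oh1]; ring
  have n2 : ‖(F α - 1) * (G * V)‖ ≤ ‖F (-t * S.r h x₁) * V - F (-t * S.r k x₁) * W‖ +
      ‖F (-t * S.r h x₂) * V' - F (-t * S.r k x₂) * W'‖ + ‖W - W'‖ + ‖V - V'‖ := by
    rw [comb]
    refine (norm_sub_le _ _).trans (add_le_add ((norm_add_le _ _).trans
      (add_le_add ((norm_sub_le _ _).trans (add_le_add le_rfl ?_)) ?_)) ?_)
    · rw [norm_mul, norm_mul, F1, F1]; simp
    · rw [norm_mul, F1, one_mul]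
    · rw [norm_mul, G1, one_mul]
  have q1' : ‖F (-t * S.r h x₁) * V - F (-t * S.r k x₁) * W‖ < γ := q1
  have q2' : ‖F (-t * S.r h x₂) * V' - F (-t * S.r k x₂) * W'‖ < γ := q2
  linarith

end BranchSystem

/-! ### Separated nets, bump functions and comparison of masses -/

section Net

variable {X : Type*} [PseudoMetricSpace X]

lemma exists_maximal_separated (G : Set X) {δ : ℝ} (hδ : 0 < δ) :
    ∃ N ⊆ G, (∀ x ∈ N, ∀ y ∈ N, x ≠ y → δ ≤ dist x y) ∧ ∀ x ∈ G, ∃ y ∈ N, dist x y < δ := by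
  obtain ⟨N, hN⟩ := zorn_subset {N : Set X | N ⊆ G ∧ ∀ x ∈ N, ∀ y ∈ N, x ≠ y → δ ≤ dist x y} (by
    intro c hc hchain
    refine ⟨⋃₀ c, ⟨Set.sUnion_subset fun s hs => (hc hs).1, ?_⟩, fun s hs =>
      Set.subset_sUnion_of_mem hs⟩
    rintro x ⟨s, hs, hx⟩ y ⟨s', hs', hy⟩ hxy
    rcases hchain.total hs hs' with h | h
    · exact (hc hs').2 x (h hx) y hy hxy
    · exact (hc hs).2 x hx y (h hy) hxy)
  refine ⟨N, hN.prop.1, hN.prop.2, fun x hx => ?_⟩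
  by_contra hcon
  push Not at hcon
  have hxN : x ∈ N := by
    refine hN.le_of_ge (y := insert x N) ⟨Set.insert_subset hx hN.prop.1, ?_⟩
      (Set.subset_insert x N) (Set.mem_insert x N)
    rintro y (rfl | hy) z (rfl | hz) hyz
    · exact absurd rfl hyz
    · exact hcon z hz
    · rw [dist_comm]; exact hcon y hy
    · exact hN.prop.2 y hy z hz hyz
  have := hcon x hxN
  rw [dist_self] at this
  linarith

/-- A Lipschitz bump function equal to `1` close to `N` and supported in a neighborhood of `N`. -/
lemma exists_bump (N : Set X) {ρ : ℝ} (hρ : 0 < ρ) :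
    ∃ b : X → ℝ, (∀ x, 0 ≤ b x) ∧ (∀ x, b x ≤ 1) ∧ (∀ x y, |b x - b y| ≤ dist x y / ρ) ∧
      (∀ y ∈ N, ∀ x, dist x y < ρ → b x = 1) ∧ ∀ x, 0 < b x → ∃ y ∈ N, dist x y < 2 * ρ := by
  rcases N.eq_empty_or_nonempty with rfl | hN
  · exact ⟨fun _ => 0, by simp, by simp, fun x y => by simp; positivity, by simp, by simp⟩
  refine ⟨fun x => max 0 (min 1 (2 - Metric.infDist x N / ρ)), fun x => le_max_left _ _,
    fun x => max_le zero_le_one (min_le_left _ _), fun x y => ?_, fun y hy x hx => ?_,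
    fun x hx => ?_⟩
  · have h1 : |Metric.infDist x N - Metric.infDist y N| ≤ dist x y := by
      rw [abs_sub_le_iff]
      exact ⟨by linarith [Metric.infDist_le_infDist_add_dist (s := N) (x := x) (y := y)],
        by linarith [Metric.infDist_le_infDist_add_dist (s := N) (x := y) (y := x), dist_comm x y]⟩
    calc |max 0 (min 1 (2 - Metric.infDist x N / ρ)) - max 0 (min 1 (2 - Metric.infDist y N / ρ))|
        ≤ |min 1 (2 - Metric.infDist x N / ρ) - min 1 (2 - Metric.infDist y N / ρ)| := by
          refine (abs_max_sub_max_le_max _ _ _ _).trans ?_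
          simp
      _ ≤ |(2 - Metric.infDist x N / ρ) - (2 - Metric.infDist y N / ρ)| := by
          refine (abs_min_sub_min_le_max _ _ _ _).trans ?_
          simp
      _ = |Metric.infDist x N - Metric.infDist y N| / ρ := by
          rw [abs_sub_comm, sub_sub_sub_cancel_left, ← sub_div, abs_div, abs_of_pos hρ]
      _ ≤ _ := by gcongr
  · have h1 : Metric.infDist x N / ρ ≤ 1 := by
      rw [div_le_one hρ]
      exact (Metric.infDist_le_dist_of_mem hy).trans hx.le
    change max 0 (min 1 (2 - Metric.infDist x N / ρ)) = 1
    rw [min_eq_left (by linarith), max_eq_right zero_le_one]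
  · have h1 : 0 < 2 - Metric.infDist x N / ρ := by
      by_contra hcon
      have : max 0 (min 1 (2 - Metric.infDist x N / ρ)) = 0 :=
        max_eq_left ((min_le_right _ _).trans (not_lt.1 hcon))
      simp [this] at hx
    have h2 : Metric.infDist x N < 2 * ρ := by
      rw [sub_pos, div_lt_iff₀ hρ] at h1
      exact h1
    exact (Metric.infDist_lt_iff hN).1 h2

variable [MeasurableSpace X] [OpensMeasurableSpace X]

/-- The mass of a function with slowly varying logarithm is comparable to its mass on a union of
balls whose enlargements cover the space. -/
lemma lintegral_le_lintegral_iUnion_ball (μ : Measure X) [IsFiniteMeasure μ]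
    (hpos : ∀ (x : X) (ρ : ℝ), 0 < ρ → 0 < μ (Metric.ball x ρ)) {N : Set X} {ρ C A b : ℝ}
    (hρ : 0 < ρ) (hb : 0 ≤ b) (hA : 0 ≤ A) (hsep : ∀ x ∈ N, ∀ y ∈ N, x ≠ y → 2 * ρ ≤ dist x y)
    (hcov : ∀ x, ∃ y ∈ N, dist x y < C * ρ)
    (hdoub : ∀ y ∈ N, μ (Metric.ball y (C * ρ)) ≤ ENNReal.ofReal A * μ (Metric.ball y ρ))
    {w : X → ℝ} (hw : LogLip b w) :
    ∫⁻ x, ENNReal.ofReal (w x) ∂μ ≤ ENNReal.ofReal (A * Real.exp (b * (C + 1) * ρ)) *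
      ∫⁻ x in ⋃ y ∈ N, Metric.ball y ρ, ENNReal.ofReal (w x) ∂μ := by
  have hdisj : Pairwise (Function.onFun Disjoint fun y : N => Metric.ball (y : X) ρ) := by
    intro y z hyz
    have := hsep y y.2 z z.2 (fun h => hyz (Subtype.ext h))
    exact Metric.ball_disjoint_ball (by linarith)
  -- Disjoint balls of positive measure in a finite measure space are countably many; this is needed
  -- to sum over the net.
  have hcount : Countable N := by
    have := Measure.countable_meas_pos_of_disjoint_iUnion (μ := μ)
      (fun y : N => Metric.isOpen_ball.measurableSet) hdisj
    have e : {y : N | 0 < μ (Metric.ball (y : X) ρ)} = Set.univ :=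
      Set.eq_univ_of_forall fun y => hpos y ρ hρ
    rw [e] at this
    exact Set.countable_univ_iff.1 this
  have hU : (⋃ y ∈ N, Metric.ball y ρ) = ⋃ y : N, Metric.ball (y : X) ρ := by
    rw [Set.biUnion_eq_iUnion]
  have hcov' : (⋃ y : N, Metric.ball (y : X) (C * ρ)) = Set.univ := by
    refine Set.eq_univ_of_forall fun x => ?_
    obtain ⟨y, hy, hxy⟩ := hcov x
    exact Set.mem_iUnion.2 ⟨⟨y, hy⟩, hxy⟩
  rw [hU, lintegral_iUnion (fun y : N => Metric.isOpen_ball.measurableSet) hdisj,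
    ← ENNReal.tsum_mul_left]
  calc ∫⁻ x, ENNReal.ofReal (w x) ∂μ
      = ∫⁻ x in ⋃ y : N, Metric.ball (y : X) (C * ρ), ENNReal.ofReal (w x) ∂μ := by
        rw [hcov', setLIntegral_univ]
    _ ≤ ∑' y : N, ∫⁻ x in Metric.ball (y : X) (C * ρ), ENNReal.ofReal (w x) ∂μ :=
        lintegral_iUnion_le _ _
    _ ≤ _ := by
        refine ENNReal.tsum_le_tsum fun y => ?_
        -- On the large ball w is at most w(y)e^{bCρ}, on the small ball at least w(y)e^{-bρ}; the
        -- measures of the two balls are compared by doubling.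
        have hwy := hw.nonneg (y : X)
        calc ∫⁻ x in Metric.ball (y : X) (C * ρ), ENNReal.ofReal (w x) ∂μ
            ≤ ∫⁻ x in Metric.ball (y : X) (C * ρ),
              ENNReal.ofReal (w y * Real.exp (b * (C * ρ))) ∂μ := by
              refine setLIntegral_mono measurable_const fun x hx => ?_
              refine ENNReal.ofReal_le_ofReal ((hw.le x y).trans ?_)
              have := (Metric.mem_ball.1 hx).le
              gcongr
          _ = ENNReal.ofReal (w y * Real.exp (b * (C * ρ))) * μ (Metric.ball (y : X) (C * ρ)) := by
              rw [setLIntegral_const]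
          _ ≤ ENNReal.ofReal (w y * Real.exp (b * (C * ρ))) *
              (ENNReal.ofReal A * μ (Metric.ball (y : X) ρ)) := by
              gcongr
              exact hdoub y y.2
          _ = ENNReal.ofReal (A * Real.exp (b * (C + 1) * ρ)) *
              ∫⁻ x in Metric.ball (y : X) ρ, ENNReal.ofReal (w y * Real.exp (-(b * ρ))) ∂μ := by
              rw [setLIntegral_const, ← mul_assoc (ENNReal.ofReal _) (ENNReal.ofReal _) _,
                ← mul_assoc (ENNReal.ofReal _) (ENNReal.ofReal _) _, ← ENNReal.ofReal_mul (by positivity), ← ENNReal.ofReal_mul (by positivity)]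
              congr 2
              have : Real.exp (b * (C * ρ))
                  = Real.exp (b * (C + 1) * ρ) * Real.exp (-(b * ρ)) := by
                rw [← Real.exp_add]; ring_nf
              rw [this]
              ring
          _ ≤ _ := by
              gcongr 1
              refine setLIntegral_mono' Metric.isOpen_ball.measurableSet fun x hx => ?_
              refine ENNReal.ofReal_le_ofReal ?_
              have h1 := hw.le (y : X) x
              have h2 : dist (y : X) x ≤ ρ := by rw [dist_comm]; exact (Metric.mem_ball.1 hx).le
              have h3 : w y ≤ w x * Real.exp (b * ρ) :=
                h1.trans (by have := hw.nonneg x; gcongr)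
              rw [Real.exp_neg, mul_inv_le_iff₀ (Real.exp_pos _)]
              exact h3

end Net

/-! ### A set of definite mass on which two branches cancel -/

/-- The part of the definition of a John domain that only involves the distance. -/
def JohnDoubling {X : Type*} [PseudoMetricSpace X] [MeasurableSpace X] (μ : Measure X) : Prop :=
  ∃ C₀ > (0 : ℝ), ∃ ε₀ > (0 : ℝ), ∀ C > (0 : ℝ), ∃ A > (0 : ℝ), ∀ ε, 0 < ε → ε < ε₀ → ∀ x : X,
    ∃ x' : X, dist x x' ≤ C₀ * ε ∧
      μ (Metric.ball x' (C * ε)) ≤ ENNReal.ofReal A * μ (Metric.ball x' ε)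

/-- The function `ψ` oscillates at every small scale around every point. -/
def Oscillates {X : Type*} [PseudoMetricSpace X] (ψ : X → ℝ) (c ρ₀ : ℝ) : Prop :=
  ∀ x, ∀ ρ, 0 < ρ → ρ < ρ₀ → ∃ x₁ x₂, dist x₁ x < ρ ∧ dist x₂ x < ρ ∧ c * ρ ≤ |ψ x₁ - ψ x₂|

namespace BranchSystem

variable {X ι : Type*} [PseudoMetricSpace X] {S : BranchSystem X ι} {θ C₁ C₂ : ℝ}
  [MeasurableSpace X] [OpensMeasurableSpace X]

/-- Dolgopyat's cancellation mechanism: the sum of the terms of two well-chosen branches is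
smaller than expected on a set which has a definite proportion of the mass. -/
theorem exists_cancellation_set (hS : S.IsRegular θ C₁ C₂) (hθ : 0 ≤ θ) (hθ4 : θ ≤ 1 / 4)
    (hC₁ : 0 ≤ C₁) (hC₂ : 0 ≤ C₂) {A R γ c ρ₀ : ℝ} (hA : 4 * (C₁ + 2 * C₂) ≤ A) (hA0 : 0 < A)
    (hR0 : 0 < R) (hγ0 : 0 < γ) (hγ1 : γ ≤ 1) (hρ₀ : 0 < ρ₀)
    (hγ : 4 * γ ≤ 2 / Real.pi * (c * R)) (hR : 4 * C₂ * R ≤ Real.pi)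
    (hE : 8 * (Real.exp (A * θ * (2 * R)) - 1) ≤ 2 * γ)
    {μ : Measure X} [IsFiniteMeasure μ]
    (hpos : ∀ (x : X) (ρ : ℝ), 0 < ρ → 0 < μ (Metric.ball x ρ)) (hJ : JohnDoubling μ)
    {h k : ι} (hosc : Oscillates (fun x => S.r h x - S.r k x) c ρ₀) (B : ℝ) (hB : 0 ≤ B) :
    ∃ δ > 0, ∃ T₀ ≥ 1, ∃ K > 0, ∀ σ t : ℝ, |σ| ≤ 1 → T₀ ≤ |t| → ∀ (u : X → ℝ) (v : X → ℂ),
      LogLip (A * |t|) u → Dominated (A * |t|) u v →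
      ∃ (b₁ b₂ : X → ℝ) (Y : Set X), MeasurableSet Y ∧
        (∀ x, 0 ≤ b₁ x ∧ b₁ x ≤ 1) ∧ (∀ x, 0 ≤ b₂ x ∧ b₂ x ≤ 1) ∧
        (∀ x y, |b₁ x - b₁ y| ≤ |t| * dist x y / δ) ∧
        (∀ x y, |b₂ x - b₂ y| ≤ |t| * dist x y / δ) ∧
        (∀ x ∈ Y, b₁ x = 1 ∨ b₂ x = 1) ∧
        (∀ x, ‖S.coeff (σ + t * Complex.I) h x * v (S.branch h x) +
            S.coeff (σ + t * Complex.I) k x * v (S.branch k x)‖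
          ≤ (1 - γ ^ 2 / 64 * b₁ x) * (S.wt σ h x * u (S.branch h x)) +
            (1 - γ ^ 2 / 64 * b₂ x) * (S.wt σ k x * u (S.branch k x))) ∧
        ∀ w : X → ℝ, LogLip (B * |t|) w → ∫⁻ x, ENNReal.ofReal (w x) ∂μ ≤
          ENNReal.ofReal K * ∫⁻ x in Y, ENNReal.ofReal (w x) ∂μ := by
  obtain ⟨C₀, hC₀, ε₀, hε₀, hdoub⟩ := hJ
  -- Chosen so that a function with constant A|t|/2 varies by exactly the factor 1 + γ/16 over the
  -- distance ε/|t|.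
  set ε := 2 * Real.log (1 + γ / 16) / A with hε
  have hεpos : 0 < ε := by
    have : 0 < Real.log (1 + γ / 16) := Real.log_pos (by linarith)
    positivity
  -- With ρ = e₀/|t|, moving by C₀ρ to a doubling centre and then by 2ρ inside its ball stays within
  -- ε/|t| of the cancellation point.
  set e₀ := ε / (C₀ + 2) with he₀
  have he₀pos : 0 < e₀ := by positivity
  -- Cρ is the covering radius of the net: R/|t| to a cancellation point, C₀ρ to a doubling centre,
  -- 2ρ to the net.
  set C := R / e₀ + C₀ + 2 with hC
  have hCpos : 0 < C := by positivity
  obtain ⟨D, hD, hdoub⟩ := hdoub C hCpos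
  -- The threshold on |t| guarantees ρ < ε₀ for the John property and R/|t| < ρ₀ for the
  -- oscillation.
  refine ⟨e₀, he₀pos, max 1 (max (e₀ / ε₀ + 1) (R / ρ₀ + 1)), le_max_left _ _,
    D * Real.exp (B * (C + 1) * e₀), by positivity, ?_⟩
  intro σ t hσ ht u v hu hv
  have ht1 : 1 ≤ |t| := (le_max_left _ _).trans ht
  have ht2 : e₀ / ε₀ < |t| := by
    have := ((le_max_left _ _).trans (le_max_right _ _)).trans ht
    linarith
  have ht3 : R / ρ₀ < |t| := by
    have := ((le_max_right _ _).trans (le_max_right _ _)).trans ht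
    linarith
  have htpos : 0 < |t| := by linarith
  set s : ℂ := σ + t * Complex.I with hs
  have hre : s.re = σ := by simp [hs]
  have hsn : ‖s‖ ≤ 2 * |t| := by
    rw [hs]
    refine (norm_add_le _ _).trans ?_
    rw [norm_mul, Complex.norm_I, mul_one, Complex.norm_real, Complex.norm_real,
      Real.norm_eq_abs, Real.norm_eq_abs]
    linarith
  have hb : C₁ + ‖s‖ * C₂ + A * |t| * θ ≤ A * |t| / 2 := by
    have h1 : C₁ ≤ C₁ * |t| := by nlinarith
    have h2 : ‖s‖ * C₂ ≤ 2 * |t| * C₂ := by gcongr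
    have h3 : A * |t| * θ ≤ A * |t| * (1 / 4) := by gcongr
    have h4 : 4 * (C₁ + 2 * C₂) * |t| ≤ A * |t| := by gcongr
    nlinarith
  have hb' : C₁ + |σ| * C₂ + A * |t| * θ ≤ A * |t| / 2 := by
    refine le_trans ?_ hb
    have : |σ| ≤ ‖s‖ := by rw [← hre]; exact Complex.abs_re_le_norm s
    gcongr
  have ha : 0 ≤ A * |t| := by positivity
  have LL : ∀ i, LogLip (A * |t| / 2) (fun x => S.wt σ i x * u (S.branch i x)) := fun i =>
    (hS.logLip_term σ i ha hu).mono hb'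
  have DD : ∀ i, Dominated (A * |t| / 2) (fun x => S.wt σ i x * u (S.branch i x))
      (fun x => S.coeff s i x * v (S.branch i x)) := fun i => by
    have := (hS.dominated_term hC₁ hC₂ s i ha hu hv).mono hb
    rwa [hre] at this
  have hexp : Real.exp (A * |t| / 2 * (ε / |t|)) - 1 ≤ γ / 16 := by
    have : A * |t| / 2 * (ε / |t|) = Real.log (1 + γ / 16) := by
      rw [hε]; field_simp
    rw [this, Real.exp_log (by linarith)]
    linarith
  set ρ := e₀ / |t| with hρ
  have hρpos : 0 < ρ := by positivity
  set η := γ ^ 2 / 32 with hη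
  -- the two kinds of good points
  set P₁ : Set X := {y | ∀ x, dist x y < 2 * ρ →
    ‖S.coeff s h x * v (S.branch h x) + S.coeff s k x * v (S.branch k x)‖
      ≤ (1 - η) * (S.wt σ h x * u (S.branch h x)) + S.wt σ k x * u (S.branch k x)} with hP₁
  set P₂ : Set X := {y | ∀ x, dist x y < 2 * ρ →
    ‖S.coeff s h x * v (S.branch h x) + S.coeff s k x * v (S.branch k x)‖
      ≤ S.wt σ h x * u (S.branch h x) + (1 - η) * (S.wt σ k x * u (S.branch k x))} with hP₂
  set G : Set X := {y | (y ∈ P₁ ∨ y ∈ P₂) ∧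
    μ (Metric.ball y (C * ρ)) ≤ ENNReal.ofReal D * μ (Metric.ball y ρ)} with hG
  have hGcov : ∀ x, ∃ y ∈ G, dist x y < R / |t| + C₀ * ρ := by
    intro x
    obtain ⟨x₁, x₂, hx₁, hx₂, hx⟩ := hosc x (R / |t|) (by positivity) (by
      rw [div_lt_iff₀ htpos]; rw [div_lt_iff₀ hρ₀] at ht3; linarith)
    obtain ⟨p, hp, hp'⟩ := exists_point_of_oscillation hS ha hθ hγ hR hC₂ (σ := σ) (t := t) htpos
      (by
        have : A * |t| * θ * (2 * R / |t|) = A * θ * (2 * R) := by field_simp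
        rwa [this]) hv hx₁ hx₂ hx
    obtain ⟨y, hy1, hy2⟩ := hdoub ρ hρpos (by
      rw [hρ, div_lt_iff₀ htpos]; rw [div_lt_iff₀ hε₀] at ht2; linarith) p
    refine ⟨y, ⟨?_, hy2⟩, ?_⟩
    · have hball : ∀ x, dist x y < 2 * ρ → dist x p < ε / |t| := by
        intro x hx
        have : ε / |t| = C₀ * ρ + 2 * ρ := by
          rw [hρ, he₀]; field_simp
        have := dist_triangle_right x p y
        linarith
      refine (exists_cancellation (by positivity) hγ0.le hγ1 hexp (LL h) (LL k) (DD h) (DD k) p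
        hp').imp ?_ ?_
      · exact fun H x hx => H x (hball x hx)
      · exact fun H x hx => H x (hball x hx)
    · have := dist_triangle_left x y p
      rw [dist_comm p y] at *
      linarith [dist_comm y p]
  obtain ⟨N, hNG, hNsep, hNcov⟩ := exists_maximal_separated G (δ := 2 * ρ) (by positivity)
  have hcov : ∀ x, ∃ y ∈ N, dist x y < C * ρ := by
    intro x
    obtain ⟨y, hy, hxy⟩ := hGcov x
    obtain ⟨z, hz, hyz⟩ := hNcov y hy
    refine ⟨z, hz, ?_⟩
    have : C * ρ = R / |t| + C₀ * ρ + 2 * ρ := by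
      rw [hC, hρ]; field_simp
    have := dist_triangle x y z
    linarith
  obtain ⟨b₁, b₁0, b₁1, b₁lip, b₁N, b₁s⟩ := exists_bump (N ∩ P₁) hρpos
  obtain ⟨b₂, b₂0, b₂1, b₂lip, b₂N, b₂s⟩ := exists_bump (N ∩ P₂) hρpos
  have hlip : ∀ x y : X, dist x y / ρ = |t| * dist x y / e₀ := by
    intro x y; rw [hρ]; field_simp
  refine ⟨b₁, b₂, ⋃ y ∈ N, Metric.ball y ρ,
    (isOpen_biUnion fun y _ => Metric.isOpen_ball).measurableSet, fun x => ⟨b₁0 x, b₁1 x⟩,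
    fun x => ⟨b₂0 x, b₂1 x⟩, fun x y => (hlip x y) ▸ b₁lip x y, fun x y => (hlip x y) ▸ b₂lip x y,
    ?_, ?_, ?_⟩
  · intro x hx
    obtain ⟨y, hy, hxy⟩ := Set.mem_iUnion₂.1 hx
    exact (hNG hy).1.imp (fun hP => b₁N y ⟨hy, hP⟩ x hxy) (fun hP => b₂N y ⟨hy, hP⟩ x hxy)
  · intro x
    have n1 := (LL h).nonneg x
    have n2 := (LL k).nonneg x
    have triv := (norm_add_le (S.coeff s h x * v (S.branch h x))
      (S.coeff s k x * v (S.branch k x))).trans (add_le_add ((DD h).norm_le x) ((DD k).norm_le x))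
    have i1 : ‖S.coeff s h x * v (S.branch h x) + S.coeff s k x * v (S.branch k x)‖
        ≤ (1 - η * b₁ x) * (S.wt σ h x * u (S.branch h x)) + S.wt σ k x * u (S.branch k x) := by
      rcases (b₁0 x).eq_or_lt with h0 | h0
      · rw [← h0]; linarith
      · obtain ⟨y, hy, hxy⟩ := b₁s x h0
        refine (hy.2 x hxy).trans ?_
        have : η * b₁ x ≤ η := mul_le_of_le_one_right (by positivity) (b₁1 x)
        gcongr
    have i2 : ‖S.coeff s h x * v (S.branch h x) + S.coeff s k x * v (S.branch k x)‖
        ≤ S.wt σ h x * u (S.branch h x) + (1 - η * b₂ x) * (S.wt σ k x * u (S.branch k x)) := by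
      rcases (b₂0 x).eq_or_lt with h0 | h0
      · rw [← h0]; linarith
      · obtain ⟨y, hy, hxy⟩ := b₂s x h0
        refine (hy.2 x hxy).trans ?_
        have : η * b₂ x ≤ η := mul_le_of_le_one_right (by positivity) (b₂1 x)
        gcongr
    -- Where both bumps are positive only one reduction is available at a time. Averaging the two
    -- bounds keeps both reductions with half of the gain.
    have e : γ ^ 2 / 64 = η / 2 := by rw [hη]; ring
    rw [e]
    linarith
  · intro w hw
    have := lintegral_le_lintegral_iUnion_ball μ hpos hρpos (by positivity) hD.le hNsep hcov
      (fun y hy => (hNG hy).2) hw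
    have e : B * |t| * (C + 1) * ρ = B * (C + 1) * e₀ := by rw [hρ]; field_simp
    rwa [e] at this

end BranchSystem

section LogLip

variable {X : Type*} [PseudoMetricSpace X]

lemma LogLip.continuous {a : ℝ} {u : X → ℝ} (hu : LogLip a u) (ha : 0 ≤ a) : Continuous u := by
  rw [continuous_iff_continuousAt]
  intro y
  have hb : ∀ x, |u x - u y| ≤ u y * (Real.exp (a * dist x y) - 1) := by
    intro x
    have h1 := hu.le x y
    have h2 := hu.le y x
    rw [dist_comm] at h2
    have h3 : 1 ≤ Real.exp (a * dist x y) := Real.one_le_exp (by positivity)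
    have h4 := hu.nonneg x
    have h5 := hu.nonneg y
    rw [abs_sub_le_iff]
    constructor
    · linarith
    · rcases le_total (u y) (u x) with h | h
      · nlinarith
      · nlinarith
  rw [ContinuousAt, tendsto_iff_dist_tendsto_zero]
  refine squeeze_zero (fun _ => dist_nonneg) hb ?_
  have : Continuous fun x => u y * (Real.exp (a * dist x y) - 1) := by fun_prop
  simpa using this.tendsto y

lemma LogLip.exists_bound {a : ℝ} {u : X → ℝ} (hu : LogLip a u) (ha : 0 ≤ a) {D : ℝ}
    (hD : ∀ x y : X, dist x y ≤ D) : ∃ M, 0 ≤ M ∧ ∀ x, u x ≤ M := by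
  rcases isEmpty_or_nonempty X with h | ⟨⟨y⟩⟩
  · exact ⟨0, le_rfl, fun x => (h.false x).elim⟩
  · refine ⟨u y * Real.exp (a * D), mul_nonneg (hu.nonneg y) (Real.exp_pos _).le, fun x => ?_⟩
    refine (hu.le x y).trans ?_
    have := hu.nonneg y
    have := hD x y
    gcongr

lemma LogLip.tsum {ι : Type*} {a : ℝ} {f : ι → X → ℝ} (hf : ∀ i, LogLip a (f i))
    (hs : ∀ x, Summable fun i => f i x) : LogLip a (fun x => ∑' i, f i x) := by
  refine ⟨fun x => tsum_nonneg fun i => (hf i).nonneg x, fun x y => ?_⟩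
  rw [← tsum_mul_right]
  exact (hs x).tsum_le_tsum (fun i => (hf i).le x y) ((hs y).mul_right _)

/-- Since 1 - ηb ≥ 1/2, passing to the logarithm at most doubles the Lipschitz constant; a small η
thus makes the cutoff as flat as desired. -/
lemma LogLip.one_sub {η L : ℝ} (hη : 0 ≤ η) (hη2 : η ≤ 1 / 2) {b : X → ℝ}
    (hb : ∀ x, 0 ≤ b x ∧ b x ≤ 1) (hL : ∀ x y, |b x - b y| ≤ L * dist x y) :
    LogLip (2 * η * L) (fun x => 1 - η * b x) := by
  have hpos : ∀ x, 1 / 2 ≤ 1 - η * b x := fun x => by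
    have := mul_le_of_le_one_right hη (hb x).2
    linarith
  refine ⟨fun x => by linarith [hpos x], fun x y => ?_⟩
  have h1 : b y - b x ≤ L * dist x y := by
    have := hL y x
    rw [dist_comm] at this
    exact (le_abs_self _).trans this
  have h0 : 0 ≤ L * dist x y := (abs_nonneg _).trans (hL x y)
  have h2 := Real.add_one_le_exp (2 * η * L * dist x y)
  have h3 : η * (b y - b x) ≤ η * (L * dist x y) := by gcongr
  calc 1 - η * b x ≤ (1 - η * b y) + η * (L * dist x y) := by linarith
    _ ≤ (1 - η * b y) * (2 * η * L * dist x y + 1) := by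
        have := hpos y
        nlinarith [mul_nonneg hη h0]
    _ ≤ _ := by
        have := hpos y
        gcongr

end LogLip

lemma norm_tsum_le_of_pair {ι : Type*} {f : ι → ℂ} {a χ : ι → ℝ} {h k : ι} (hhk : h ≠ k)
    (hfa : ∀ i, ‖f i‖ ≤ a i) (ha : Summable a) (hχ : ∀ i, 0 ≤ χ i ∧ χ i ≤ 1)
    (hχ1 : ∀ i, i ≠ h → i ≠ k → χ i = 1)
    (hpair : ‖f h + f k‖ ≤ χ h * a h + χ k * a k) :
    ‖∑' i, f i‖ ≤ ∑' i, χ i * a i := by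
  classical
  have ha0 : ∀ i, 0 ≤ a i := fun i => (norm_nonneg _).trans (hfa i)
  have hf : Summable f := Summable.of_norm_bounded ha hfa
  have hχa : Summable fun i => χ i * a i :=
    Summable.of_nonneg_of_le (fun i => mul_nonneg (hχ i).1 (ha0 i))
      (fun i => mul_le_of_le_one_left (ha0 i) (hχ i).2) ha
  rw [← hf.sum_add_tsum_compl (s := {h, k}), ← hχa.sum_add_tsum_compl (s := {h, k}),
    Finset.sum_pair hhk, Finset.sum_pair hhk]
  refine (norm_add_le _ _).trans (add_le_add hpair ?_)
  refine tsum_of_norm_bounded (hχa.subtype _).hasSum fun i => ?_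
  have hi : (i : ι) ≠ h ∧ (i : ι) ≠ k := by simpa using i.2
  simpa [hχ1 i hi.1 hi.2] using hfa i

/-! ### Weighted L² estimates -/

namespace BranchSystem

variable {X ι : Type*} [PseudoMetricSpace X] {S : BranchSystem X ι} {θ C₁ C₂ : ℝ}
  [MeasurableSpace X] [OpensMeasurableSpace X]

/-- The operator with weights `J` preserves the integral with respect to `μ`. -/
structure PreservesIntegral (S : BranchSystem X ι) (μ : Measure X) : Prop where
  measurable_branch : ∀ i, Measurable (S.branch i)
  tsum_lintegral : ∀ f : X → ℝ≥0∞, Measurable f →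
    ∑' i, ∫⁻ x, ENNReal.ofReal (S.J i x) * f (S.branch i x) ∂μ = ∫⁻ x, f x ∂μ

lemma PreservesIntegral.pow {μ : Measure X} (h : S.PreservesIntegral μ)
    (hS : S.IsRegular θ C₁ C₂) (hθ : 0 ≤ θ) (hθ1 : θ < 1) (hC₁ : 0 ≤ C₁) (hC₂ : 0 ≤ C₂) (n : ℕ) :
    (S.pow n).PreservesIntegral μ := by
  induction n with
  | zero =>
    refine ⟨fun _ => measurable_id, fun f _ => ?_⟩
    have : Unique (Word ι 0) := inferInstanceAs (Unique PUnit)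
    rw [tsum_eq_single (default : Word ι 0) (fun b hb => absurd (Subsingleton.elim _ _) hb)]
    simp [BranchSystem.pow]
  | succ n ih =>
    refine ⟨fun w => (ih.measurable_branch _).comp (h.measurable_branch _), fun f hf => ?_⟩
    have hR := hS.pow hθ hθ1 hC₁ hC₂ n
    have hD1 : 0 ≤ C₁ / (1 - θ) := div_nonneg hC₁ (by linarith)
    refine (ENNReal.tsum_prod' (α := ι) (β := Word ι n) (f := fun p =>
      ∫⁻ x, ENNReal.ofReal ((S.pow (n + 1)).J p x) * f ((S.pow (n + 1)).branch p x) ∂μ)).trans ?_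
    rw [ENNReal.tsum_comm, ← ih.tsum_lintegral f hf]
    refine tsum_congr fun w => ?_
    have hm : Measurable fun x => ENNReal.ofReal ((S.pow n).J w x) * f ((S.pow n).branch w x) :=
      (((hR.logLip_J w).continuous hD1).measurable.ennreal_ofReal).mul
        (hf.comp (ih.measurable_branch w))
    rw [← h.tsum_lintegral _ hm]
    refine tsum_congr fun i => lintegral_congr fun x => ?_
    rw [← mul_assoc, ← ENNReal.ofReal_mul (hS.J_pos i x).le]
    rfl

lemma PreservesIntegral.lintegral_tsum [Countable ι] {μ : Measure X} (h : S.PreservesIntegral μ)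
    (hS : S.IsRegular θ C₁ C₂) (hC₁ : 0 ≤ C₁) {f : X → ℝ} (hf : Measurable f) (hf0 : ∀ x, 0 ≤ f x)
    (hs : ∀ x, Summable fun i => S.J i x * f (S.branch i x)) :
    ∫⁻ x, ENNReal.ofReal (∑' i, S.J i x * f (S.branch i x)) ∂μ
      = ∫⁻ x, ENNReal.ofReal (f x) ∂μ := by
  rw [← h.tsum_lintegral _ hf.ennreal_ofReal, ← MeasureTheory.lintegral_tsum]
  · refine lintegral_congr fun x => ?_
    rw [ENNReal.ofReal_tsum_of_nonneg (fun i => mul_nonneg (hS.J_pos i x).le (hf0 _)) (hs x)]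
    exact tsum_congr fun i => ENNReal.ofReal_mul (hS.J_pos i x).le
  · exact fun i => ((((hS.logLip_J i).continuous hC₁).measurable.ennreal_ofReal).mul
      (hf.ennreal_ofReal.comp (h.measurable_branch i))).aemeasurable

omit [PseudoMetricSpace X] [MeasurableSpace X] [OpensMeasurableSpace X] in
lemma wt_zero (S : BranchSystem X ι) (i : ι) (x : X) : S.wt 0 i x = S.J i x := by
  simp [wt]

omit [MeasurableSpace X] [OpensMeasurableSpace X] in
/-- Cauchy-Schwarz inequality for the transfer operator with cutoff `χ`. -/
lemma sq_tsum_wt_le (hS : S.IsRegular θ C₁ C₂) {σ : ℝ} {x : X} {χ : ι → ℝ} (hχ : ∀ i, 0 ≤ χ i)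
    {u g : X → ℝ} (hu : ∀ x, 0 ≤ u x) (hg : ∀ x, 0 < g x)
    (s1 : Summable fun i => χ i ^ 2 * (S.wt (2 * σ) i x * g (S.branch i x)))
    (s2 : Summable fun i => S.J i x * (u (S.branch i x) ^ 2 / g (S.branch i x))) :
    (∑' i, χ i * (S.wt σ i x * u (S.branch i x))) ^ 2 ≤
      (∑' i, χ i ^ 2 * (S.wt (2 * σ) i x * g (S.branch i x))) *
        ∑' i, S.J i x * (u (S.branch i x) ^ 2 / g (S.branch i x)) := by
  refine sq_tsum_le_tsum_mul_tsum
    (fun i => mul_nonneg (hχ i) (mul_nonneg (hS.wt_pos _ _ _).le (hu _)))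
    (fun i => mul_nonneg (sq_nonneg _) (mul_nonneg (hS.wt_pos _ _ _).le (hg _).le))
    (fun i => mul_nonneg (hS.J_pos _ _).le (div_nonneg (sq_nonneg _) (hg _).le))
    (fun i => le_of_eq ?_) s1 s2
  have hg' := (hg (S.branch i x)).ne'
  -- This identity explains the parameter 2σ for supersolutions: Cauchy-Schwarz splits the square of
  -- the weight into the weight at 2σ and the weight J.
  have e : S.wt (2 * σ) i x * S.J i x = S.wt σ i x ^ 2 := by
    simp only [wt]
    rw [show -(2 * σ) * S.r i x = -σ * S.r i x + -σ * S.r i x by ring, Real.exp_add]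
    ring
  calc (χ i * (S.wt σ i x * u (S.branch i x))) ^ 2
      = χ i ^ 2 * (S.wt σ i x ^ 2) * u (S.branch i x) ^ 2 := by ring
    _ = _ := by rw [← e]; field_simp

omit [MeasurableSpace X] [OpensMeasurableSpace X] in
/-- The weighted square `u² / g`. -/
lemma logLip_sq_div {a : ℝ} {u g : X → ℝ} (hu : LogLip a u) (hg : LogLip C₁ g)
    (hg0 : ∀ x, 0 < g x) : LogLip (2 * a + C₁) (fun x => u x ^ 2 / g x) := by
  have := (hu.mul hu).div hg hg0
  simpa only [sq, two_mul] using this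

omit [MeasurableSpace X] [OpensMeasurableSpace X] in
lemma summable_J_mul (hS : S.IsRegular θ C₁ C₂) {x : X} (hs : Summable fun i => S.J i x)
    {f : X → ℝ} {M : ℝ} (hf0 : ∀ x, 0 ≤ f x) (hf : ∀ x, f x ≤ M) :
    Summable fun i => S.J i x * f (S.branch i x) :=
  Summable.of_nonneg_of_le (fun i => mul_nonneg (hS.J_pos i x).le (hf0 _))
    (fun i => mul_le_mul_of_nonneg_left (hf _) (hS.J_pos i x).le) (hs.mul_right M)

/-- The weighted `L²` norm does not grow more than allowed by a supersolution. -/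
lemma lintegral_sq_transfer_le [Countable ι] (hS : S.IsRegular θ C₁ C₂) (hC₁ : 0 ≤ C₁)
    {μ : Measure X} (hμ : S.PreservesIntegral μ) {D : ℝ} (hD : ∀ x y : X, dist x y ≤ D)
    (hs : ∀ x, Summable fun i => S.J i x) {s : ℂ}
    {a : ℝ} (ha : 0 ≤ a) {u : X → ℝ} {v : X → ℂ} (hu : LogLip a u) (huv : ∀ x, ‖v x‖ ≤ u x)
    (hss : ∀ x, Summable fun i => S.wt s.re i x)
    {g : X → ℝ} {Λ : ℝ} (hg : LogLip C₁ g) (hg0 : ∀ x, 0 < g x) (hΛ : 0 ≤ Λ)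
    (hsup : S.SuperSol (2 * s.re) Λ g) :
    ∫⁻ x, ENNReal.ofReal (‖S.transfer s v x‖ ^ 2 / g x) ∂μ ≤
      ENNReal.ofReal Λ * ∫⁻ x, ENNReal.ofReal (u x ^ 2 / g x) ∂μ := by
  have hw := logLip_sq_div hu hg hg0
  have ha' : 0 ≤ 2 * a + C₁ := by positivity
  obtain ⟨M, hM0, hM⟩ := hw.exists_bound ha' hD
  obtain ⟨M', hM'0, hM'⟩ := hu.exists_bound ha hD
  have s2 := fun x => summable_J_mul hS (hs x) hw.nonneg hM
  rw [← hμ.lintegral_tsum hS hC₁ (hw.continuous ha').measurable hw.nonneg s2,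
    ← lintegral_const_mul' _ _ ENNReal.ofReal_ne_top]
  refine lintegral_mono fun x => ?_
  have hw0 : 0 ≤ ∑' i, S.J i x * (u (S.branch i x) ^ 2 / g (S.branch i x)) :=
    tsum_nonneg fun i => mul_nonneg (hS.J_pos _ _).le (hw.nonneg _)
  rw [← ENNReal.ofReal_mul hΛ]
  refine ENNReal.ofReal_le_ofReal ?_
  rw [div_le_iff₀ (hg0 x)]
  have h1 : ‖S.transfer s v x‖ ≤ ∑' i, 1 * (S.wt s.re i x * u (S.branch i x)) := by
    have : Summable fun i => S.wt s.re i x * u (S.branch i x) :=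
      Summable.of_nonneg_of_le (fun i => mul_nonneg (hS.wt_pos _ _ _).le (hu.nonneg _))
        (fun i => mul_le_mul_of_nonneg_left (hM' _) (hS.wt_pos _ _ _).le) ((hss x).mul_right M')
    simp only [one_mul]
    refine tsum_of_norm_bounded this.hasSum fun i => ?_
    rw [norm_mul, hS.norm_coeff]
    exact mul_le_mul_of_nonneg_left (huv _) (hS.wt_pos _ _ _).le
  have h2 := sq_tsum_wt_le hS (σ := s.re) (x := x) (χ := fun _ => 1) (fun _ => zero_le_one)
    hu.nonneg hg0 (by simpa using hsup.summable hS (fun x => (hg0 x).le) x) (s2 x)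
  have h3 := hsup.tsum_le hS (fun x => (hg0 x).le) hΛ x
  simp only [one_pow, one_mul] at h1 h2
  calc ‖S.transfer s v x‖ ^ 2 ≤ (∑' i, S.wt s.re i x * u (S.branch i x)) ^ 2 := by gcongr
    _ ≤ _ := h2
    _ ≤ (Λ * g x) * ∑' i, S.J i x * (u (S.branch i x) ^ 2 / g (S.branch i x)) := by gcongr
    _ = _ := by ring

end BranchSystem

/-! ### The contraction step for a block of branches -/

namespace BranchSystem

variable {X ι : Type*} [PseudoMetricSpace X] {S : BranchSystem X ι} {θ C₁ C₂ : ℝ}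
  [MeasurableSpace X] [OpensMeasurableSpace X]

omit [MeasurableSpace X] [OpensMeasurableSpace X] in
-- A single weight is log-Lipschitz on a bounded space, hence bounded below. Monotonicity in σ
-- reduces the whole range |σ| ≤ 1 to the extreme parameter 2.
lemma exists_wt_lower_bound (hS : S.IsRegular θ C₁ C₂) (hC₁ : 0 ≤ C₁) (hC₂ : 0 ≤ C₂) {D : ℝ}
    (hD : ∀ x y : X, dist x y ≤ D) (h : ι) :
    ∃ m > 0, ∀ σ : ℝ, |σ| ≤ 1 → ∀ x, m ≤ S.wt (2 * σ) h x := by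
  rcases isEmpty_or_nonempty X with he | ⟨⟨y⟩⟩
  · exact ⟨1, one_pos, fun _ _ x => (he.false x).elim⟩
  refine ⟨S.wt 2 h y * Real.exp (-((C₁ + 2 * C₂) * D)),
    mul_pos (hS.wt_pos _ _ _) (Real.exp_pos _), fun σ hσ x => ?_⟩
  have h1 := (hS.logLip_wt 2 h).le y x
  have h2 : S.wt 2 h y ≤ S.wt 2 h x * Real.exp ((C₁ + 2 * C₂) * D) := by
    refine h1.trans ?_
    have := (hS.wt_pos 2 h x).le
    have := hD y x
    rw [abs_of_pos (by norm_num : (0 : ℝ) < 2)]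
    gcongr
  rw [Real.exp_neg, mul_inv_le_iff₀ (Real.exp_pos _)]
  refine h2.trans ?_
  gcongr
  exact hS.wt_mono (by linarith [(abs_le.1 hσ).2]) h x

set_option maxHeartbeats 1000000 in
/-- One step of the Dolgopyat argument, for a block of branches. -/
theorem dolgopyat_step [Countable ι] (hS : S.IsRegular θ C₁ C₂) (hθ : 0 ≤ θ) (hθ4 : θ ≤ 1 / 4)
    (hC₁ : 0 ≤ C₁) (hC₂ : 0 ≤ C₂) {A R γ c ρ₀ : ℝ} (hA : 4 * (C₁ + 2 * C₂) ≤ A) (hA0 : 0 < A)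
    (hR0 : 0 < R) (hγ0 : 0 < γ) (hγ1 : γ ≤ 1) (hρ₀ : 0 < ρ₀)
    (hγ : 4 * γ ≤ 2 / Real.pi * (c * R)) (hR : 4 * C₂ * R ≤ Real.pi)
    (hE : 8 * (Real.exp (A * θ * (2 * R)) - 1) ≤ 2 * γ)
    {μ : Measure X} [IsFiniteMeasure μ]
    (hpos : ∀ (x : X) (ρ : ℝ), 0 < ρ → 0 < μ (Metric.ball x ρ)) (hJ : JohnDoubling μ)
    (hμ : S.PreservesIntegral μ) {D : ℝ} (hD : ∀ x y : X, dist x y ≤ D)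
    {σ₁ : ℝ} (hσ₁ : 0 ≤ σ₁) (hσ₁1 : σ₁ ≤ 1) (hs : ∀ σ x, |σ| ≤ σ₁ → Summable fun i => S.wt σ i x)
    {h k : ι} (hhk : h ≠ k) (hosc : Oscillates (fun x => S.r h x - S.r k x) c ρ₀) :
    ∃ η₀ > 0, ∃ T₀ ≥ 1, ∀ σ t : ℝ, |σ| ≤ σ₁ → T₀ ≤ |t| → ∀ (u : X → ℝ) (v : X → ℂ),
      LogLip (A * |t|) u → Dominated (A * |t|) u v →
      ∃ U : X → ℝ, LogLip (A * |t|) U ∧ Dominated (A * |t|) U (S.transfer (σ + t * Complex.I) v) ∧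
        ∀ (g : X → ℝ) (Λ : ℝ), LogLip C₁ g → (∀ x, 0 < g x) → 0 ≤ Λ → S.SuperSol (2 * σ) Λ g →
          ∫⁻ x, ENNReal.ofReal (U x ^ 2 / g x) ∂μ +
              ENNReal.ofReal η₀ * ∫⁻ x, ENNReal.ofReal (u x ^ 2 / g x) ∂μ ≤
            ENNReal.ofReal Λ * ∫⁻ x, ENNReal.ofReal (u x ^ 2 / g x) ∂μ := by
  classical
  obtain ⟨δ, hδ, T₀, hT₀, K, hK, hcanc⟩ := exists_cancellation_set hS hθ hθ4 hC₁ hC₂ hA hA0 hR0 hγ0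
    hγ1 hρ₀ hγ hR hE hpos hJ hosc (2 * C₁ + 2 * A) (by positivity)
  obtain ⟨m₁, hm₁, hm₁'⟩ := exists_wt_lower_bound hS hC₁ hC₂ hD h
  obtain ⟨m₂, hm₂, hm₂'⟩ := exists_wt_lower_bound hS hC₁ hC₂ hD k
  -- The first bound keeps the cutoff within the available cancellation; the second makes its
  -- logarithm Lipschitz of constant at most A|t|/2.
  set η := min (γ ^ 2 / 64) (A * δ / 4) with hη
  have hη0 : 0 < η := lt_min (by positivity) (by positivity)
  have hη2 : η ≤ 1 / 2 := (min_le_left _ _).trans (by nlinarith)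
  -- Lower bound for the share of g that either chosen branch contributes: the factor e^{-C₁D}
  -- compares g at the image point with g x.
  set m := min m₁ m₂ * Real.exp (-(C₁ * D)) with hm
  have hm0 : 0 < m := mul_pos (lt_min hm₁ hm₂) (Real.exp_pos _)
  -- A loss ηm on a set carrying at least the share 1/K of the mass. It is fixed before g and Λ are
  -- introduced, so Λ may later be tuned against it.
  refine ⟨η * m / K, by positivity, T₀, hT₀, ?_⟩
  intro σ t hσ ht u v hu hv
  have hσ1 := hσ.trans hσ₁1
  obtain ⟨b₁, b₂, Y, hY, hb₁, hb₂, hb₁l, hb₂l, hYb, hpair, hmass⟩ := hcanc σ t hσ1 ht u v hu hv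
  have ht1 : 1 ≤ |t| := hT₀.trans ht
  have htpos : 0 < |t| := by linarith
  set s : ℂ := σ + t * Complex.I with hs_def
  have hre : s.re = σ := by simp [hs_def]
  have hsn : ‖s‖ ≤ 2 * |t| := by
    rw [hs_def]
    refine (norm_add_le _ _).trans ?_
    rw [norm_mul, Complex.norm_I, mul_one, Complex.norm_real, Complex.norm_real,
      Real.norm_eq_abs, Real.norm_eq_abs]
    linarith
  have hb : C₁ + ‖s‖ * C₂ + A * |t| * θ ≤ A * |t| / 2 := by
    have h1 : C₁ ≤ C₁ * |t| := by nlinarith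
    have h2 : ‖s‖ * C₂ ≤ 2 * |t| * C₂ := by gcongr
    have h3 : A * |t| * θ ≤ A * |t| * (1 / 4) := by gcongr
    have h4 : 4 * (C₁ + 2 * C₂) * |t| ≤ A * |t| := by gcongr
    nlinarith
  have hb' : C₁ + |σ| * C₂ + A * |t| * θ ≤ A * |t| / 2 := by
    refine le_trans ?_ hb
    have : |σ| ≤ ‖s‖ := by rw [← hre]; exact Complex.abs_re_le_norm s
    gcongr
  have ha : 0 ≤ A * |t| := by positivity
  have LL : ∀ i, LogLip (A * |t| / 2) (fun x => S.wt σ i x * u (S.branch i x)) := fun i =>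
    (hS.logLip_term σ i ha hu).mono hb'
  have DD : ∀ i, Dominated (A * |t| / 2) (fun x => S.wt σ i x * u (S.branch i x))
      (fun x => S.coeff s i x * v (S.branch i x)) := fun i => by
    have := (hS.dominated_term hC₁ hC₂ s i ha hu hv).mono hb
    rwa [hre] at this
  -- the cutoff
  set χ : ι → X → ℝ := fun i x =>
    if i = h then 1 - η * b₁ x else if i = k then 1 - η * b₂ x else 1 with hχ
  have hχlip : ∀ i, LogLip (A * |t| / 2) (χ i) := by
    have hc : 2 * η * (|t| / δ) ≤ A * |t| / 2 := by
      have : η ≤ A * δ / 4 := min_le_right _ _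
      calc 2 * η * (|t| / δ) ≤ 2 * (A * δ / 4) * (|t| / δ) := by gcongr
        _ = _ := by field_simp; ring
    intro i
    by_cases hi : i = h
    · have e : χ i = fun x => 1 - η * b₁ x := by ext x; simp [hχ, hi]
      rw [e]
      exact (LogLip.one_sub hη0.le hη2 hb₁ (fun x y => by
        rw [div_mul_eq_mul_div]; exact hb₁l x y)).mono hc
    by_cases hi' : i = k
    · have e : χ i = fun x => 1 - η * b₂ x := by ext x; simp [hχ, hi', hhk.symm]
      rw [e]
      exact (LogLip.one_sub hη0.le hη2 hb₂ (fun x y => by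
        rw [div_mul_eq_mul_div]; exact hb₂l x y)).mono hc
    · have e : χ i = fun _ => 1 := by ext x; simp [hχ, hi, hi']
      rw [e]
      exact ⟨fun _ => zero_le_one, fun x y => by
        rw [one_mul]; exact Real.one_le_exp (by positivity)⟩
  have hχb : ∀ i x, 1 / 2 ≤ χ i x ∧ χ i x ≤ 1 := by
    intro i x
    have h1 := mul_le_of_le_one_right hη0.le (hb₁ x).2
    have h2 := mul_le_of_le_one_right hη0.le (hb₂ x).2
    have h3 := mul_nonneg hη0.le (hb₁ x).1
    have h4 := mul_nonneg hη0.le (hb₂ x).1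
    simp only [hχ]
    split_ifs
    · constructor <;> linarith
    · constructor <;> linarith
    · constructor <;> norm_num
  have hχ0 : ∀ i x, 0 ≤ χ i x := fun i x => by linarith [(hχb i x).1]
  obtain ⟨M, hM0, hM⟩ := hu.exists_bound ha hD
  have hsum : ∀ x, Summable fun i => S.wt σ i x * u (S.branch i x) := fun x =>
    Summable.of_nonneg_of_le (fun i => (LL i).nonneg x)
      (fun i => mul_le_mul_of_nonneg_left (hM _) (hS.wt_pos _ _ _).le) ((hs σ x hσ).mul_right M)
  have hsumχ : ∀ x, Summable fun i => χ i x * (S.wt σ i x * u (S.branch i x)) := fun x =>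
    Summable.of_nonneg_of_le (fun i => mul_nonneg (hχ0 i x) ((LL i).nonneg x))
      (fun i => mul_le_of_le_one_left ((LL i).nonneg x) (hχb i x).2) (hsum x)
  refine ⟨fun x => ∑' i, χ i x * (S.wt σ i x * u (S.branch i x)), ?_, ⟨?_, ?_⟩, ?_⟩
  · refine (LogLip.tsum (a := A * |t| / 2 + A * |t| / 2) (fun i => (hχlip i).mul (LL i))
      hsumχ).mono (by linarith)
  · intro x
    refine norm_tsum_le_of_pair (χ := fun i => χ i x) hhk (fun i => (DD i).norm_le x) (hsum x)
      (fun i => ⟨hχ0 i x, (hχb i x).2⟩) (fun i hi hi' => by simp [hχ, hi, hi']) ?_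
    refine (hpair x).trans ?_
    have e1 : χ h x = 1 - η * b₁ x := by simp [hχ]
    have e2 : χ k x = 1 - η * b₂ x := by simp [hχ, hhk.symm]
    have l := min_le_left (γ ^ 2 / 64) (A * δ / 4)
    have n1 := (LL h).nonneg x
    have n2 := (LL k).nonneg x
    have p1 := (hb₁ x).1
    have p2 := (hb₂ x).1
    rw [e1, e2]
    gcongr
  · intro x y
    have hsv : ∀ x, Summable fun i => S.coeff s i x * v (S.branch i x) := fun x =>
      Summable.of_norm_bounded (hsum x) fun i => (DD i).norm_le x
    simp only [transfer]
    rw [← (hsv x).tsum_sub (hsv y), ← tsum_mul_right]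
    refine tsum_of_norm_bounded ((hsumχ x).mul_right _).hasSum fun i => ?_
    refine ((DD i).norm_sub_le x y).trans ?_
    -- The majorant may have been halved by the cutoff, but each term varies with constant A|t|/2
    -- only, and doubling that constant recovers the factor.
    have h1 := Real.two_mul_exp_sub_one_le (a := A * |t| / 2 * dist x y) (by positivity)
    have h2 := (LL i).nonneg x
    have h3 : 0 ≤ Real.exp (A * |t| / 2 * dist x y) - 1 := by
      have := Real.one_le_exp (x := A * |t| / 2 * dist x y) (by positivity); linarith
    have e : Real.exp (2 * (A * |t| / 2 * dist x y)) = Real.exp (A * |t| * dist x y) := by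
      congr 1; ring
    rw [e] at h1
    calc S.wt σ i x * u (S.branch i x) * (Real.exp (A * |t| / 2 * dist x y) - 1)
        = (1 / 2 * (S.wt σ i x * u (S.branch i x))) *
          (2 * (Real.exp (A * |t| / 2 * dist x y) - 1)) := by ring
      _ ≤ (χ i x * (S.wt σ i x * u (S.branch i x))) * (Real.exp (A * |t| * dist x y) - 1) := by
          refine mul_le_mul (mul_le_mul_of_nonneg_right (hχb i x).1 h2) h1 (by positivity)
            (mul_nonneg (hχ0 i x) h2)
  · intro g Λ hg hg0 hΛ hsup
    have hf := logLip_sq_div hu hg hg0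
    have ha' : 0 ≤ 2 * (A * |t|) + C₁ := by positivity
    obtain ⟨M', hM'0, hM'⟩ := hf.exists_bound ha' hD
    have s2 : ∀ x, Summable fun i => S.J i x * (u (S.branch i x) ^ 2 / g (S.branch i x)) := fun x =>
      summable_J_mul hS (by
        have := hs 0 x (by simpa using hσ₁)
        simpa [wt] using this) hf.nonneg hM'
    -- The second Cauchy-Schwarz factor. It has the same integral as u²/g, and its logarithm has
    -- Lipschitz constant of order |t|, so its mass on Y is comparable to its total mass.
    set w : X → ℝ := fun x => ∑' i, S.J i x * (u (S.branch i x) ^ 2 / g (S.branch i x)) with hw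
    have hwlip : LogLip ((2 * C₁ + 2 * A) * |t|) w := by
      refine (LogLip.tsum (a := C₁ + (2 * (A * |t|) + C₁) * θ)
        (fun i => (hS.logLip_J i).mul (hf.comp ha' (hS.contr i))) s2).mono ?_
      have h1 : (2 * (A * |t|) + C₁) * θ ≤ (2 * (A * |t|) + C₁) * 1 := by
        gcongr; linarith
      nlinarith
    have hwint : ∫⁻ x, ENNReal.ofReal (w x) ∂μ = ∫⁻ x, ENNReal.ofReal (u x ^ 2 / g x) ∂μ :=
      hμ.lintegral_tsum hS hC₁ (hf.continuous ha').measurable hf.nonneg s2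
    have hwm : Measurable w := (hwlip.continuous (by positivity)).measurable
    -- pointwise estimate
    have hgh : ∀ i x, g x * Real.exp (-(C₁ * D)) ≤ g (S.branch i x) := by
      intro i x
      have h1 := hg.le x (S.branch i x)
      have h2 := hD x (S.branch i x)
      have h3 := hg.nonneg (S.branch i x)
      rw [Real.exp_neg, mul_inv_le_iff₀ (Real.exp_pos _)]
      exact h1.trans (by gcongr)
    have hptw : ∀ x, (∑' i, χ i x * (S.wt σ i x * u (S.branch i x))) ^ 2 / g x ≤
        (Λ - Y.indicator (fun _ => η * m) x) * w x := by
      intro x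
      have s0 := hsup.summable hS (fun x => (hg0 x).le) x
      have s1 : Summable fun i => χ i x ^ 2 * (S.wt (2 * σ) i x * g (S.branch i x)) :=
        Summable.of_nonneg_of_le
          (fun i => mul_nonneg (sq_nonneg _) (mul_nonneg (hS.wt_pos _ _ _).le (hg0 _).le))
          (fun i => mul_le_of_le_one_left (mul_nonneg (hS.wt_pos _ _ _).le (hg0 _).le)
            (pow_le_one₀ (hχ0 i x) (hχb i x).2)) s0
      have CS := sq_tsum_wt_le hS (σ := σ) (x := x) (χ := fun i => χ i x) (fun i => hχ0 i x)
        hu.nonneg hg0 s1 (s2 x)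
      have hw0 := hwlip.nonneg x
      have hbr : ∑' i, χ i x ^ 2 * (S.wt (2 * σ) i x * g (S.branch i x)) ≤
          (Λ - Y.indicator (fun _ => η * m) x) * g x := by
        have tot := hsup.tsum_le hS (fun x => (hg0 x).le) hΛ x
        have sd : Summable fun i => (1 - χ i x ^ 2) * (S.wt (2 * σ) i x * g (S.branch i x)) := by
          have := s0.sub s1
          refine this.congr fun i => ?_
          ring
        have split : ∑' i, χ i x ^ 2 * (S.wt (2 * σ) i x * g (S.branch i x)) =
            ∑' i, S.wt (2 * σ) i x * g (S.branch i x) -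
            ∑' i, (1 - χ i x ^ 2) * (S.wt (2 * σ) i x * g (S.branch i x)) := by
          rw [← s0.tsum_sub sd]
          refine tsum_congr fun i => ?_
          ring
        have hd0 : ∀ i, 0 ≤ (1 - χ i x ^ 2) * (S.wt (2 * σ) i x * g (S.branch i x)) := fun i =>
          mul_nonneg (by have := pow_le_one₀ (n := 2) (hχ0 i x) (hχb i x).2; linarith)
            (mul_nonneg (hS.wt_pos _ _ _).le (hg0 _).le)
        -- One branch with cutoff 1 - η already lowers the first factor, because 1 - (1 - η)² ≥ η
        -- when η ≤ 1.
        have hdef : ∀ i, χ i x = 1 - η → min m₁ m₂ ≤ S.wt (2 * σ) i x →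
            η * m * g x ≤ ∑' i, (1 - χ i x ^ 2) * (S.wt (2 * σ) i x * g (S.branch i x)) := by
          intro i hi hmi
          refine le_trans ?_ (sd.le_tsum i fun j _ => hd0 j)
          rw [hi]
          have h1 : η ≤ 1 - (1 - η) ^ 2 := by nlinarith
          calc η * m * g x = η * (min m₁ m₂ * (g x * Real.exp (-(C₁ * D)))) := by rw [hm]; ring
            _ ≤ _ := by
              refine mul_le_mul h1 (mul_le_mul hmi (hgh i x) ?_ (hS.wt_pos _ _ _).le) ?_ (by linarith)
              · exact mul_nonneg (hg0 x).le (Real.exp_pos _).le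
              · exact mul_nonneg (lt_min hm₁ hm₂).le (mul_nonneg (hg0 x).le (Real.exp_pos _).le)
        rw [split]
        by_cases hx : x ∈ Y
        · rw [Set.indicator_of_mem hx, sub_mul]
          refine sub_le_sub tot ?_
          rcases hYb x hx with h1 | h1
          · exact hdef h (by simp [hχ, h1]) ((min_le_left _ _).trans (hm₁' σ hσ1 x))
          · exact hdef k (by simp [hχ, h1, hhk.symm]) ((min_le_right _ _).trans (hm₂' σ hσ1 x))
        · rw [Set.indicator_of_notMem hx, sub_zero]
          have := tsum_nonneg (L := .unconditional ι) hd0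
          linarith
      rw [div_le_iff₀ (hg0 x)]
      calc _ ≤ _ := CS
        _ ≤ ((Λ - Y.indicator (fun _ => η * m) x) * g x) * w x := by gcongr
        _ = _ := by ring
    have hint : ∫⁻ x, ENNReal.ofReal ((∑' i, χ i x * (S.wt σ i x * u (S.branch i x))) ^ 2 / g x) ∂μ
        + ENNReal.ofReal (η * m) * ∫⁻ x in Y, ENNReal.ofReal (w x) ∂μ ≤
        ENNReal.ofReal Λ * ∫⁻ x, ENNReal.ofReal (w x) ∂μ := by
      rw [← lintegral_const_mul' _ _ ENNReal.ofReal_ne_top,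
        ← lintegral_const_mul' _ _ ENNReal.ofReal_ne_top, ← lintegral_indicator hY]
      -- Superadditivity of the lower integral needs no measurability.
      refine (le_lintegral_add _ _).trans (lintegral_mono fun x => ?_)
      have hw0 := hwlip.nonneg x
      have e : Y.indicator (fun x => ENNReal.ofReal (η * m) * ENNReal.ofReal (w x)) x =
          ENNReal.ofReal (Y.indicator (fun _ => η * m) x * w x) := by
        by_cases hx : x ∈ Y
        · simp only [Set.indicator_of_mem hx]
          rw [ENNReal.ofReal_mul (q := w x) (by positivity)]
        · simp [Set.indicator_of_notMem hx]
      change _ + Y.indicator (fun x => ENNReal.ofReal (η * m) * ENNReal.ofReal (w x)) x ≤ _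
      rw [e, ← ENNReal.ofReal_mul hΛ, ← ENNReal.ofReal_add
        (div_nonneg (sq_nonneg _) (hg0 x).le)
        (mul_nonneg (Set.indicator_nonneg (fun _ _ => by positivity) _) hw0)]
      refine ENNReal.ofReal_le_ofReal ?_
      have := hptw x
      linarith
    rw [hwint] at hint
    refine le_trans (add_le_add le_rfl ?_) hint
    have := hmass w hwlip
    rw [hwint] at this
    calc ENNReal.ofReal (η * m / K) * ∫⁻ x, ENNReal.ofReal (u x ^ 2 / g x) ∂μ
        ≤ ENNReal.ofReal (η * m / K) *
          (ENNReal.ofReal K * ∫⁻ x in Y, ENNReal.ofReal (w x) ∂μ) := by gcongr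
      _ = _ := by
        rw [← mul_assoc, ← ENNReal.ofReal_mul (by positivity), div_mul_cancel₀ _ hK.ne']

end BranchSystem

lemma Dominated.continuous {X : Type*} [PseudoMetricSpace X] {a : ℝ} {u : X → ℝ} {v : X → ℂ}
    (h : Dominated a u v) : Continuous v := by
  rw [continuous_iff_continuousAt]
  intro y
  rw [ContinuousAt, tendsto_iff_dist_tendsto_zero]
  refine squeeze_zero (g := fun x => u y * (Real.exp (a * dist y x) - 1))
    (fun _ => dist_nonneg) (fun x => ?_) ?_
  · rw [dist_comm, dist_eq_norm]
    exact h.norm_sub_le y x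
  · have : Continuous fun x => u y * (Real.exp (a * dist y x) - 1) := by fun_prop
    simpa using this.tendsto y

/-! ### Supersolutions close to invariant densities -/

namespace BranchSystem

variable {X ι : Type*} [PseudoMetricSpace X] {S : BranchSystem X ι} {θ C₁ C₂ : ℝ}

lemma IsRegular.mono (hS : S.IsRegular θ C₁ C₂) {C₁' C₂' : ℝ} (h₁ : C₁ ≤ C₁') (h₂ : C₂ ≤ C₂') :
    S.IsRegular θ C₁' C₂' where
  J_pos := hS.J_pos
  r_nonneg := hS.r_nonneg
  contr := hS.contr
  J_le i x y := (hS.J_le i x y).trans (by have := (hS.J_pos i y).le; gcongr)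
  r_lip i x y := (hS.r_lip i x y).trans (by gcongr)

/-- Without cutoff: used only to see that the iterates are continuous, hence measurable. -/
lemma dominated_transfer (hS : S.IsRegular θ C₁ C₂) (hC₁ : 0 ≤ C₁) (hC₂ : 0 ≤ C₂) {s : ℂ}
    {a : ℝ} (ha : 0 ≤ a) {u : X → ℝ} {v : X → ℂ} (hu : LogLip a u) (huv : Dominated a u v)
    (hs : ∀ x, Summable fun i => S.wt s.re i x * u (S.branch i x)) :
    Dominated (C₁ + ‖s‖ * C₂ + a * θ) (fun x => ∑' i, S.wt s.re i x * u (S.branch i x))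
      (S.transfer s v) := by
  have DD := fun i => hS.dominated_term hC₁ hC₂ s i ha hu huv
  refine ⟨fun x => tsum_of_norm_bounded (hs x).hasSum fun i => (DD i).norm_le x, fun x y => ?_⟩
  have hsv : ∀ x, Summable fun i => S.coeff s i x * v (S.branch i x) := fun x =>
    Summable.of_norm_bounded (hs x) fun i => (DD i).norm_le x
  simp only [transfer]
  rw [← (hsv x).tsum_sub (hsv y), ← tsum_mul_right]
  exact tsum_of_norm_bounded ((hs x).mul_right _).hasSum fun i => (DD i).norm_sub_le x y

lemma SuperSol.of_le_wt (hS : S.IsRegular θ C₁ C₂) {σ σ' K : ℝ} (h : S.SuperSol σ K 1)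
    (hσ : σ ≤ σ') : S.SuperSol σ' K 1 := fun x =>
  le_trans (ENNReal.tsum_le_tsum fun i => ENNReal.ofReal_le_ofReal (by
    simpa using hS.wt_mono hσ i x)) (h x)

lemma SuperSol.summable_wt (hS : S.IsRegular θ C₁ C₂) {σ σ' K : ℝ} (h : S.SuperSol σ K 1)
    (hσ : σ ≤ σ') (x : X) : Summable fun i => S.wt σ' i x := by
  simpa using (h.of_le_wt hS hσ).summable hS (fun _ => zero_le_one) x

/-- A small change of the parameter has a small effect on supersolutions. -/
lemma SuperSol.perturb (hS : S.IsRegular θ C₁ C₂) {σ₀ K δ G σ : ℝ} (hσ₀ : 0 < σ₀) (hK : 0 ≤ K)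
    (hδ : 0 ≤ δ)
    (h : S.SuperSol (-σ₀) K 1) {g : X → ℝ} (hg : S.SuperSol 0 (1 + δ) g) (hg1 : ∀ x, 1 ≤ g x)
    (hgG : ∀ x, g x ≤ G) (hσ : 4 * |σ| ≤ σ₀) (hσ' : 4 * |σ| / σ₀ * (G * K) ≤ δ) :
    S.SuperSol (2 * σ) (1 + 2 * δ) g := by
  intro x
  have hG : 0 ≤ G := by linarith [hg1 x, hgG x]
  have hwt : ∀ i, S.wt (2 * σ) i x ≤ S.wt 0 i x + 4 * |σ| / σ₀ * S.wt (-σ₀) i x := by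
    intro i
    have hr := hS.r_nonneg i x
    have hJ := (hS.J_pos i x).le
    -- With y = 2|σ|r ≤ σ₀r/2 one has e^y ≤ 1 + ye^y. Half of the exponential moment absorbs e^y,
    -- the other half absorbs the factor r.
    have key : Real.exp (-(2 * σ) * S.r i x) ≤ 1 + 4 * |σ| / σ₀ * Real.exp (σ₀ * S.r i x) := by
      have h1 : -(2 * σ) * S.r i x ≤ 2 * |σ| * S.r i x := by
        have := neg_abs_le σ
        nlinarith
      set y := 2 * |σ| * S.r i x with hy
      have hy0 : 0 ≤ y := by positivity
      have h2 : Real.exp y ≤ 1 + y * Real.exp y := by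
        have h3 := Real.add_one_le_exp (-y)
        have h4 : Real.exp (-y) * Real.exp y = 1 := by rw [← Real.exp_add]; simp
        nlinarith [Real.exp_pos y]
      have h5 : S.r i x ≤ 2 / σ₀ * Real.exp (σ₀ / 2 * S.r i x) := by
        have h6 := Real.add_one_le_exp (σ₀ / 2 * S.r i x)
        calc S.r i x = 2 / σ₀ * (σ₀ / 2 * S.r i x) := by field_simp
          _ ≤ _ := by gcongr; linarith
      have h7 : Real.exp y ≤ Real.exp (σ₀ / 2 * S.r i x) := by
        rw [Real.exp_le_exp, hy]
        gcongr
        linarith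
      calc Real.exp (-(2 * σ) * S.r i x) ≤ Real.exp y := by gcongr
        _ ≤ 1 + y * Real.exp y := h2
        _ ≤ 1 + (2 * |σ| * (2 / σ₀ * Real.exp (σ₀ / 2 * S.r i x))) *
            Real.exp (σ₀ / 2 * S.r i x) := by rw [hy]; gcongr
        _ = 1 + 4 * |σ| / σ₀ * (Real.exp (σ₀ / 2 * S.r i x) * Real.exp (σ₀ / 2 * S.r i x)) := by
            ring
        _ = _ := by
            rw [← Real.exp_add]
            ring_nf
    simp only [wt, neg_zero, zero_mul, Real.exp_zero, one_mul, neg_neg]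
    calc Real.exp (-(2 * σ) * S.r i x) * S.J i x
        ≤ (1 + 4 * |σ| / σ₀ * Real.exp (σ₀ * S.r i x)) * S.J i x := by gcongr
      _ = _ := by ring
  calc ∑' i, ENNReal.ofReal (S.wt (2 * σ) i x * g (S.branch i x))
      ≤ ∑' i, (ENNReal.ofReal (S.wt 0 i x * g (S.branch i x)) +
        ENNReal.ofReal (4 * |σ| / σ₀ * G) * ENNReal.ofReal (S.wt (-σ₀) i x * 1)) := by
        refine ENNReal.tsum_le_tsum fun i => ?_
        have n0 := (hS.wt_pos 0 i x).le
        have n1 := (hS.wt_pos (-σ₀) i x).le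
        have n2 : 0 ≤ g (S.branch i x) := by linarith [hg1 (S.branch i x)]
        rw [← ENNReal.ofReal_mul (by positivity), ← ENNReal.ofReal_add (by positivity)
          (by positivity)]
        refine ENNReal.ofReal_le_ofReal ?_
        calc _ ≤ (S.wt 0 i x + 4 * |σ| / σ₀ * S.wt (-σ₀) i x) * g (S.branch i x) := by
              gcongr; exact hwt i
          _ = S.wt 0 i x * g (S.branch i x) +
              4 * |σ| / σ₀ * S.wt (-σ₀) i x * g (S.branch i x) := by ring
          _ ≤ S.wt 0 i x * g (S.branch i x) + 4 * |σ| / σ₀ * S.wt (-σ₀) i x * G := by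
              gcongr; exact hgG _
          _ = _ := by ring
    _ = ∑' i, ENNReal.ofReal (S.wt 0 i x * g (S.branch i x)) +
        ENNReal.ofReal (4 * |σ| / σ₀ * G) * ∑' i, ENNReal.ofReal (S.wt (-σ₀) i x * 1) := by
        rw [ENNReal.tsum_add, ENNReal.tsum_mul_left]
    _ ≤ ENNReal.ofReal ((1 + δ) * g x) + ENNReal.ofReal (4 * |σ| / σ₀ * G) *
        ENNReal.ofReal (K * 1) := by
        gcongr
        · exact hg x
        · exact h x
    _ ≤ _ := by
        have n2 : 0 ≤ g x := by linarith [hg1 x]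
        rw [← ENNReal.ofReal_mul (by positivity), ← ENNReal.ofReal_add (by positivity)
          (by positivity)]
        refine ENNReal.ofReal_le_ofReal ?_
        have e : 4 * |σ| / σ₀ * G * (K * 1) = 4 * |σ| / σ₀ * (G * K) := by ring
        rw [e]
        -- The error is at most δ, and δ ≤ δ g x because g ≥ 1.
        nlinarith [hg1 x]

variable [MeasurableSpace X] [OpensMeasurableSpace X]

/-- Approximate invariant densities, with uniformly Lipschitz logarithm. -/
lemma exists_superSol [Countable ι] [Nonempty X] (hS : S.IsRegular θ C₁ C₂) (hC₁ : 0 ≤ C₁)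
    (hpow : ∀ n, (S.pow n).IsRegular (θ ^ n) C₁ C₂)
    {μ : Measure X} [IsFiniteMeasure μ]
    (hpos : ∀ (x : X) (ρ : ℝ), 0 < ρ → 0 < μ (Metric.ball x ρ))
    (hμ : ∀ n, (S.pow n).PreservesIntegral μ) {D : ℝ} (hD : ∀ x y : X, dist x y ≤ D)
    {K : ℝ} (hK : 0 ≤ K) (h : S.SuperSol 0 K 1) {δ : ℝ} (hδ : 0 < δ) :
    ∃ (g : X → ℝ) (G : ℝ), LogLip C₁ g ∧ (∀ x, 1 ≤ g x) ∧ (∀ x, g x ≤ G) ∧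
      S.SuperSol 0 (1 + δ) g := by
  have hJs : ∀ n x, Summable fun w => (S.pow n).J w x := fun n x => by
    simpa [wt] using (h.pow hS hK n).summable_wt (hpow n) le_rfl x
  set a : ℕ → X → ℝ := fun n x => ∑' w, (S.pow n).J w x with ha
  have ha0 : ∀ n x, 0 ≤ a n x := fun n x => tsum_nonneg fun w => ((hpow n).J_pos w x).le
  have halip : ∀ n, LogLip C₁ (a n) := fun n =>
    LogLip.tsum (fun w => (hpow n).logLip_J w) (hJs n)
  have hμX : 0 < μ Set.univ := by
    obtain ⟨x⟩ := ‹Nonempty X›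
    exact (hpos x 1 one_pos).trans_le (measure_mono (Set.subset_univ _))
  have haint : ∀ n, ∫⁻ x, ENNReal.ofReal (a n x) ∂μ = μ Set.univ := by
    intro n
    have := (hμ n).lintegral_tsum (hpow n) hC₁ (f := fun _ => 1) measurable_const
      (fun _ => zero_le_one) (fun x => by simpa using hJs n x)
    simpa using this
  set E := Real.exp (C₁ * D) with hE
  have hEpos : 0 < E := Real.exp_pos _
  -- `a n` has mean 1 and oscillates at most by the factor E, so a value above E would make it
  -- exceed 1 uniformly.
  have haE : ∀ n x, a n x ≤ E := by
    intro n x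
    by_contra hcon
    rw [not_le] at hcon
    set c := a n x / E with hc
    have hc1 : 1 < c := by rwa [hc, one_lt_div hEpos]
    have hlow : ∀ y, c ≤ a n y := by
      intro y
      rw [hc, div_le_iff₀ hEpos]
      refine ((halip n).le x y).trans ?_
      have := ha0 n y
      have := hD x y
      rw [hE]
      gcongr
    have h1 : ENNReal.ofReal c * μ Set.univ ≤ μ Set.univ := by
      calc _ = ∫⁻ _, ENNReal.ofReal c ∂μ := by rw [lintegral_const]
        _ ≤ ∫⁻ y, ENNReal.ofReal (a n y) ∂μ :=
          lintegral_mono fun y => ENNReal.ofReal_le_ofReal (hlow y)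
        _ = μ Set.univ := haint n
    have h2 : 1 * μ Set.univ < ENNReal.ofReal c * μ Set.univ := by
      refine (ENNReal.mul_lt_mul_iff_left hμX.ne' (measure_ne_top _ _)).2 ?_
      rwa [ENNReal.one_lt_ofReal]
    rw [one_mul] at h2
    exact absurd h1 (not_le.2 h2)
  have hrec : ∀ n x, ∑' i, ENNReal.ofReal (S.wt 0 i x * a n (S.branch i x))
      = ENNReal.ofReal (a (n + 1) x) := by
    intro n x
    rw [ha]
    simp only
    rw [ENNReal.ofReal_tsum_of_nonneg (fun w => ((hpow (n + 1)).J_pos w x).le) (hJs (n + 1) x)]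
    refine Eq.trans ?_ (ENNReal.tsum_prod' (α := ι) (β := Word ι n) (f := fun p =>
      ENNReal.ofReal ((S.pow (n + 1)).J p x))).symm
    refine tsum_congr fun i => ?_
    rw [wt_zero, ENNReal.ofReal_mul (hS.J_pos i x).le,
      ENNReal.ofReal_tsum_of_nonneg (fun w => ((hpow n).J_pos w _).le) (hJs n _),
      ← ENNReal.tsum_mul_left]
    refine tsum_congr fun w => ?_
    rw [← ENNReal.ofReal_mul (hS.J_pos i x).le]
    rfl
  have ha_zero : ∀ x, a 0 x = 1 := by
    intro x
    have : Unique (Word ι 0) := inferInstanceAs (Unique PUnit)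
    simp only [ha]
    rw [tsum_eq_single (default : Word ι 0) (fun b hb => absurd (Subsingleton.elim _ _) hb)]
    rfl
  set q := (1 + δ)⁻¹ with hq
  have hq0 : 0 < q := by positivity
  have hq1 : q < 1 := inv_lt_one_of_one_lt₀ (by linarith)
  -- The function g is a truncated resolvent series ∑_{m<N} q^m L^m 1. Applying L shifts it: Lg =
  -- (1+δ)(g - 1 + q^N L^N 1). This is at most (1+δ)g once q^N E ≤ 1.
  obtain ⟨N, hN⟩ : ∃ N, q ^ N < E⁻¹ := exists_pow_lt_of_lt_one (inv_pos.2 hEpos) hq1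
  have hN0 : 0 < N := by
    rcases Nat.eq_zero_or_pos N with rfl | h
    · rw [pow_zero] at hN
      obtain ⟨x⟩ := ‹Nonempty X›
      have : E⁻¹ ≤ 1 := inv_le_one_of_one_le₀ ((ha_zero x) ▸ haE 0 x)
      linarith
    · exact h
  have hgx : ∀ x, ∑ m ∈ Finset.range N, q ^ m * a m x ≤ ∑ m ∈ Finset.range N, q ^ m * E := by
    intro x
    gcongr with m
    exact haE m x
  refine ⟨fun x => ∑ m ∈ Finset.range N, q ^ m * a m x, ∑ m ∈ Finset.range N, q ^ m * E,
    ⟨fun x => Finset.sum_nonneg fun m _ => mul_nonneg (by positivity) (ha0 m x), fun x y => ?_⟩,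
    fun x => ?_, hgx, fun x => ?_⟩
  · rw [Finset.sum_mul]
    refine Finset.sum_le_sum fun m _ => ?_
    rw [mul_assoc]
    gcongr
    exact (halip m).le x y
  · refine le_trans ?_ (Finset.single_le_sum (f := fun m => q ^ m * a m x) (fun m _ =>
      mul_nonneg (by positivity) (ha0 m x)) (Finset.mem_range.2 hN0))
    simp [ha_zero]
  · have e1 : ∑' i, ENNReal.ofReal (S.wt 0 i x *
        ∑ m ∈ Finset.range N, q ^ m * a m (S.branch i x)) =
        ENNReal.ofReal (∑ m ∈ Finset.range N, q ^ m * a (m + 1) x) := by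
      rw [ENNReal.ofReal_sum_of_nonneg (fun m _ => mul_nonneg (by positivity) (ha0 _ x))]
      have : ∀ i, ENNReal.ofReal (S.wt 0 i x *
          ∑ m ∈ Finset.range N, q ^ m * a m (S.branch i x)) =
          ∑ m ∈ Finset.range N, ENNReal.ofReal (q ^ m) *
            ENNReal.ofReal (S.wt 0 i x * a m (S.branch i x)) := by
        intro i
        rw [Finset.mul_sum, ENNReal.ofReal_sum_of_nonneg (fun m _ => mul_nonneg (hS.wt_pos _ _ _).le
          (mul_nonneg (by positivity) (ha0 _ _)))]
        refine Finset.sum_congr rfl fun m _ => ?_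
        rw [← ENNReal.ofReal_mul (by positivity)]
        congr 1
        ring
      simp_rw [this]
      rw [Summable.tsum_finsetSum (fun _ _ => ENNReal.summable)]
      refine Finset.sum_congr rfl fun m _ => ?_
      rw [ENNReal.tsum_mul_left, hrec, ← ENNReal.ofReal_mul (by positivity)]
    rw [e1]
    refine ENNReal.ofReal_le_ofReal ?_
    have hq' : (1 + δ) * q = 1 := mul_inv_cancel₀ (by linarith)
    have e2 : ∑ m ∈ Finset.range N, q ^ m * a (m + 1) x
        = (1 + δ) * ∑ m ∈ Finset.range N, q ^ (m + 1) * a (m + 1) x := by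
      rw [Finset.mul_sum]
      refine Finset.sum_congr rfl fun m _ => ?_
      rw [pow_succ]
      linear_combination (-(q ^ m * a (m + 1) x)) * hq'
    have e3 := Finset.sum_range_succ' (fun m => q ^ m * a m x) N
    rw [Finset.sum_range_succ] at e3
    simp only [pow_zero, one_mul, ha_zero] at e3
    rw [e2]
    gcongr
    have e4 : q ^ N * a N x ≤ 1 := by
      calc q ^ N * a N x ≤ E⁻¹ * E := by
            have := haE N x
            have := ha0 N x
            gcongr
        _ = 1 := inv_mul_cancel₀ hEpos.ne'
    linarith

end BranchSystem

/-! ### Exponential decay for abstract branch systems -/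

namespace BranchSystem

variable {X ι : Type*} [PseudoMetricSpace X] {S : BranchSystem X ι} {θ C₁ C₂ : ℝ}
  [MeasurableSpace X] [OpensMeasurableSpace X]

/-- Uniform non-integrability: pairs of arbitrarily long branches along which the Birkhoff sums of
the roof function differ by a function oscillating at every small scale. -/
def UniformNonIntegrability (S : BranchSystem X ι) : Prop :=
  ∃ c > (0 : ℝ), ∃ ρ₀ > (0 : ℝ), ∀ N : ℕ, ∃ n ≥ N, ∃ h k : Word ι n, h ≠ k ∧
    Oscillates (fun x => (S.pow n).r h x - (S.pow n).r k x) c ρ₀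

set_option maxHeartbeats 1000000 in
/-- Exponential decay of the iterates of the transfer operators `L_s`, for `s` close to the
imaginary axis and with large imaginary part. -/
theorem exists_decay [Countable ι] [Nonempty X] (hS : S.IsRegular θ C₁ C₂) (hθ : 0 ≤ θ)
    (hθ1 : θ < 1) (hC₁ : 0 ≤ C₁) (hC₂ : 0 ≤ C₂) {μ : Measure X} [IsFiniteMeasure μ]
    (hpos : ∀ (x : X) (ρ : ℝ), 0 < ρ → 0 < μ (Metric.ball x ρ)) (hJ : JohnDoubling μ)
    (hμ : S.PreservesIntegral μ) {D : ℝ} (hD : ∀ x y : X, dist x y ≤ D)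
    {σ₀ K : ℝ} (hσ₀ : 0 < σ₀) (hK : 0 ≤ K) (hexp : S.SuperSol (-σ₀) K 1)
    (huni : S.UniformNonIntegrability) :
    ∃ σ₀' : ℝ, 0 < σ₀' ∧ σ₀' ≤ σ₀ ∧ ∃ T₀ : ℝ, 0 < T₀ ∧ ∃ C : ℝ, 0 < C ∧ ∃ β : ℝ, 0 < β ∧ β < 1 ∧
      ∀ σ t : ℝ, |σ| ≤ σ₀' → T₀ ≤ |t| → 1 ≤ |t| ∧ ∀ (v : X → ℂ) (N : ℝ), (∀ x, ‖v x‖ ≤ N) →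
        (∀ x y, ‖v x - v y‖ ≤ N * (|t| * dist x y)) → ∀ k : ℕ,
        (∀ x, Summable fun i => S.coeff (σ + t * Complex.I) i x *
          ((S.transfer (σ + t * Complex.I))^[k] v) (S.branch i x)) ∧
        Measurable ((S.transfer (σ + t * Complex.I))^[k] v) ∧
        ∫⁻ x, ENNReal.ofReal (‖(S.transfer (σ + t * Complex.I))^[k] v x‖ ^ 2) ∂μ ≤
          ENNReal.ofReal ((C * β ^ k * N) ^ 2) := by
  obtain ⟨c, hc, ρ₀, hρ₀, huni⟩ := huni
  -- uniform regularity of the iterates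
  have h1θ : 0 < 1 - θ := by linarith
  set C₁' := C₁ / (1 - θ) with hC₁'
  set C₂' := C₂ / (1 - θ) with hC₂'
  have hC₁0 : 0 ≤ C₁' := by positivity
  have hC₂0 : 0 ≤ C₂' := by positivity
  have hle : ∀ C : ℝ, 0 ≤ C → C ≤ C / (1 - θ) := fun C hC => by
    rw [le_div_iff₀ h1θ]; nlinarith
  have hpow : ∀ n, (S.pow n).IsRegular (θ ^ n) C₁' C₂' := hS.pow hθ hθ1 hC₁ hC₂
  have hμpow : ∀ n, (S.pow n).PreservesIntegral μ := hμ.pow hS hθ hθ1 hC₁ hC₂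
  -- constants
  set A := 4 * (C₁' + 2 * C₂') + 1 with hA
  have hA1 : 1 ≤ A := by rw [hA]; linarith [mul_nonneg (by norm_num : (0 : ℝ) ≤ 2) hC₂0]
  set R := 1 / (4 * C₂' + 1) with hR
  have hR0 : 0 < R := by positivity
  have hRC : 4 * C₂' * R ≤ Real.pi := by
    have : 4 * C₂' * R ≤ 1 := by
      rw [hR, mul_one_div, div_le_one (by positivity)]; linarith
    linarith [Real.pi_gt_three]
  set γ := min 1 (c * R / 8) with hγ
  have hγ0 : 0 < γ := lt_min one_pos (by positivity)
  have hγc : 4 * γ ≤ 2 / Real.pi * (c * R) := by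
    have h1 : γ ≤ c * R / 8 := min_le_right _ _
    have h2 : 1 / 2 ≤ 2 / Real.pi := by
      rw [div_le_div_iff₀ two_pos Real.pi_pos]; linarith [Real.pi_le_four]
    have h3 : 1 / 2 * (c * R) ≤ 2 / Real.pi * (c * R) := by gcongr
    linarith
  have hθn : Filter.Tendsto (fun n : ℕ => θ ^ n) Filter.atTop (nhds 0) :=
    tendsto_pow_atTop_nhds_zero_of_lt_one hθ hθ1
  have hθE : Filter.Tendsto (fun n : ℕ => 8 * (Real.exp (A * θ ^ n * (2 * R)) - 1)) Filter.atTop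
      (nhds 0) := by
    have : Continuous fun y : ℝ => 8 * (Real.exp (A * y * (2 * R)) - 1) := by fun_prop
    have := (this.tendsto 0).comp hθn
    simpa [Function.comp_def] using this
  -- A, R and γ depend only on the uniform constants, so the block length can be taken large after
  -- them, to make θ^n small enough for the cancellation argument.
  obtain ⟨n₀, hn₀⟩ := Filter.eventually_atTop.1
    ((hθn.eventually (gt_mem_nhds (by norm_num : (0 : ℝ) < 1 / 4))).and
      (hθE.eventually (gt_mem_nhds (by positivity : 0 < 2 * γ))))
  obtain ⟨n, hn, h, k, hhk, hosc⟩ := huni (max n₀ 1)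
  have hn1 : 1 ≤ n := (le_max_right _ _).trans hn
  obtain ⟨hn4, hnE⟩ := hn₀ n ((le_max_left _ _).trans hn)
  set σ₁ := min 1 σ₀ with hσ₁
  have hσ₁0 : 0 < σ₁ := lt_min one_pos hσ₀
  have hwt : ∀ (m : ℕ) (σ : ℝ) (x : X), |σ| ≤ σ₁ → Summable fun w => (S.pow m).wt σ w x := by
    intro m σ x hσ
    refine (hexp.pow hS hK m).summable_wt (hpow m) ?_ x
    have := (abs_le.1 hσ).1
    have : σ₁ ≤ σ₀ := min_le_right _ _
    linarith
  obtain ⟨η₀, hη₀, T₀, hT₀, hstep⟩ := dolgopyat_step (hpow n) (pow_nonneg hθ n) hn4.le hC₁0 hC₂0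
    (A := A) (by linarith) (by linarith) hR0 hγ0 (min_le_left _ _) hρ₀ hγc hRC hnE.le hpos hJ
    (hμpow n) hD hσ₁0.le (min_le_left _ _) (hwt n) hhk hosc
  -- choice of `δ`
  obtain ⟨δ, hδ, hδn⟩ : ∃ δ > 0, (1 + 2 * δ) ^ n < 1 + η₀ / 2 := by
    have hcont : Continuous fun y : ℝ => (1 + 2 * y) ^ n := by fun_prop
    have : ∀ᶠ y in nhds (0 : ℝ), (1 + 2 * y) ^ n < 1 + η₀ / 2 := by
      refine hcont.continuousAt.eventually (gt_mem_nhds ?_)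
      simp; positivity
    obtain ⟨e, he, hball⟩ := Metric.eventually_nhds_iff.1 this
    exact ⟨e / 2, by positivity, hball (by
      rw [Real.dist_eq, sub_zero, abs_of_pos (by positivity)]; linarith)⟩
  obtain ⟨g, G, hg, hg1, hgG, hgsup⟩ := exists_superSol (hS.mono (hle _ hC₁) (hle _ hC₂)) hC₁0 hpow
    hpos hμpow hD hK (hexp.of_le_wt hS (by linarith)) hδ
  have hg0 : ∀ x, 0 < g x := fun x => one_pos.trans_le (hg1 x)
  have hG0 : 0 < G := by
    obtain ⟨x⟩ := ‹Nonempty X›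
    exact (hg0 x).trans_le (hgG x)
  set Λ := 1 + 2 * δ with hΛ
  have hΛ1 : 1 ≤ Λ := by linarith
  -- choice of `σ₀'`
  set σ₂ := min (σ₀ / 4) (δ * σ₀ / (4 * (G * K + 1))) with hσ₂
  have hσ₂0 : 0 < σ₂ := lt_min (by positivity) (by positivity)
  have hsup : ∀ σ, |σ| ≤ σ₂ → S.SuperSol (2 * σ) Λ g := by
    intro σ hσ
    refine SuperSol.perturb hS hσ₀ hK hδ.le hexp hgsup hg1 hgG ?_ ?_
    · have : σ₂ ≤ σ₀ / 4 := min_le_left _ _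
      linarith
    · have h1 : |σ| ≤ δ * σ₀ / (4 * (G * K + 1)) := hσ.trans (min_le_right _ _)
      rw [le_div_iff₀ (by positivity)] at h1
      rw [div_mul_eq_mul_div, div_le_iff₀ hσ₀]
      nlinarith [abs_nonneg σ]
  -- The growth Λ^n < 1 + η₀/2 minus the gain η₀ leaves at most 1 - η₀/2; the value 1/2 only keeps q
  -- positive.
  set q := max (1 - η₀ / 2) (1 / 2) with hq
  have hq0 : 0 < q := lt_max_of_lt_right (by norm_num)
  have hq1 : q < 1 := max_lt (by linarith) (by norm_num)
  have hΛq : Λ ^ n ≤ q + η₀ := by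
    have : 1 - η₀ / 2 ≤ q := le_max_left _ _
    linarith
  set V := (μ Set.univ).toReal with hV
  have hV0 : 0 ≤ V := ENNReal.toReal_nonneg
  -- The squared norm loses a factor q every n steps, hence β^(2n) = q.
  set β := q ^ ((1 : ℝ) / (2 * n)) with hβ
  have hβ0 : 0 < β := Real.rpow_pos_of_pos hq0 _
  have hn0 : (0 : ℝ) < n := by exact_mod_cast hn1
  have hβ1 : β < 1 := Real.rpow_lt_one hq0.le hq1 (by positivity)
  have hβn : β ^ (2 * n) = q := by
    rw [hβ, ← Real.rpow_natCast, ← Real.rpow_mul hq0.le]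
    push_cast
    rw [one_div, inv_mul_cancel₀ (by positivity), Real.rpow_one]
  -- Collects the comparison of g with 1, the growth over an incomplete block, the total mass and
  -- one missing factor q. The summand 1 ensures that this product is at most Cf².
  set Cf := G * Λ ^ n * V / q + 1 with hCf
  have hCf1 : 1 ≤ Cf := by
    have : 0 ≤ G * Λ ^ n * V / q := by positivity
    linarith
  refine ⟨min σ₁ σ₂, lt_min hσ₁0 hσ₂0, (min_le_left _ _).trans (min_le_right _ _), T₀,
    by linarith, Cf, by linarith, β, hβ0, hβ1, ?_⟩
  intro σ t hσ ht
  have ht1 : 1 ≤ |t| := hT₀.trans ht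
  refine ⟨ht1, ?_⟩
  intro v N hvN hvlip k
  set s : ℂ := σ + t * Complex.I with hs
  have hre : s.re = σ := by simp [hs]
  have hσ₁' : |σ| ≤ σ₁ := hσ.trans (min_le_left _ _)
  have hσ₂' : |σ| ≤ σ₂ := hσ.trans (min_le_right _ _)
  have hN : 0 ≤ N := by
    obtain ⟨x⟩ := ‹Nonempty X›
    exact (norm_nonneg _).trans (hvN x)
  have hKs : S.SuperSol s.re K 1 := hexp.of_le_wt hS (by
    rw [hre]
    have := (abs_le.1 hσ₁').1
    have : σ₁ ≤ σ₀ := min_le_right _ _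
    linarith)
  have ha : 0 ≤ A * |t| := by positivity
  have hit : ∀ m (v : X → ℂ) (B : ℝ), (∀ x, ‖v x‖ ≤ B) →
      (S.pow m).transfer s v = (S.transfer s)^[m] v := fun m v B hv =>
    hS.transfer_pow hθ hθ1 hC₁ hC₂ hKs hK hv m
  -- the initial pair
  have hu₀ : LogLip (A * |t|) (fun _ : X => N) :=
    ⟨fun _ => hN, fun x y => le_mul_of_one_le_right hN (Real.one_le_exp (by positivity))⟩
  have hv₀ : Dominated (A * |t|) (fun _ : X => N) v := by
    refine ⟨hvN, fun x y => (hvlip x y).trans ?_⟩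
    gcongr
    have h1 := Real.add_one_le_exp (A * |t| * dist x y)
    have h2 : 1 * (|t| * dist x y) ≤ A * (|t| * dist x y) := by gcongr
    nlinarith
  refine ⟨fun x => hS.summable_transfer (hs := fun x => ?_)
    (hS.norm_iterate_transfer_le hKs hK hvN k) x, ?_, ?_⟩
  · simpa using hKs.summable hS (fun _ => zero_le_one) x
  -- Seen as one step of `S.pow k`, the iterate is dominated by a majorant and therefore continuous.
  · rw [← hit k v N hvN]
    refine (dominated_transfer (hpow k) hC₁0 hC₂0 ha hu₀ hv₀ fun x => ?_).continuous.measurable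
    rw [hre]
    exact (hwt k σ x hσ₁').mul_right N
  -- the weighted norm of the successive pairs
  set Q : (X → ℝ) → ℝ≥0∞ := fun u => ∫⁻ x, ENNReal.ofReal (u x ^ 2 / g x) ∂μ with hQ
  have hQfin : ∀ u : X → ℝ, LogLip (A * |t|) u → Q u ≠ ⊤ := by
    intro u hu
    obtain ⟨M, -, hM⟩ := (logLip_sq_div hu hg hg0).exists_bound (by positivity) hD
    refine ne_top_of_le_ne_top ?_ (lintegral_mono fun x => ENNReal.ofReal_le_ofReal (hM x))
    rw [lintegral_const]
    exact ENNReal.mul_ne_top ENNReal.ofReal_ne_top (measure_ne_top _ _)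
  have hiter : ∀ j : ℕ, ∃ u : X → ℝ, LogLip (A * |t|) u ∧
      Dominated (A * |t|) u ((S.transfer s)^[n * j] v) ∧
      Q u ≤ ENNReal.ofReal (q ^ j) * Q (fun _ => N) := by
    intro j
    induction j with
    | zero => exact ⟨fun _ => N, hu₀, by simpa using hv₀, by simp⟩
    | succ j ih =>
      obtain ⟨u, hu, huv, hQu⟩ := ih
      obtain ⟨U, hU, hUv, hUQ⟩ := hstep σ t hσ₁' ht u _ hu huv
      refine ⟨U, hU, ?_, ?_⟩
      · obtain ⟨M, -, hM⟩ := hu.exists_bound ha hD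
        rw [hit n _ M (fun x => (huv.norm_le x).trans (hM x))] at hUv
        rwa [mul_add, mul_one, add_comm, Function.iterate_add_apply]
      · have h1 := hUQ g (Λ ^ n) hg hg0 (by positivity)
          ((hsup σ hσ₂').pow hS (by linarith) n)
        change Q U + ENNReal.ofReal η₀ * Q u ≤ ENNReal.ofReal (Λ ^ n) * Q u at h1
        have h2 : Q U + ENNReal.ofReal η₀ * Q u ≤
            ENNReal.ofReal q * Q u + ENNReal.ofReal η₀ * Q u := by
          refine h1.trans ?_
          rw [← add_mul, ← ENNReal.ofReal_add hq0.le hη₀.le]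
          gcongr
        -- Cancelling the common term in [0, ∞] requires that it be finite.
        have h3 : Q U ≤ ENNReal.ofReal q * Q u :=
          (ENNReal.add_le_add_iff_right
            (ENNReal.mul_ne_top ENNReal.ofReal_ne_top (hQfin u hu))).1 h2
        calc Q U ≤ ENNReal.ofReal q * Q u := h3
          _ ≤ ENNReal.ofReal q * (ENNReal.ofReal (q ^ j) * Q (fun _ => N)) := by gcongr
          _ = _ := by
            rw [← mul_assoc, ← ENNReal.ofReal_mul hq0.le, pow_succ']
  obtain ⟨u, hu, huv, hQu⟩ := hiter (k / n)
  set i := k % n with hi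
  have hin : i ≤ n := (Nat.mod_lt _ hn1).le
  have hk : (S.transfer s)^[k] v = (S.pow i).transfer s ((S.transfer s)^[n * (k / n)] v) := by
    obtain ⟨M, -, hM⟩ := hu.exists_bound ha hD
    rw [hit i _ M (fun x => (huv.norm_le x).trans (hM x)), ← Function.iterate_add_apply,
      hi, Nat.mod_add_div]
  have hlast := lintegral_sq_transfer_le (hpow i) hC₁0 (hμpow i) hD
    (fun x => by simpa [wt] using hwt i 0 x (by simpa using hσ₁0.le)) (s := s) ha hu huv.norm_le
    (fun x => by rw [hre]; exact hwt i σ x hσ₁') hg hg0 (Λ := Λ ^ i) (by positivity)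
    (by rw [hre]; exact (hsup σ hσ₂').pow hS (by linarith) i)
  rw [← hk] at hlast
  have hQ0 : Q (fun _ => N) ≤ ENNReal.ofReal (N ^ 2 * V) := by
    calc Q (fun _ => N) ≤ ∫⁻ _, ENNReal.ofReal (N ^ 2) ∂μ :=
          lintegral_mono fun x => ENNReal.ofReal_le_ofReal (div_le_self (sq_nonneg N) (hg1 x))
      _ = ENNReal.ofReal (N ^ 2 * V) := by
          rw [lintegral_const, ENNReal.ofReal_mul (sq_nonneg N), hV,
            ENNReal.ofReal_toReal (measure_ne_top _ _)]
  calc ∫⁻ x, ENNReal.ofReal (‖(S.transfer s)^[k] v x‖ ^ 2) ∂μ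
      ≤ ∫⁻ x, ENNReal.ofReal G * ENNReal.ofReal (‖(S.transfer s)^[k] v x‖ ^ 2 / g x) ∂μ := by
        refine lintegral_mono fun x => ?_
        have := hg0 x
        rw [← ENNReal.ofReal_mul hG0.le]
        refine ENNReal.ofReal_le_ofReal ?_
        rw [mul_div_assoc', le_div_iff₀ this, mul_comm G]
        gcongr
        exact hgG x
    _ = ENNReal.ofReal G * ∫⁻ x, ENNReal.ofReal (‖(S.transfer s)^[k] v x‖ ^ 2 / g x) ∂μ :=
        lintegral_const_mul' _ _ ENNReal.ofReal_ne_top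
    _ ≤ ENNReal.ofReal G * (ENNReal.ofReal (Λ ^ n) *
        (ENNReal.ofReal (q ^ (k / n)) * ENNReal.ofReal (N ^ 2 * V))) := by
        refine mul_le_mul_right (hlast.trans ?_) _
        refine mul_le_mul' (ENNReal.ofReal_le_ofReal (pow_le_pow_right₀ hΛ1 hin)) ?_
        exact hQu.trans (mul_le_mul_right hQ0 _)
    _ = ENNReal.ofReal (G * (Λ ^ n * (q ^ (k / n) * (N ^ 2 * V)))) := by
        rw [← ENNReal.ofReal_mul (by positivity), ← ENNReal.ofReal_mul (by positivity),
          ← ENNReal.ofReal_mul hG0.le]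
    _ ≤ _ := by
        refine ENNReal.ofReal_le_ofReal ?_
        -- An incomplete block costs one factor q: 2k ≤ 2n(k/n + 1) with the integer quotient k/n.
        have h1 : q ^ (k / n) ≤ (β ^ k) ^ 2 / q := by
          rw [le_div_iff₀ hq0, ← pow_succ, ← hβn, ← pow_mul, ← pow_mul]
          refine pow_le_pow_of_le_one hβ0.le hβ1.le ?_
          have := Nat.mod_add_div k n
          have := Nat.mod_lt k hn1
          nlinarith
        calc G * (Λ ^ n * (q ^ (k / n) * (N ^ 2 * V)))
            ≤ G * (Λ ^ n * (((β ^ k) ^ 2 / q) * (N ^ 2 * V))) := by gcongr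
          _ = (G * Λ ^ n * V / q) * ((β ^ k) ^ 2 * N ^ 2) := by ring
          _ ≤ Cf ^ 2 * ((β ^ k) ^ 2 * N ^ 2) := by
              gcongr
              nlinarith
          _ = _ := by ring

end BranchSystem

/-! ### Finsler lengths and distances -/

namespace FinslerMetric

variable {E : Type*} [NormedAddCommGroup E] [NormedSpace ℝ E]
  {M : Type*} [TopologicalSpace M] [ChartedSpace E M] [IsManifold 𝓘(ℝ, E) ∞ M]

/-- The extended norms on the tangent spaces defined by a Finsler metric. -/
@[reducible] noncomputable def tangentENorm (F : FinslerMetric E M) (z : M) : ENorm (TangentSpace 𝓘(ℝ, E) z) :=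
  ⟨fun v => ENNReal.ofReal (F.norm z v)⟩

lemma tangentENormSMulClass (F : FinslerMetric E M) (z : M) :
    letI := F.tangentENorm
    ENormSMulClass ℝ (TangentSpace 𝓘(ℝ, E) z) := by
  let := F.tangentENorm
  refine ⟨fun c v => ?_⟩
  change ENNReal.ofReal (F.norm z (c • v)) = ‖c‖ₑ * ENNReal.ofReal (F.norm z v)
  rw [map_smul_eq_mul, ENNReal.ofReal_mul (norm_nonneg c), ofReal_norm]

lemma edist_self (F : FinslerMetric E M) (x : M) : F.edist x x = 0 := by
  let := F.tangentENorm
  have := F.tangentENormSMulClass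
  exact Manifold.riemannianEDist_self

lemma edist_comm (F : FinslerMetric E M) (x y : M) : F.edist x y = F.edist y x := by
  let := F.tangentENorm
  have := F.tangentENormSMulClass
  exact Manifold.riemannianEDist_comm

lemma edist_triangle (F : FinslerMetric E M) (x y z : M) :
    F.edist x z ≤ F.edist x y + F.edist y z := by
  let := F.tangentENorm
  have := F.tangentENormSMulClass
  exact Manifold.riemannianEDist_triangle

/-- The length of a path for a Finsler metric. -/
noncomputable def pathLength (F : FinslerMetric E M) (γ : ℝ → M) (a b : ℝ) : ℝ≥0∞ :=
  ∫⁻ t in Set.Icc a b, ENNReal.ofReal (F.norm (γ t) (mfderiv 𝓘(ℝ, ℝ) 𝓘(ℝ, E) γ t (1 : ℝ)))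

lemma pathLength_eq_pathELength (F : FinslerMetric E M) (γ : ℝ → M) (a b : ℝ) :
    letI := F.tangentENorm
    F.pathLength γ a b = Manifold.pathELength 𝓘(ℝ, E) γ a b := by
  let := F.tangentENorm
  rw [Manifold.pathELength_eq_lintegral_mfderiv_Icc]; rfl

lemma pathLength_eq_lintegral_Icc (F : FinslerMetric E M) (γ : ℝ → M) (a b : ℝ) :
    F.pathLength γ a b = ∫⁻ t in Set.Icc a b, ENNReal.ofReal
      (F.norm (γ t) (mfderivWithin 𝓘(ℝ, ℝ) 𝓘(ℝ, E) γ (Set.Icc a b) t (1 : ℝ))) := by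
  let := F.tangentENorm
  rw [pathLength_eq_pathELength, Manifold.pathELength_eq_lintegral_mfderivWithin_Icc]; rfl

lemma pathLength_mono (F : FinslerMetric E M) (γ : ℝ → M) {a b a' b' : ℝ} (h : a' ≤ a)
    (h' : b ≤ b') : F.pathLength γ a b ≤ F.pathLength γ a' b' :=
  lintegral_mono_set (Set.Icc_subset_Icc h h')

lemma edist_le_pathLength (F : FinslerMetric E M) {γ : ℝ → M} {a b : ℝ}
    (hγ : ContMDiffOn 𝓘(ℝ, ℝ) 𝓘(ℝ, E) 1 γ (Set.Icc a b)) (hab : a ≤ b) :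
    F.edist (γ a) (γ b) ≤ F.pathLength γ a b := by
  let := F.tangentENorm
  have := F.tangentENormSMulClass
  exact (Manifold.riemannianEDist_le_pathELength hγ rfl rfl hab).trans_eq
    Manifold.pathELength_eq_lintegral_mfderiv_Icc

lemma exists_path_of_edist_lt (F : FinslerMetric E M) {x y : M} {ρ : ℝ≥0∞} (h : F.edist x y < ρ) :
    ∃ γ : ℝ → M, γ 0 = x ∧ γ 1 = y ∧ ContMDiff 𝓘(ℝ, ℝ) 𝓘(ℝ, E) 1 γ ∧
      F.pathLength γ 0 1 < ρ := by
  let := F.tangentENorm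
  have := F.tangentENormSMulClass
  obtain ⟨γ, h0, h1, hγ, hl, -⟩ :=
    Manifold.exists_lt_locally_constant_of_riemannianEDist_lt h zero_lt_one
  exact ⟨γ, h0, h1, hγ, lt_of_eq_of_lt (F.pathLength_eq_pathELength γ 0 1) hl⟩

/-- A `C^1` map which expands lengths at most by `K` on a set expands the lengths of the paths in
this set at most by `K`. -/
lemma pathLength_comp_le (F : FinslerMetric E M) {s : Set M} (hs : IsOpen s) {f : M → M}
    (hf : ContMDiffOn 𝓘(ℝ, E) 𝓘(ℝ, E) 1 f s) {K : ℝ} (hK : 0 ≤ K)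
    (hfK : ∀ x ∈ s, ∀ v : TangentSpace 𝓘(ℝ, E) x,
      F.norm (f x) (mfderiv 𝓘(ℝ, E) 𝓘(ℝ, E) f x v) ≤ K * F.norm x v)
    {γ : ℝ → M} {a b : ℝ} (hγ : ContMDiffOn 𝓘(ℝ, ℝ) 𝓘(ℝ, E) 1 γ (Set.Icc a b)) (hab : a ≤ b)
    (hγs : ∀ t ∈ Set.Icc a b, γ t ∈ s) :
    F.edist (f (γ a)) (f (γ b)) ≤ ENNReal.ofReal K * F.pathLength γ a b := by
  -- A one-point interval has no unique derivative within it, so it is treated apart.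
  rcases hab.eq_or_lt with rfl | hab'
  · rw [edist_self]; exact bot_le
  refine (F.edist_le_pathLength (γ := f ∘ γ) (hf.comp hγ hγs) hab).trans ?_
  rw [pathLength_eq_lintegral_Icc, pathLength_eq_lintegral_Icc,
    ← lintegral_const_mul' _ _ ENNReal.ofReal_ne_top]
  refine setLIntegral_mono' measurableSet_Icc fun t ht => ?_
  have hcomp : mfderivWithin 𝓘(ℝ, ℝ) 𝓘(ℝ, E) (f ∘ γ) (Set.Icc a b) t =
      (mfderiv 𝓘(ℝ, E) 𝓘(ℝ, E) f (γ t)).comp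
        (mfderivWithin 𝓘(ℝ, ℝ) 𝓘(ℝ, E) γ (Set.Icc a b) t) := by
    refine mfderiv_comp_mfderivWithin t ?_ (hγ.mdifferentiableOn one_ne_zero t ht) ?_
    · exact (hf.contMDiffAt (hs.mem_nhds (hγs t ht))).mdifferentiableAt one_ne_zero
    · rw [uniqueMDiffWithinAt_iff_uniqueDiffWithinAt]
      exact uniqueDiffOn_Icc hab' t ht
  rw [← ENNReal.ofReal_mul hK, hcomp]
  exact ENNReal.ofReal_le_ofReal (hfK _ (hγs t ht) _)

lemma le_mul_edist_of_forall_path (F : FinslerMetric E M) {x y : M} {c K : ℝ≥0∞} (hK : K ≠ ⊤)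
    (h : ∀ γ : ℝ → M, γ 0 = x → γ 1 = y → ContMDiff 𝓘(ℝ, ℝ) 𝓘(ℝ, E) 1 γ →
      c ≤ K * F.pathLength γ 0 1) (hxy : F.edist x y ≠ ⊤) : c ≤ K * F.edist x y := by
  have key : ∀ ρ, F.edist x y < ρ → c ≤ K * ρ := fun ρ hρ => by
    obtain ⟨γ, h0, h1, hγ, hl⟩ := F.exists_path_of_edist_lt hρ
    exact (h γ h0 h1 hγ).trans (by gcongr)
  refine ENNReal.le_of_forall_pos_le_add fun ε hε _ => ?_
  lift K to NNReal using hK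
  -- Dividing by K + 1 instead of K covers K = 0.
  have hδ : (0 : ℝ≥0∞) < ε / (K + 1 : NNReal) := ENNReal.div_pos (by simpa using hε.ne') (by simp)
  refine (key _ (ENNReal.lt_add_right hxy hδ.ne')).trans ?_
  rw [mul_add]
  gcongr
  calc (K : ℝ≥0∞) * (ε / (K + 1 : NNReal)) ≤ (K + 1 : NNReal) * (ε / (K + 1 : NNReal)) := by
        gcongr; simp
    _ ≤ ε := ENNReal.mul_div_le

lemma edist_map_le (F : FinslerMetric E M) {f : M → M} (hf : ContMDiff 𝓘(ℝ, E) 𝓘(ℝ, E) 1 f)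
    {K : ℝ} (hK : 0 ≤ K) (hfK : ∀ x, ∀ v : TangentSpace 𝓘(ℝ, E) x,
      F.norm (f x) (mfderiv 𝓘(ℝ, E) 𝓘(ℝ, E) f x v) ≤ K * F.norm x v) {x y : M}
    (hxy : F.edist x y ≠ ⊤) :
    F.edist (f x) (f y) ≤ ENNReal.ofReal K * F.edist x y := by
  refine F.le_mul_edist_of_forall_path ENNReal.ofReal_ne_top (fun γ h0 h1 hγ => ?_) hxy
  rw [← h0, ← h1]
  exact F.pathLength_comp_le isOpen_univ hf.contMDiffOn hK (fun x _ => hfK x) hγ.contMDiffOn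
    zero_le_one fun _ _ => Set.mem_univ _

/-- A `C^1` function whose differential has norm at most `K` is `K`-Lipschitz for the Finsler
distance. -/
lemma edist_le_of_norm_mfderiv_le (F : FinslerMetric E M) {V : Type*} [NormedAddCommGroup V]
    [NormedSpace ℝ V] [CompleteSpace V] {u : M → V} (hu : ContMDiff 𝓘(ℝ, E) 𝓘(ℝ, V) 1 u)
    {K : ℝ} (hK : 0 ≤ K) (huK : ∀ x, ∀ v : TangentSpace 𝓘(ℝ, E) x,
      Norm.norm (E := V) (mfderiv 𝓘(ℝ, E) 𝓘(ℝ, V) u x v) ≤ K * F.norm x v) {x y : M}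
    (hxy : F.edist x y ≠ ⊤) :
    ‖u y - u x‖ₑ ≤ ENNReal.ofReal K * F.edist x y := by
  refine F.le_mul_edist_of_forall_path ENNReal.ofReal_ne_top (fun γ h0 h1 hγ => ?_) hxy
  have hcd : ContDiff ℝ 1 (u ∘ γ) := by
    rw [← contMDiff_iff_contDiff]; exact hu.comp hγ
  have h2 := enorm_sub_le_lintegral_derivWithin_Icc_of_contDiffOn_Icc
    (hcd.contDiffOn (s := Set.Icc 0 1)) zero_le_one
  rw [← h0, ← h1]
  refine h2.trans ?_
  rw [pathLength, ← lintegral_const_mul' _ _ ENNReal.ofReal_ne_top]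
  refine setLIntegral_mono' measurableSet_Icc fun t ht => ?_
  have hcomp : mfderiv 𝓘(ℝ, ℝ) 𝓘(ℝ, V) (u ∘ γ) t =
      (mfderiv 𝓘(ℝ, E) 𝓘(ℝ, V) u (γ t)).comp (mfderiv 𝓘(ℝ, ℝ) 𝓘(ℝ, E) γ t) :=
    mfderiv_comp t (hu.mdifferentiable one_ne_zero _) (hγ.mdifferentiable one_ne_zero _)
  have hd : derivWithin (u ∘ γ) (Set.Icc 0 1) t = deriv (u ∘ γ) t :=
    (hcd.differentiable one_ne_zero t).derivWithin (uniqueDiffOn_Icc zero_lt_one t ht)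
  have hd' : deriv (u ∘ γ) t = mfderiv 𝓘(ℝ, E) 𝓘(ℝ, V) u (γ t)
      (mfderiv 𝓘(ℝ, ℝ) 𝓘(ℝ, E) γ t (1 : ℝ)) := by
    rw [← fderiv_apply_one_eq_deriv, ← mfderiv_eq_fderiv, hcomp]; rfl
  rw [← ENNReal.ofReal_mul hK, hd, ← ofReal_norm, hd']
  exact ENNReal.ofReal_le_ofReal (huK _ _)

end FinslerMetric

/-! ### Finsler norms in charts and norms of differentials -/

namespace FinslerMetric

variable {E : Type*} [NormedAddCommGroup E] [NormedSpace ℝ E]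
  {M : Type*} [TopologicalSpace M] [ChartedSpace E M] [IsManifold 𝓘(ℝ, E) ∞ M]

/-- The Finsler norm read in the chart at `x₀`. -/
noncomputable def chartNorm (F : FinslerMetric E M) (x₀ : M) (y w : E) : ℝ :=
  F.norm ((extChartAt 𝓘(ℝ, E) x₀).symm y)
    (mfderiv 𝓘(ℝ, E) 𝓘(ℝ, E) (extChartAt 𝓘(ℝ, E) x₀).symm y w)

/-- The chart norm is the Finsler norm composed with the tangent map of the inverse chart, which is
continuous on the tangent bundle. -/
lemma continuousOn_chartNorm (F : FinslerMetric E M) (x₀ : M) :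
    ContinuousOn (fun p : E × E => F.chartNorm x₀ p.1 p.2)
      ((extChartAt 𝓘(ℝ, E) x₀).target ×ˢ Set.univ) := by
  have hopen := isOpen_extChartAt_target (I := 𝓘(ℝ, E)) x₀
  have h1 := (contMDiffOn_extChartAt_symm (I := 𝓘(ℝ, E)) (n := 1) x₀).continuousOn_tangentMapWithin
    le_rfl hopen.uniqueMDiffOn
  have h2 : ContinuousOn (fun p : E × E => (⟨p.1, p.2⟩ : TangentBundle 𝓘(ℝ, E) E))
      ((extChartAt 𝓘(ℝ, E) x₀).target ×ˢ Set.univ) :=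
    (tangentBundleModelSpaceHomeomorph 𝓘(ℝ, E)).symm.continuous.continuousOn
  have h3 := F.continuous_norm.comp_continuousOn (h1.comp h2 fun p hp => hp.1)
  refine h3.congr fun p hp => ?_
  simp only [Function.comp, tangentMapWithin, chartNorm]
  rw [mfderivWithin_of_isOpen hopen hp.1]
  rfl

lemma chartNorm_smul (F : FinslerMetric E M) (x₀ : M) (y : E) (c : ℝ) (w : E) :
    F.chartNorm x₀ y (c • w) = |c| * F.chartNorm x₀ y w := by
  exact (congrArg _ (ContinuousLinearMap.map_smul (mfderiv 𝓘(ℝ, E) 𝓘(ℝ, E)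
    (extChartAt 𝓘(ℝ, E) x₀).symm y) c w)).trans (map_smul_eq_mul _ _ _)

lemma mdifferentiableAt_extChartAt_symm_of_mem {x₀ : M} {y : E}
    (hy : y ∈ (extChartAt 𝓘(ℝ, E) x₀).target) :
    MDifferentiableAt 𝓘(ℝ, E) 𝓘(ℝ, E) (extChartAt 𝓘(ℝ, E) x₀).symm y :=
  ((contMDiffOn_extChartAt_symm (I := 𝓘(ℝ, E)) (n := 1) x₀).contMDiffAt
    ((isOpen_extChartAt_target x₀).mem_nhds hy)).mdifferentiableAt one_ne_zero

lemma mfderiv_extChartAt_comp_symm {x₀ : M} {y : E} (hy : y ∈ (extChartAt 𝓘(ℝ, E) x₀).target)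
    (w : E) :
    mfderiv 𝓘(ℝ, E) 𝓘(ℝ, E) (extChartAt 𝓘(ℝ, E) x₀) ((extChartAt 𝓘(ℝ, E) x₀).symm y)
      (mfderiv 𝓘(ℝ, E) 𝓘(ℝ, E) (extChartAt 𝓘(ℝ, E) x₀).symm y w) = w := by
  have h1 : MDifferentiableAt 𝓘(ℝ, E) 𝓘(ℝ, E) (extChartAt 𝓘(ℝ, E) x₀)
      ((extChartAt 𝓘(ℝ, E) x₀).symm y) :=
    mdifferentiableAt_extChartAt (by simpa using (extChartAt 𝓘(ℝ, E) x₀).map_target hy)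
  have h2 := mfderiv_comp y h1 (mdifferentiableAt_extChartAt_symm_of_mem hy)
  have h3 : (extChartAt 𝓘(ℝ, E) x₀) ∘ (extChartAt 𝓘(ℝ, E) x₀).symm =ᶠ[nhds y] id := by
    filter_upwards [(isOpen_extChartAt_target x₀).mem_nhds hy] with z hz
    exact (extChartAt 𝓘(ℝ, E) x₀).right_inv hz
  rw [h3.mfderiv_eq, mfderiv_id] at h2
  exact (congrArg (fun A : E →L[ℝ] E => A w) h2).symm

lemma exists_mfderiv_extChartAt_symm_eq [FiniteDimensional ℝ E] {x₀ : M} {y : E}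
    (hy : y ∈ (extChartAt 𝓘(ℝ, E) x₀).target)
    (v : TangentSpace 𝓘(ℝ, E) ((extChartAt 𝓘(ℝ, E) x₀).symm y)) :
    ∃ w : E, mfderiv 𝓘(ℝ, E) 𝓘(ℝ, E) (extChartAt 𝓘(ℝ, E) x₀).symm y w = v := by
  let A : E →L[ℝ] E := mfderiv 𝓘(ℝ, E) 𝓘(ℝ, E) (extChartAt 𝓘(ℝ, E) x₀).symm y
  have hinj : Function.Injective (A : E →ₗ[ℝ] E) := fun w w' h => by
    rw [← mfderiv_extChartAt_comp_symm hy w, ← mfderiv_extChartAt_comp_symm hy w']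
    exact congrArg _ h
  exact LinearMap.surjective_of_injective hinj v

/-- In a chart, the Finsler norms are locally uniformly equivalent to the norm of the model. -/
lemma exists_chartNorm_le [FiniteDimensional ℝ E] (F : FinslerMetric E M) (x₀ : M) :
    ∃ C > 0, ∃ ρ > 0, Metric.ball (extChartAt 𝓘(ℝ, E) x₀ x₀) ρ ⊆ (extChartAt 𝓘(ℝ, E) x₀).target ∧
      ∀ y ∈ Metric.ball (extChartAt 𝓘(ℝ, E) x₀ x₀) ρ, ∀ w,
        F.chartNorm x₀ y w ≤ C * ‖w‖ ∧ ‖w‖ ≤ C * F.chartNorm x₀ y w := by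
  set y₀ := extChartAt 𝓘(ℝ, E) x₀ x₀ with hy₀
  have hy₀t : y₀ ∈ (extChartAt 𝓘(ℝ, E) x₀).target := mem_extChartAt_target x₀
  have hopen := isOpen_extChartAt_target (I := 𝓘(ℝ, E)) x₀
  have hcont : ∀ w, ContinuousAt (fun p : E × E => F.chartNorm x₀ p.1 p.2) (y₀, w) := fun w =>
    (F.continuousOn_chartNorm x₀).continuousAt ((hopen.prod isOpen_univ).mem_nhds ⟨hy₀t, trivial⟩)
  have hS : IsCompact (Metric.sphere (0 : E) 1) := isCompact_sphere _ _
  have hcS : ContinuousOn (fun w => F.chartNorm x₀ y₀ w) (Metric.sphere (0 : E) 1) := fun w _ =>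
    ((hcont w).comp (f := fun w : E => (y₀, w))
      (Continuous.prodMk_right y₀).continuousAt).continuousWithinAt
  have hpos : ∀ w ∈ Metric.sphere (0 : E) 1, 0 < F.chartNorm x₀ y₀ w := fun w hw => by
    refine lt_of_le_of_ne (apply_nonneg _ _) fun h => ?_
    have h1 := F.eq_zero_of_norm_eq_zero _ _ h.symm
    have h2 : (0 : E) = w := by
      refine Eq.trans ?_ (mfderiv_extChartAt_comp_symm hy₀t w)
      rw [h1]
      exact (map_zero _).symm
    rw [mem_sphere_zero_iff_norm, ← h2, norm_zero] at hw
    exact zero_ne_one hw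
  obtain ⟨m, hm, hmS⟩ : ∃ m > 0, ∀ w ∈ Metric.sphere (0 : E) 1, m < F.chartNorm x₀ y₀ w := by
    obtain ⟨m, hm, h⟩ := hS.exists_forall_le' hcS hpos
    exact ⟨m / 2, by positivity, fun w hw => lt_of_lt_of_le (by linarith) (h w hw)⟩
  obtain ⟨m', hm'S⟩ : ∃ m', ∀ w ∈ Metric.sphere (0 : E) 1, F.chartNorm x₀ y₀ w < m' := by
    obtain ⟨m', h⟩ := hS.bddAbove_image hcS
    exact ⟨m' + 1, fun w hw => lt_of_le_of_lt (h ⟨w, hw, rfl⟩) (by linarith)⟩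
  -- Compactness of the unit sphere makes the neighbourhood of y₀ uniform in the direction;
  -- homogeneity then reaches all vectors.
  have hev : ∀ᶠ y in nhds y₀, ∀ w ∈ Metric.sphere (0 : E) 1,
      m < F.chartNorm x₀ y w ∧ F.chartNorm x₀ y w < m' := by
    refine hS.eventually_forall_of_forall_eventually fun w hw => ?_
    exact ((hcont w).eventually (lt_mem_nhds (hmS w hw))).and
      ((hcont w).eventually (gt_mem_nhds (hm'S w hw)))
  obtain ⟨ρ, hρ, hball⟩ := Metric.mem_nhds_iff.1 (Filter.inter_mem (hopen.mem_nhds hy₀t) hev)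
  refine ⟨max m' m⁻¹, lt_max_of_lt_right (by positivity), ρ, hρ, fun y hy => (hball hy).1,
    fun y hy w => ?_⟩
  rcases eq_or_ne w 0 with rfl | hw
  · have : F.chartNorm x₀ y 0 = 0 := by
      have := F.chartNorm_smul x₀ y 0 0; simpa using this
    simp [this]
  · have hw' : 0 < ‖w‖ := norm_pos_iff.2 hw
    have h1 := (hball hy).2 (‖w‖⁻¹ • w) (by simp [norm_smul, hw'.ne'])
    rw [chartNorm_smul, abs_of_pos (by positivity)] at h1
    constructor
    · calc F.chartNorm x₀ y w = ‖w‖ * (‖w‖⁻¹ * F.chartNorm x₀ y w) := by field_simp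
        _ ≤ ‖w‖ * max m' m⁻¹ := by gcongr; exact h1.2.le.trans (le_max_left _ _)
        _ = _ := mul_comm _ _
    · have h2 : m * ‖w‖ ≤ F.chartNorm x₀ y w := by
        have := h1.1.le
        rwa [le_inv_mul_iff₀ hw', mul_comm] at this
      have h3 : 0 ≤ F.chartNorm x₀ y w := le_trans (by positivity) h2
      calc ‖w‖ = m⁻¹ * (m * ‖w‖) := by field_simp
        _ ≤ max m' m⁻¹ * F.chartNorm x₀ y w := by
          gcongr
          exact le_max_right _ _

/-- In a chart, the derivative along the lift of a vector. -/
lemma mfderiv_apply_mfderiv_symm {V : Type*} [NormedAddCommGroup V] [NormedSpace ℝ V] {x₀ : M}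
    {y : E} (hy : y ∈ (extChartAt 𝓘(ℝ, E) x₀).target) {u : M → V}
    (hu : MDifferentiableAt 𝓘(ℝ, E) 𝓘(ℝ, V) u ((extChartAt 𝓘(ℝ, E) x₀).symm y)) (w : E) :
    mfderiv 𝓘(ℝ, E) 𝓘(ℝ, V) u ((extChartAt 𝓘(ℝ, E) x₀).symm y)
      (mfderiv 𝓘(ℝ, E) 𝓘(ℝ, E) (extChartAt 𝓘(ℝ, E) x₀).symm y w) =
    fderiv ℝ (u ∘ (extChartAt 𝓘(ℝ, E) x₀).symm) y w := by
  have h := mfderiv_comp y hu (mdifferentiableAt_extChartAt_symm_of_mem hy)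
  rw [mfderiv_eq_fderiv] at h
  exact (congrArg (fun A : E →L[ℝ] V => A w) h).symm

section DerivNorm

variable {V : Type*} [NormedAddCommGroup V] [NormedSpace ℝ V]

lemma derivNorm_nonneg (F : FinslerMetric E M) (u : M → V) (x : M) : 0 ≤ F.derivNorm u x :=
  Real.sInf_nonneg fun _ hc => hc.1

lemma derivNorm_le (F : FinslerMetric E M) {u : M → V} {x : M} {K : ℝ} (hK : 0 ≤ K)
    (h : ∀ v : TangentSpace 𝓘(ℝ, E) x,
      Norm.norm (E := V) (mfderiv 𝓘(ℝ, E) 𝓘(ℝ, V) u x v) ≤ K * F.norm x v) :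
    F.derivNorm u x ≤ K :=
  csInf_le ⟨0, fun _ hc => hc.1⟩ ⟨hK, h⟩

lemma norm_mfderiv_symm_le [FiniteDimensional ℝ E] (F : FinslerMetric E M) {x₀ : M} {y : E}
    (hy : y ∈ (extChartAt 𝓘(ℝ, E) x₀).target) {C : ℝ}
    (hC : ∀ w, ‖w‖ ≤ C * F.chartNorm x₀ y w) (u : M → V)
    (v : TangentSpace 𝓘(ℝ, E) ((extChartAt 𝓘(ℝ, E) x₀).symm y)) :
    Norm.norm (E := V) (mfderiv 𝓘(ℝ, E) 𝓘(ℝ, V) u ((extChartAt 𝓘(ℝ, E) x₀).symm y) v) ≤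
      ‖fderiv ℝ (u ∘ (extChartAt 𝓘(ℝ, E) x₀).symm) y‖ * C *
        F.norm ((extChartAt 𝓘(ℝ, E) x₀).symm y) v := by
  obtain ⟨w, rfl⟩ := exists_mfderiv_extChartAt_symm_eq hy v
  by_cases hu : MDifferentiableAt 𝓘(ℝ, E) 𝓘(ℝ, V) u ((extChartAt 𝓘(ℝ, E) x₀).symm y)
  · refine ((congrArg _ (mfderiv_apply_mfderiv_symm hy hu w)).le.trans
      (ContinuousLinearMap.le_opNorm _ w)).trans ?_
    rw [mul_assoc]
    gcongr
    exact hC w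
  · rw [mfderiv_zero_of_not_mdifferentiableAt hu, mul_assoc]
    exact (norm_zero (E := V)).le.trans
      (mul_nonneg (norm_nonneg _) ((norm_nonneg w).trans (hC w)))

/-- The infimum defining `derivNorm` runs over a nonempty set. Otherwise it would be the default
value 0 and would bound nothing. -/
lemma exists_norm_mfderiv_le [FiniteDimensional ℝ E] (F : FinslerMetric E M) (u : M → V) (x : M) :
    ∃ c, 0 ≤ c ∧ ∀ v : TangentSpace 𝓘(ℝ, E) x,
      Norm.norm (E := V) (mfderiv 𝓘(ℝ, E) 𝓘(ℝ, V) u x v) ≤ c * F.norm x v := by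
  obtain ⟨C, hC, ρ, hρ, hball, h⟩ := F.exists_chartNorm_le x
  have hy := Metric.mem_ball_self (x := extChartAt 𝓘(ℝ, E) x x) hρ
  have key := F.norm_mfderiv_symm_le (hball hy) (fun w => (h _ hy w).2) u
  rw [extChartAt_to_inv x] at key
  exact ⟨_, by positivity, key⟩

lemma norm_mfderiv_le [FiniteDimensional ℝ E] (F : FinslerMetric E M) (u : M → V) (x : M)
    (v : TangentSpace 𝓘(ℝ, E) x) :
    Norm.norm (E := V) (mfderiv 𝓘(ℝ, E) 𝓘(ℝ, V) u x v) ≤ F.derivNorm u x * F.norm x v := by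
  obtain ⟨c₀, hc₀⟩ := F.exists_norm_mfderiv_le u x
  rcases (apply_nonneg (F.norm x) v).eq_or_lt with h | h
  · have := hc₀.2 v
    rw [← h, mul_zero] at this ⊢
    exact this
  · rw [← div_le_iff₀ h]
    refine le_csInf ⟨c₀, hc₀⟩ fun c hc => ?_
    rw [div_le_iff₀ h]
    exact hc.2 v

end DerivNorm

end FinslerMetric

/-! ### The Finsler distance induces the manifold topology -/

namespace FinslerMetric

variable {E : Type*} [NormedAddCommGroup E] [NormedSpace ℝ E]
  {M : Type*} [TopologicalSpace M] [ChartedSpace E M] [IsManifold 𝓘(ℝ, E) ∞ M]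

/-- The Finsler distance is bounded above by the length of a segment in a chart. -/
lemma edist_symm_le_of_segment (F : FinslerMetric E M) {x₀ : M} {a b : E}
    (hs : ∀ t ∈ Set.Icc (0 : ℝ) 1, a + t • (b - a) ∈ (extChartAt 𝓘(ℝ, E) x₀).target) {K : ℝ}
    (hK : ∀ t ∈ Set.Icc (0 : ℝ) 1, F.chartNorm x₀ (a + t • (b - a)) (b - a) ≤ K) :
    F.edist ((extChartAt 𝓘(ℝ, E) x₀).symm a) ((extChartAt 𝓘(ℝ, E) x₀).symm b) ≤
      ENNReal.ofReal K := by
  set η : ℝ → E := fun t => a + t • (b - a) with hη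
  have hη1 : ∀ t, HasDerivAt η (b - a) t := fun t => by
    have h := ((hasDerivAt_id t).smul_const (b - a)).const_add a
    rw [one_smul] at h
    exact h
  have hηc : ContDiff ℝ 1 η := by fun_prop
  have hηm : ContMDiff 𝓘(ℝ, ℝ) 𝓘(ℝ, E) 1 η := contMDiff_iff_contDiff.2 hηc
  have h1 := F.edist_le_pathLength (γ := (extChartAt 𝓘(ℝ, E) x₀).symm ∘ η) (a := 0) (b := 1)
    ((contMDiffOn_extChartAt_symm (I := 𝓘(ℝ, E)) x₀).comp hηm.contMDiffOn hs) zero_le_one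
  have e0 : η 0 = a := by simp [hη]
  have e1 : η 1 = b := by simp [hη]
  rw [Function.comp_apply, Function.comp_apply, e0, e1] at h1
  refine h1.trans ?_
  calc F.pathLength ((extChartAt 𝓘(ℝ, E) x₀).symm ∘ η) 0 1
      ≤ ∫⁻ _ in Set.Icc (0 : ℝ) 1, ENNReal.ofReal K := by
        refine setLIntegral_mono' measurableSet_Icc fun t ht => ENNReal.ofReal_le_ofReal ?_
        have hcomp := mfderiv_comp t (mdifferentiableAt_extChartAt_symm_of_mem (hs t ht))
          (hηm.mdifferentiable one_ne_zero t)
        have hd : mfderiv 𝓘(ℝ, ℝ) 𝓘(ℝ, E) η t (1 : ℝ) = b - a := by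
          rw [mfderiv_eq_fderiv]
          exact (fderiv_apply_one_eq_deriv (f := η) (x := t)).trans (hη1 t).deriv
        refine le_of_eq_of_le ?_ (hK t ht)
        rw [hcomp]
        exact congrArg (fun w => F.chartNorm x₀ (η t) w) hd
    _ = ENNReal.ofReal K := by simp

/-- Charts are locally Lipschitz for the Finsler distance. -/
lemma edist_symm_le (F : FinslerMetric E M) {x₀ : M} {y₀ : E} {ρ C : ℝ}
    (hball : Metric.ball y₀ ρ ⊆ (extChartAt 𝓘(ℝ, E) x₀).target)
    (hC : ∀ y ∈ Metric.ball y₀ ρ, ∀ w, F.chartNorm x₀ y w ≤ C * ‖w‖) {a b : E}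
    (ha : a ∈ Metric.ball y₀ ρ) (hb : b ∈ Metric.ball y₀ ρ) :
    F.edist ((extChartAt 𝓘(ℝ, E) x₀).symm a) ((extChartAt 𝓘(ℝ, E) x₀).symm b) ≤
      ENNReal.ofReal (C * ‖b - a‖) := by
  have hseg : ∀ t ∈ Set.Icc (0 : ℝ) 1, a + t • (b - a) ∈ Metric.ball y₀ ρ := fun t ht =>
    (convex_ball y₀ ρ).add_smul_sub_mem ha hb ht
  exact F.edist_symm_le_of_segment (fun t ht => hball (hseg t ht)) fun t ht => hC _ (hseg t ht) _

/-- A function which is differentiable at a point, and `K`-Lipschitz there for the Finsler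
distance, has a differential of norm at most `K`. -/
lemma derivNorm_le_of_edist_le [FiniteDimensional ℝ E] (F : FinslerMetric E M) {V : Type*}
    [NormedAddCommGroup V] [NormedSpace ℝ V] {u : M → V} {x₀ : M}
    (hu : MDifferentiableAt 𝓘(ℝ, E) 𝓘(ℝ, V) u x₀) {K : ℝ} (hK : 0 ≤ K)
    (hlip : ∀ y, ‖u y - u x₀‖ₑ ≤ ENNReal.ofReal K * F.edist x₀ y) : F.derivNorm u x₀ ≤ K := by
  set ψ := (extChartAt 𝓘(ℝ, E) x₀).symm with hψ
  set y₀ := extChartAt 𝓘(ℝ, E) x₀ x₀ with hy₀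
  have hx₀ : ψ y₀ = x₀ := extChartAt_to_inv x₀
  have hy₀t : y₀ ∈ (extChartAt 𝓘(ℝ, E) x₀).target := mem_extChartAt_target x₀
  have hopen := isOpen_extChartAt_target (I := 𝓘(ℝ, E)) x₀
  have hu' : MDifferentiableAt 𝓘(ℝ, E) 𝓘(ℝ, V) u (ψ y₀) := by rwa [hx₀]
  have key : ∀ v : TangentSpace 𝓘(ℝ, E) (ψ y₀),
      Norm.norm (E := V) (mfderiv 𝓘(ℝ, E) 𝓘(ℝ, V) u (ψ y₀) v) ≤ K * F.norm (ψ y₀) v := by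
    intro v
    obtain ⟨w, rfl⟩ := exists_mfderiv_extChartAt_symm_eq hy₀t v
    refine (congrArg _ (mfderiv_apply_mfderiv_symm hy₀t hu' w)).le.trans ?_
    change ‖fderiv ℝ (u ∘ ψ) y₀ w‖ ≤ K * F.chartNorm x₀ y₀ w
    have hdiff : DifferentiableAt ℝ (u ∘ ψ) y₀ := by
      rw [← mdifferentiableAt_iff_differentiableAt]
      exact hu'.comp y₀ (mdifferentiableAt_extChartAt_symm_of_mem hy₀t)
    -- Along the chart segment t ↦ y₀ + tw the Finsler distance to x₀ is at most |t| times the norm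
    -- of w plus ε', by continuity of the metric. The Lipschitz bound then controls the derivative
    -- at t = 0.
    refine le_of_forall_pos_le_add fun ε hε => ?_
    obtain ⟨ε', hε', hKε⟩ : ∃ ε' > 0, K * ε' ≤ ε :=
      ⟨ε / (K + 1), by positivity, by
        rw [mul_div_assoc', div_le_iff₀ (by positivity)]; nlinarith⟩
    have hη : ContinuousAt (fun t : ℝ => y₀ + t • w) 0 := by fun_prop
    have hη0 : y₀ + (0 : ℝ) • w = y₀ := by simp
    have hcn : ContinuousAt (fun t : ℝ => F.chartNorm x₀ (y₀ + t • w) w) 0 := by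
      have h1 : ContinuousAt (fun p : E × E => F.chartNorm x₀ p.1 p.2) (y₀ + (0 : ℝ) • w, w) :=
        (F.continuousOn_chartNorm x₀).continuousAt
          ((hopen.prod isOpen_univ).mem_nhds ⟨by rwa [hη0], trivial⟩)
      exact ContinuousAt.comp (f := fun t : ℝ => (y₀ + t • w, w)) h1 (by fun_prop)
    have hev : ∀ᶠ t in nhds (0 : ℝ), y₀ + t • w ∈ (extChartAt 𝓘(ℝ, E) x₀).target ∧
        F.chartNorm x₀ (y₀ + t • w) w < F.chartNorm x₀ y₀ w + ε' := by
      refine (hη.eventually (hopen.mem_nhds ?_)).and (hcn.eventually (gt_mem_nhds ?_)) <;>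
        simp only [hη0]
      exacts [hy₀t, lt_add_of_pos_right _ hε']
    obtain ⟨δ, hδ, hδball⟩ := Metric.eventually_nhds_iff_ball.1 hev
    have hN : 0 ≤ F.chartNorm x₀ y₀ w := apply_nonneg _ _
    have hd : HasDerivAt (fun t : ℝ => (u ∘ ψ) (y₀ + t • w)) (fderiv ℝ (u ∘ ψ) y₀ w) 0 := by
      have h1 : HasDerivAt (fun t : ℝ => y₀ + t • w) w 0 := by
        have h := ((hasDerivAt_id (0 : ℝ)).smul_const w).const_add y₀
        rw [one_smul] at h
        exact h
      have h2 : HasFDerivAt (u ∘ ψ) (fderiv ℝ (u ∘ ψ) y₀) (y₀ + (0 : ℝ) • w) := by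
        rw [hη0]
        exact hdiff.hasFDerivAt
      exact h2.comp_hasDerivAt (f := fun t : ℝ => y₀ + t • w) 0 h1
    have := hd.le_of_lip' (C := K * (F.chartNorm x₀ y₀ w + ε')) (by positivity) ?_
    · linarith
    filter_upwards [Metric.ball_mem_nhds 0 hδ] with t ht
    have hin : ∀ s ∈ Set.Icc (0 : ℝ) 1, s * t ∈ Metric.ball (0 : ℝ) δ := fun s hs => by
      rw [mem_ball_zero_iff, norm_mul, Real.norm_of_nonneg hs.1] at *
      exact lt_of_le_of_lt (mul_le_of_le_one_left (norm_nonneg _) hs.2) ht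
    have hed : F.edist (ψ y₀) (ψ (y₀ + t • w)) ≤
        ENNReal.ofReal (|t| * (F.chartNorm x₀ y₀ w + ε')) := by
      refine F.edist_symm_le_of_segment (fun s hs => ?_) (fun s hs => ?_)
      · have := (hδball _ (hin s hs)).1
        rwa [add_sub_cancel_left, smul_smul]
      · have := (hδball _ (hin s hs)).2.le
        rw [add_sub_cancel_left, smul_smul, chartNorm_smul]
        gcongr
    rw [hx₀] at hed
    have h2 : ‖u (ψ (y₀ + t • w)) - u x₀‖ₑ ≤
        ENNReal.ofReal K * ENNReal.ofReal (|t| * (F.chartNorm x₀ y₀ w + ε')) :=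
      (hlip (ψ (y₀ + t • w))).trans (by gcongr)
    rw [← ENNReal.ofReal_mul hK, ← ofReal_norm, ENNReal.ofReal_le_ofReal_iff (by positivity)] at h2
    simp only [Function.comp, zero_smul, add_zero, hx₀, sub_zero, Real.norm_eq_abs]
    linarith
  rw [hx₀] at key
  exact F.derivNorm_le hK key

lemma eventually_derivNorm_le [FiniteDimensional ℝ E] (F : FinslerMetric E M) {V : Type*}
    [NormedAddCommGroup V] [NormedSpace ℝ V] {u : M → V}
    (hu : ContMDiff 𝓘(ℝ, E) 𝓘(ℝ, V) 1 u) (x₀ : M) :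
    ∃ C, ∀ᶠ x in nhds x₀, F.derivNorm u x ≤ C := by
  obtain ⟨C, hC, ρ, hρ, hball, h⟩ := F.exists_chartNorm_le x₀
  have hopen := isOpen_extChartAt_target (I := 𝓘(ℝ, E)) x₀
  have hcd : ContDiffOn ℝ 1 (u ∘ (extChartAt 𝓘(ℝ, E) x₀).symm)
      (extChartAt 𝓘(ℝ, E) x₀).target := by
    rw [← contMDiffOn_iff_contDiffOn]
    exact hu.comp_contMDiffOn (contMDiffOn_extChartAt_symm x₀)
  have hcont := (hcd.continuousOn_fderiv_of_isOpen hopen le_rfl).continuousAt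
    (hopen.mem_nhds (mem_extChartAt_target x₀))
  set y₀ := extChartAt 𝓘(ℝ, E) x₀ x₀
  set B := ‖fderiv ℝ (u ∘ (extChartAt 𝓘(ℝ, E) x₀).symm) y₀‖ + 1
  have hev := (hcont.norm.eventually (gt_mem_nhds (lt_add_one _))).and (Metric.ball_mem_nhds y₀ hρ)
  refine ⟨B * C, ?_⟩
  filter_upwards [(continuousAt_extChartAt x₀).eventually hev,
    extChartAt_source_mem_nhds (I := 𝓘(ℝ, E)) x₀] with x hx hxs
  have key := F.norm_mfderiv_symm_le (hball hx.2) (fun w => (h _ hx.2 w).2) u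
  rw [(extChartAt 𝓘(ℝ, E) x₀).left_inv hxs] at key
  refine (F.derivNorm_le (by positivity) key).trans ?_
  gcongr
  exact hx.1.le

lemma derivNorm_of_notMem_tsupport (F : FinslerMetric E M) {V : Type*}
    [NormedAddCommGroup V] [NormedSpace ℝ V] {u : M → V} {x : M} (hx : x ∉ tsupport u) :
    F.derivNorm u x = 0 := by
  refine le_antisymm (F.derivNorm_le le_rfl fun v => ?_) (F.derivNorm_nonneg u x)
  have h : u =ᶠ[nhds x] fun _ => 0 := by
    filter_upwards [(isClosed_tsupport u).isOpen_compl.mem_nhds hx] with z hz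
    exact image_eq_zero_of_notMem_tsupport hz
  rw [h.mfderiv_eq, mfderiv_const, zero_mul]
  exact (norm_zero (E := V)).le

lemma bddAbove_derivNorm_of_hasCompactSupport [FiniteDimensional ℝ E] (F : FinslerMetric E M)
    {V : Type*} [NormedAddCommGroup V] [NormedSpace ℝ V] {u : M → V}
    (hu : ContMDiff 𝓘(ℝ, E) 𝓘(ℝ, V) 1 u) (hc : HasCompactSupport u) :
    ∃ K, 0 ≤ K ∧ ∀ x, F.derivNorm u x ≤ K := by
  have key : ∃ K, ∀ x ∈ tsupport u, F.derivNorm u x ≤ K := by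
    refine hc.induction_on (p := fun s => ∃ K, ∀ x ∈ s, F.derivNorm u x ≤ K) ⟨0, by simp⟩
      (fun s t hst ⟨K, hK⟩ => ⟨K, fun x hx => hK x (hst hx)⟩)
      (fun s t ⟨K, hK⟩ ⟨K', hK'⟩ => ⟨max K K', fun x hx => ?_⟩) fun x _ => ?_
    · exact hx.elim (fun h => (hK x h).trans (le_max_left _ _))
        fun h => (hK' x h).trans (le_max_right _ _)
    · obtain ⟨C, hC⟩ := F.eventually_derivNorm_le hu x
      exact ⟨_, mem_nhdsWithin_of_mem_nhds hC, C, fun y hy => hy⟩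
  obtain ⟨K, hK⟩ := key
  refine ⟨max K 0, le_max_right _ _, fun x => ?_⟩
  by_cases hx : x ∈ tsupport u
  · exact (hK x hx).trans (le_max_left _ _)
  · rw [F.derivNorm_of_notMem_tsupport hx]; exact le_max_right _ _

/-- Finsler balls are neighbourhoods, because chart segments are short for the Finsler length. -/
lemma edist_lt_mem_nhds [FiniteDimensional ℝ E] (F : FinslerMetric E M) (x : M) {c : ℝ≥0∞}
    (hc : 0 < c) : {y | F.edist x y < c} ∈ nhds x := by
  obtain ⟨C, hC, ρ, hρ, hball, h⟩ := F.exists_chartNorm_le x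
  set y₀ := extChartAt 𝓘(ℝ, E) x x
  have h1 : Continuous (fun y => ENNReal.ofReal (C * ‖y - y₀‖)) :=
    ENNReal.continuous_ofReal.comp (by fun_prop)
  have h2 : ∀ᶠ y in nhds y₀, ENNReal.ofReal (C * ‖y - y₀‖) < c :=
    h1.continuousAt.eventually (gt_mem_nhds (by simpa using hc))
  filter_upwards [(continuousAt_extChartAt x).eventually (h2.and (Metric.ball_mem_nhds y₀ hρ)),
    extChartAt_source_mem_nhds (I := 𝓘(ℝ, E)) x] with z hz hzs
  have := F.edist_symm_le hball (fun y hy w => (h y hy w).1) (Metric.mem_ball_self hρ) hz.2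
  rw [(extChartAt 𝓘(ℝ, E) x).left_inv hzs, extChartAt_to_inv x] at this
  exact this.trans_lt hz.1

/-- Neighbourhoods contain Finsler balls: a compactly supported bump function is Lipschitz for the
Finsler distance, so passing from the value 1 to the value 0 costs a definite distance. -/
lemma exists_edist_lt_subset [FiniteDimensional ℝ E] [T2Space M] (F : FinslerMetric E M)
    (hfin : ∀ x y, F.edist x y ≠ ⊤) {x : M} {s : Set M} (hs : s ∈ nhds x) :
    ∃ c > 0, {y | F.edist x y < c} ⊆ s := by
  obtain ⟨f, -, hf⟩ := (SmoothBumpFunction.nhds_basis_support (I := 𝓘(ℝ, E)) hs).mem_iff.1 hs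
  have hf1 : ContMDiff 𝓘(ℝ, E) 𝓘(ℝ, ℝ) 1 f := f.contMDiff.of_le (by simp)
  obtain ⟨K, hK, hfK⟩ := F.bddAbove_derivNorm_of_hasCompactSupport hf1 f.hasCompactSupport
  refine ⟨(ENNReal.ofReal (K + 1))⁻¹, by simp, fun y hy => hf fun hy0 => ?_⟩
  have h1 := F.edist_le_of_norm_mfderiv_le hf1 (K := K + 1) (by positivity) (fun z v =>
    (F.norm_mfderiv_le f z v).trans (mul_le_mul_of_nonneg_right ((hfK z).trans (by linarith))
      (apply_nonneg _ _))) (hfin x y)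
  rw [hy0, f.eq_one, zero_sub, enorm_neg, enorm_one] at h1
  have hK1 : ENNReal.ofReal (K + 1) ≠ 0 := by simp; positivity
  have h2 : ENNReal.ofReal (K + 1) * F.edist x y <
      ENNReal.ofReal (K + 1) * (ENNReal.ofReal (K + 1))⁻¹ :=
    ENNReal.mul_lt_mul_right hK1 ENNReal.ofReal_ne_top hy
  rw [ENNReal.mul_inv_cancel hK1 ENNReal.ofReal_ne_top] at h2
  exact absurd h1 h2.not_ge

/-- A bounded Finsler distance comes from a pseudometric compatible with the topology. -/
lemma exists_pseudoMetricSpace [FiniteDimensional ℝ E] [T2Space M] (F : FinslerMetric E M)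
    (hfin : ∀ x y, F.edist x y ≠ ⊤) :
    ∃ m : PseudoMetricSpace M, ‹TopologicalSpace M› = m.toUniformSpace.toTopologicalSpace ∧
      ∀ x y, F.edist x y = EDist.edist x y := by
  let m₀ : PseudoEMetricSpace M := PseudoEMetricSpace.ofEDistOfTopology F.edist F.edist_self
    F.edist_comm F.edist_triangle (fun x => (nhds x).basis_sets.to_hasBasis'
      (fun s hs => F.exists_edist_lt_subset hfin hs) fun c hc => F.edist_lt_mem_nhds x hc)
  exact ⟨PseudoEMetricSpace.toPseudoMetricSpace hfin, rfl, fun x y => rfl⟩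

end FinslerMetric

/-! ### C^1 functions and the Finsler distance -/

namespace FinslerMetric

variable {E : Type*} [NormedAddCommGroup E] [NormedSpace ℝ E]
  {M : Type*} [PseudoMetricSpace M] [ChartedSpace E M] [IsManifold 𝓘(ℝ, E) ∞ M]
  {F : FinslerMetric E M}

lemma ball_eq_metricBall (hF : ∀ x y, F.edist x y = EDist.edist x y) (x : M) (ε : ℝ) :
    F.ball x ε = Metric.ball x ε := by
  ext y
  rw [Metric.mem_ball', ← edist_lt_ofReal, ← hF]; rfl

lemma norm_sub_le_of_derivNorm_le [FiniteDimensional ℝ E]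
    (hF : ∀ x y, F.edist x y = EDist.edist x y) {V : Type*} [NormedAddCommGroup V]
    [NormedSpace ℝ V] [CompleteSpace V] {u : M → V} (hu : ContMDiff 𝓘(ℝ, E) 𝓘(ℝ, V) 1 u)
    {K : ℝ} (huK : ∀ x, F.derivNorm u x ≤ K) (x y : M) : ‖u x - u y‖ ≤ K * dist x y := by
  have hK : 0 ≤ K := (F.derivNorm_nonneg u x).trans (huK x)
  have h := F.edist_le_of_norm_mfderiv_le hu hK (fun z v => (F.norm_mfderiv_le u z v).trans
    (mul_le_mul_of_nonneg_right (huK z) (apply_nonneg _ _))) (x := y) (y := x)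
    (by rw [hF]; exact edist_ne_top _ _)
  rwa [hF, edist_dist, ← ENNReal.ofReal_mul hK, ← ofReal_norm,
    ENNReal.ofReal_le_ofReal_iff (by positivity), dist_comm] at h

lemma derivNorm_le_of_norm_sub_le [FiniteDimensional ℝ E]
    (hF : ∀ x y, F.edist x y = EDist.edist x y) {V : Type*} [NormedAddCommGroup V]
    [NormedSpace ℝ V] {u : M → V} (hu : ContMDiff 𝓘(ℝ, E) 𝓘(ℝ, V) 1 u) {K : ℝ} (hK : 0 ≤ K)
    (hlip : ∀ x y, ‖u x - u y‖ ≤ K * dist x y) (x : M) : F.derivNorm u x ≤ K := by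
  refine F.derivNorm_le_of_edist_le (hu.mdifferentiable one_ne_zero x) hK fun y => ?_
  rw [hF, edist_dist, ← ENNReal.ofReal_mul hK, ← ofReal_norm, dist_comm]
  exact ENNReal.ofReal_le_ofReal (hlip y x)

lemma exists_chart_comparison [FiniteDimensional ℝ E]
    (hF : ∀ x y, F.edist x y = EDist.edist x y) (x₀ : M) :
    ∃ C > 0, ∃ ρ > 0, Metric.ball (extChartAt 𝓘(ℝ, E) x₀ x₀) ρ ⊆ (extChartAt 𝓘(ℝ, E) x₀).target ∧
      ∀ a ∈ Metric.ball (extChartAt 𝓘(ℝ, E) x₀ x₀) ρ,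
      ∀ b ∈ Metric.ball (extChartAt 𝓘(ℝ, E) x₀ x₀) ρ,
        dist ((extChartAt 𝓘(ℝ, E) x₀).symm a) ((extChartAt 𝓘(ℝ, E) x₀).symm b) ≤ C * ‖b - a‖ := by
  obtain ⟨C, hC, ρ, hρ, hball, h⟩ := F.exists_chartNorm_le x₀
  refine ⟨C, hC, ρ, hρ, hball, fun a ha b hb => ?_⟩
  have := F.edist_symm_le hball (fun y hy w => (h y hy w).1) ha hb
  rwa [hF, edist_dist, ENNReal.ofReal_le_ofReal_iff (by positivity)] at this

lemma contDiffOn_comp_symm {V : Type*} [NormedAddCommGroup V] [NormedSpace ℝ V] {u : M → V}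
    (hu : ContMDiff 𝓘(ℝ, E) 𝓘(ℝ, V) 1 u) (x₀ : M) :
    ContDiffOn ℝ 1 (u ∘ (extChartAt 𝓘(ℝ, E) x₀).symm) (extChartAt 𝓘(ℝ, E) x₀).target := by
  rw [← contMDiffOn_iff_contDiffOn]
  exact hu.comp_contMDiffOn (contMDiffOn_extChartAt_symm x₀)

/-- A series of `C^1` functions whose Lipschitz constants are summable is `C^1`. -/
lemma contMDiff_tsum [FiniteDimensional ℝ E] (hF : ∀ x y, F.edist x y = EDist.edist x y)
    {f : ℕ → M → ℝ} (hf : ∀ j, ContMDiff 𝓘(ℝ, E) 𝓘(ℝ, ℝ) 1 (f j)) {a : ℕ → ℝ}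
    (ha : Summable a) (hlip : ∀ j x y, |f j x - f j y| ≤ a j * dist x y)
    (hsum : ∀ x, Summable fun j => f j x) :
    ContMDiff 𝓘(ℝ, E) 𝓘(ℝ, ℝ) 1 fun x => ∑' j, f j x := by
  intro x₀
  obtain ⟨C, hC, ρ, hρ, hball, hdist⟩ := exists_chart_comparison hF x₀
  set y₀ := extChartAt 𝓘(ℝ, E) x₀ x₀
  set ψ := (extChartAt 𝓘(ℝ, E) x₀).symm
  have hopen := isOpen_extChartAt_target (I := 𝓘(ℝ, E)) x₀
  have hcd : ∀ j, ContDiffOn ℝ 1 (f j ∘ ψ) (extChartAt 𝓘(ℝ, E) x₀).target := fun j =>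
    contDiffOn_comp_symm (hf j) x₀
  -- Charts are locally Lipschitz, so summable Lipschitz constants give summable bounds for the
  -- derivatives in the chart.
  have hbound : ∀ j, ∀ y ∈ Metric.ball y₀ ρ, ‖fderiv ℝ (f j ∘ ψ) y‖ ≤ |a j| * C := by
    intro j y hy
    refine norm_fderiv_le_of_lip' ℝ (by positivity) ?_
    filter_upwards [Metric.isOpen_ball.mem_nhds hy] with z hz
    calc ‖(f j ∘ ψ) z - (f j ∘ ψ) y‖ ≤ a j * dist (ψ z) (ψ y) := hlip j _ _
      _ ≤ |a j| * (C * ‖z - y‖) := by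
        gcongr
        · exact le_abs_self _
        · rw [dist_comm]; exact hdist y hy z hz
      _ = |a j| * C * ‖z - y‖ := by ring
  have hder : ∀ y ∈ Metric.ball y₀ ρ, HasFDerivAt (fun y => ∑' j, (f j ∘ ψ) y)
      (∑' j, fderiv ℝ (f j ∘ ψ) y) y := fun y hy =>
    hasFDerivAt_tsum_of_isPreconnected (ha.abs.mul_right C) Metric.isOpen_ball
      (convex_ball y₀ ρ).isPreconnected
      (fun j z hz => (((hcd j).contDiffAt (hopen.mem_nhds (hball hz))).differentiableAt
        one_ne_zero).hasFDerivAt) hbound (Metric.mem_ball_self hρ) (hsum _) hy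
  have hC1 : ContDiffAt ℝ 1 (fun y => ∑' j, (f j ∘ ψ) y) y₀ := by
    refine contDiffAt_one_iff.2 ⟨_, _, Metric.ball_mem_nhds y₀ hρ, ?_, hder⟩
    exact continuousOn_tsum (fun j => ((hcd j).continuousOn_fderiv_of_isOpen hopen le_rfl).mono
      hball) (ha.abs.mul_right C) hbound
  refine (hC1.contMDiffAt.comp x₀ (contMDiffAt_extChartAt (I := 𝓘(ℝ, E)))).congr_of_eventuallyEq ?_
  filter_upwards [extChartAt_source_mem_nhds (I := 𝓘(ℝ, E)) x₀] with x hx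
  have h : ψ (extChartAt 𝓘(ℝ, E) x₀ x) = x := (extChartAt 𝓘(ℝ, E) x₀).left_inv hx
  change ∑' j, f j x = ∑' j, f j (ψ (extChartAt 𝓘(ℝ, E) x₀ x))
  rw [h]

/-- A nonconstant `C^1` function oscillates at least linearly at all small scales around some
point. -/
lemma exists_oscillation_of_ne [FiniteDimensional ℝ E]
    (hF : ∀ x y, F.edist x y = EDist.edist x y) {f : M → ℝ}
    (hf : ContMDiff 𝓘(ℝ, E) 𝓘(ℝ, ℝ) 1 f) {p q : M} (hpq : f p ≠ f q) :
    ∃ z, ∃ O ∈ nhds z, ∃ c > 0, ∃ ρ₀ > 0, ∀ x ∈ O, ∀ ρ, 0 < ρ → ρ < ρ₀ →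
      ∃ x', dist x' x < ρ ∧ c * ρ ≤ |f x' - f x| := by
  obtain ⟨z, hz⟩ : ∃ z, 0 < F.derivNorm f z := by
    by_contra! h
    have := norm_sub_le_of_derivNorm_le hF hf h p q
    rw [zero_mul, norm_le_zero_iff, sub_eq_zero] at this
    exact hpq this
  obtain ⟨C, hC, ρ, hρ, hball, hdist⟩ := exists_chart_comparison hF z
  have hy₀t := mem_extChartAt_target (I := 𝓘(ℝ, E)) z
  have hopen := isOpen_extChartAt_target (I := 𝓘(ℝ, E)) z
  have hcda := (contDiffOn_comp_symm hf z).contDiffAt (hopen.mem_nhds hy₀t)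
  obtain ⟨w, hw⟩ : ∃ w, fderiv ℝ (f ∘ (extChartAt 𝓘(ℝ, E) z).symm) (extChartAt 𝓘(ℝ, E) z z) w
      ≠ 0 := by
    by_contra! h
    have key : F.derivNorm f ((extChartAt 𝓘(ℝ, E) z).symm (extChartAt 𝓘(ℝ, E) z z)) ≤ 0 := by
      refine F.derivNorm_le le_rfl fun v => ?_
      obtain ⟨w, rfl⟩ := exists_mfderiv_extChartAt_symm_eq hy₀t v
      refine (congrArg _ (mfderiv_apply_mfderiv_symm hy₀t
        (hf.mdifferentiable one_ne_zero _) w)).le.trans ?_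
      rw [h w, norm_zero, zero_mul]
    rw [extChartAt_to_inv] at key
    exact absurd key hz.not_ge
  set ψ := (extChartAt 𝓘(ℝ, E) z).symm
  set y₀ := extChartAt 𝓘(ℝ, E) z z
  set A := fderiv ℝ (f ∘ ψ) y₀
  have hw0 : 0 < ‖w‖ := norm_pos_iff.2 fun h => hw (by rw [h, map_zero])
  have hAw : 0 < |A w| := abs_pos.2 hw
  -- Strict differentiability compares pairs of points, so the lower bound on the increment is
  -- uniform over base points near z.
  have hstrict := (hcda.hasStrictFDerivAt one_ne_zero).isLittleO.def
    (c := |A w| / (2 * ‖w‖)) (by positivity)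
  obtain ⟨δ, hδ, hδ'⟩ := Metric.eventually_nhds_iff_ball.1 hstrict
  set δ₁ := min δ ρ
  have hδ₁ : 0 < δ₁ := lt_min hδ hρ
  -- The chart displacement then has length σ/(2C), hence Finsler distance at most σ/2.
  set t₀ := 1 / (2 * C * ‖w‖)
  refine ⟨z, extChartAt 𝓘(ℝ, E) z ⁻¹' Metric.ball y₀ (δ₁ / 2) ∩ (extChartAt 𝓘(ℝ, E) z).source,
    Filter.inter_mem ((continuousAt_extChartAt z).preimage_mem_nhds
      (Metric.ball_mem_nhds y₀ (by positivity))) (extChartAt_source_mem_nhds z),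
    t₀ * (|A w| / 2), by positivity, C * δ₁, by positivity, fun x hx σ hσ hσ₀ => ?_⟩
  have hx1 : ψ (extChartAt 𝓘(ℝ, E) z x) = x := (extChartAt 𝓘(ℝ, E) z).left_inv hx.2
  set a := extChartAt 𝓘(ℝ, E) z x
  have hta : ‖(t₀ * σ) • w‖ = σ / (2 * C) := by
    rw [norm_smul, Real.norm_of_nonneg (by positivity)]
    simp only [t₀]; field_simp
  have hta' : σ / (2 * C) < δ₁ / 2 := by
    rw [div_lt_div_iff₀ (by positivity) (by positivity)]; nlinarith
  have ha : a ∈ Metric.ball y₀ δ₁ := Metric.ball_subset_ball (by linarith) hx.1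
  have hb : a + (t₀ * σ) • w ∈ Metric.ball y₀ δ₁ := by
    have h1 := mem_ball_iff_norm.1 hx.1
    rw [mem_ball_iff_norm]
    calc ‖a + (t₀ * σ) • w - y₀‖ = ‖(a - y₀) + (t₀ * σ) • w‖ := by congr 1; abel
      _ ≤ ‖a - y₀‖ + ‖(t₀ * σ) • w‖ := norm_add_le _ _
      _ < δ₁ / 2 + δ₁ / 2 := by rw [hta]; exact add_lt_add h1 hta'
      _ = δ₁ := by ring
  refine ⟨ψ (a + (t₀ * σ) • w), ?_, ?_⟩
  · have h1 := hdist a (Metric.ball_subset_ball (min_le_right _ _) ha) _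
      (Metric.ball_subset_ball (min_le_right _ _) hb)
    rw [hx1, add_sub_cancel_left, hta, dist_comm] at h1
    refine h1.trans_lt ?_
    calc C * (σ / (2 * C)) = σ / 2 := by field_simp
      _ < σ := by linarith
  · have h1 := hδ' (a + (t₀ * σ) • w, a) (by
      rw [← ball_prod_same]
      exact ⟨Metric.ball_subset_ball (min_le_left _ _) hb,
        Metric.ball_subset_ball (min_le_left _ _) ha⟩)
    simp only [Function.comp, hx1, add_sub_cancel_left, hta, map_smul, smul_eq_mul] at h1
    have h2 : |A w| / (2 * ‖w‖) * (σ / (2 * C)) = t₀ * σ * (|A w| / 2) := by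
      simp only [t₀]; field_simp
    have h3 : |t₀ * σ * A w| = t₀ * σ * |A w| := by
      rw [abs_mul, abs_of_pos (by positivity)]
    rw [h2, Real.norm_eq_abs] at h1
    have h4 := abs_sub_abs_le_abs_sub (t₀ * σ * A w) (f (ψ (a + (t₀ * σ) • w)) - f x)
    rw [abs_sub_comm (t₀ * σ * A w)] at h4
    rw [h3] at h4
    nlinarith

end FinslerMetric

/-! ### Phases and uniform non-integrability -/

/-- The word of length `n` all of whose letters are `i`. -/
def Word.replicate {ι : Type*} : ∀ n : ℕ, ι → Word ι n
  | 0, _ => PUnit.unit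
  | n + 1, i => (i, Word.replicate n i)

namespace BranchSystem

variable {X ι : Type*}

/-- Two words that begin with the same `w` share the term `(S.pow m).r w`, which drops out of the
difference of their roof functions. -/
lemma exists_word_append (S : BranchSystem X ι) {n : ℕ} (v : Word ι n) :
    ∀ {m : ℕ} (w : Word ι m), ∃ w' : Word ι (n + m), ∀ x,
      (S.pow (n + m)).r w' x = (S.pow m).r w x + (S.pow n).r v ((S.pow m).branch w x)
  | 0, _ => ⟨v, fun _ => (zero_add _).symm⟩
  | m + 1, w => by
    obtain ⟨w', hw'⟩ := S.exists_word_append v (m := m) w.2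
    refine ⟨(w.1, w'), fun x => ?_⟩
    change S.r w.1 x + (S.pow (n + m)).r w' (S.branch w.1 x) = _
    rw [hw', ← add_assoc]
    rfl

lemma pow_r_replicate (S : BranchSystem X ι) (i : ι) (n : ℕ) (x : X) :
    (S.pow n).r (Word.replicate n i) x =
      ∑ j ∈ Finset.range n, S.r i ((S.branch i)^[j] x) := by
  induction n generalizing x with
  | zero => rfl
  | succ n ih =>
    rw [Finset.sum_range_succ', add_comm (Finset.sum _ _)]
    exact congrArg (S.r i x + ·) (ih (S.branch i x))

/-- The sum of the roof function along the inverse orbits following the branch `i`, normalized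
at `x₀`. -/
noncomputable def phase (S : BranchSystem X ι) (i : ι) (x₀ x : X) : ℝ :=
  ∑' j, (S.r i ((S.branch i)^[j] x) - S.r i ((S.branch i)^[j] x₀))

variable [PseudoMetricSpace X] {S : BranchSystem X ι} {θ C₁ C₂ : ℝ}

lemma IsRegular.dist_iterate_le (hS : S.IsRegular θ C₁ C₂) (hθ : 0 ≤ θ) (i : ι) (j : ℕ) (x y : X) :
    dist ((S.branch i)^[j] x) ((S.branch i)^[j] y) ≤ θ ^ j * dist x y := by
  induction j generalizing x y with
  | zero => simp
  | succ j ih =>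
    calc _ ≤ θ ^ j * dist (S.branch i x) (S.branch i y) := ih _ _
      _ ≤ θ ^ j * (θ * dist x y) := by gcongr; exact hS.contr _ _ _
      _ = _ := by ring

lemma IsRegular.abs_r_iterate_sub_le (hS : S.IsRegular θ C₁ C₂) (hθ : 0 ≤ θ) (hC₂ : 0 ≤ C₂)
    (i : ι) (j : ℕ) (x y : X) :
    |S.r i ((S.branch i)^[j] x) - S.r i ((S.branch i)^[j] y)| ≤ C₂ * θ ^ j * dist x y := by
  rw [mul_assoc]
  exact (hS.r_lip _ _ _).trans (mul_le_mul_of_nonneg_left (hS.dist_iterate_le hθ i j x y) hC₂)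

lemma IsRegular.summable_phase (hS : S.IsRegular θ C₁ C₂) (hθ : 0 ≤ θ) (hθ1 : θ < 1) (hC₂ : 0 ≤ C₂)
    (i : ι) (x y : X) :
    Summable fun j => S.r i ((S.branch i)^[j] x) - S.r i ((S.branch i)^[j] y) :=
  Summable.of_norm_bounded (((summable_geometric_of_lt_one hθ hθ1).mul_left C₂).mul_right _)
    fun j => hS.abs_r_iterate_sub_le hθ hC₂ i j x y

/-- Increments of the phase do not depend on the normalization point, so the base point can be moved
to where an estimate is wanted. -/
lemma IsRegular.phase_sub (hS : S.IsRegular θ C₁ C₂) (hθ : 0 ≤ θ) (hθ1 : θ < 1) (hC₂ : 0 ≤ C₂)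
    (i : ι) (x₀ x y : X) : S.phase i x₀ x - S.phase i x₀ y = S.phase i y x := by
  rw [phase, phase, phase, ← (hS.summable_phase hθ hθ1 hC₂ i x x₀).tsum_sub
    (hS.summable_phase hθ hθ1 hC₂ i y x₀)]
  exact tsum_congr fun j => by ring

/-- The phase is a coboundary up to the roof function. -/
lemma IsRegular.phase_eq (hS : S.IsRegular θ C₁ C₂) (hθ : 0 ≤ θ) (hθ1 : θ < 1) (hC₂ : 0 ≤ C₂)
    (i : ι) (x₀ x : X) :
    S.phase i x₀ x = S.r i x - S.r i x₀ +
      (S.phase i x₀ (S.branch i x) - S.phase i x₀ (S.branch i x₀)) := by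
  rw [hS.phase_sub hθ hθ1 hC₂, phase, (hS.summable_phase hθ hθ1 hC₂ i x x₀).tsum_eq_zero_add]
  rfl

/-- The finite sums of the roof function approximate the phase in the Lipschitz sense. -/
lemma IsRegular.abs_phase_sub_sum_le (hS : S.IsRegular θ C₁ C₂) (hθ : 0 ≤ θ) (hθ1 : θ < 1)
    (hC₂ : 0 ≤ C₂) (i : ι) (n : ℕ) (x y : X) :
    |S.phase i y x -
      ((S.pow n).r (Word.replicate n i) x - (S.pow n).r (Word.replicate n i) y)| ≤
      C₂ / (1 - θ) * θ ^ n * dist x y := by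
  have hs := hS.summable_phase hθ hθ1 hC₂ i x y
  rw [pow_r_replicate, pow_r_replicate, ← Finset.sum_sub_distrib, phase,
    ← hs.sum_add_tsum_nat_add n, add_sub_cancel_left]
  have hg : HasSum (fun j => C₂ * θ ^ (j + n) * dist x y) (C₂ / (1 - θ) * θ ^ n * dist x y) := by
    have := (hasSum_geometric_of_lt_one hθ hθ1).mul_left (C₂ * θ ^ n * dist x y)
    convert! this using 1
    · ext j; ring
    · ring
  rw [← Real.norm_eq_abs]
  refine tsum_of_norm_bounded hg fun j => ?_
  rw [Real.norm_eq_abs]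
  exact hS.abs_r_iterate_sub_le hθ hC₂ i (j + n) x y

lemma IsRegular.abs_phase_le (hS : S.IsRegular θ C₁ C₂) (hθ : 0 ≤ θ) (hθ1 : θ < 1)
    (hC₂ : 0 ≤ C₂) (i : ι) (x y : X) : |S.phase i y x| ≤ C₂ / (1 - θ) * dist x y := by
  simpa [BranchSystem.pow] using hS.abs_phase_sub_sum_le hθ hθ1 hC₂ i 0 x y

/-- If the difference of two phases oscillates at all small scales around the points of some set
containing a cylinder, whose branch has a Lipschitz inverse at sufficiently many places, then the
system is uniformly non-integrable. -/
lemma uniformNonIntegrability_of_phase [Nonempty X] (hS : S.IsRegular θ C₁ C₂) (hθ : 0 ≤ θ)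
    (hθ1 : θ < 1) (hC₂ : 0 ≤ C₂) {i i' : ι} {x₀ : X} {O : Set X} {c ρ₀ : ℝ} (hc : 0 < c)
    (hρ₀ : 0 < ρ₀)
    (hosc : ∀ x ∈ O, ∀ ρ, 0 < ρ → ρ < ρ₀ → ∃ x', dist x' x < ρ ∧
      c * ρ ≤ |(S.phase i x₀ x' - S.phase i' x₀ x') - (S.phase i x₀ x - S.phase i' x₀ x)|)
    {m : ℕ} {w : Word ι m} (hw : ∀ x, (S.pow m).branch w x ∈ O) {C₀ c₁ ε₀ : ℝ} (hC₀ : 0 < C₀)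
    (hc₁ : 0 < c₁) (hε₀ : 0 < ε₀)
    (hpull : ∀ ε, 0 < ε → ε < ε₀ → ∀ x : X, ∃ x', dist x x' ≤ C₀ * ε ∧
      Metric.ball ((S.pow m).branch w x') (c₁ * ε) ⊆ (S.pow m).branch w '' Metric.ball x' ε) :
    S.UniformNonIntegrability := by
  have hC : 0 < C₀ + 1 := by linarith
  have h1θ : 0 < 1 - θ := by linarith
  set ρ₁ := min ((C₀ + 1) * ε₀) ((C₀ + 1) * (ρ₀ / c₁)) with hρ₁
  have hρ₁0 : 0 < ρ₁ := lt_min (by positivity) (by positivity)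
  have hc' : 0 < c * c₁ / (2 * (C₀ + 1)) := by positivity
  refine ⟨c * c₁ / (2 * (C₀ + 1)), hc', ρ₁, hρ₁0, fun N => ?_⟩
  -- Replacing both phases by sums of length n costs at most half of the oscillation.
  obtain ⟨n, hnN, hn⟩ : ∃ n ≥ N, 2 * (C₂ / (1 - θ)) * θ ^ n ≤ c / 2 := by
    have h := ((tendsto_pow_atTop_nhds_zero_of_lt_one hθ hθ1).const_mul
      (2 * (C₂ / (1 - θ))))
    rw [mul_zero] at h
    have h2 := h.eventually (gt_mem_nhds (show 0 < c / 2 by positivity))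
    obtain ⟨n, hn1, hn2⟩ := (h2.and (Filter.eventually_ge_atTop N)).exists
    exact ⟨n, hn2, hn1.le⟩
  obtain ⟨h, hh⟩ := S.exists_word_append (Word.replicate n i) w
  obtain ⟨k, hk⟩ := S.exists_word_append (Word.replicate n i') w
  have hO : Oscillates (fun x => (S.pow (n + m)).r h x - (S.pow (n + m)).r k x)
      (c * c₁ / (2 * (C₀ + 1))) ρ₁ := by
    intro x ρ hρ hρρ₁
    -- Reaching x' costs C₀ε and its ball another ε, which together make ρ.
    set ε := ρ / (C₀ + 1) with hε
    have hρε : ρ = (C₀ + 1) * ε := by rw [hε]; field_simp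
    have hε0 : 0 < ε := by positivity
    have hε1 : ε < ε₀ := by
      have := hρρ₁.trans_le (min_le_left _ _)
      rw [hρε] at this
      exact lt_of_mul_lt_mul_left this hC.le
    have hε2 : c₁ * ε < ρ₀ := by
      have := hρρ₁.trans_le (min_le_right _ _)
      rw [hρε] at this
      have := lt_of_mul_lt_mul_left this hC.le
      rw [lt_div_iff₀ hc₁] at this
      linarith
    obtain ⟨x', hxx', hsub⟩ := hpull ε hε0 hε1 x
    obtain ⟨z', hz', hosc'⟩ := hosc _ (hw x') (c₁ * ε) (by positivity) hε2
    obtain ⟨x'', hx'', rfl⟩ := hsub (Metric.mem_ball.2 hz')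
    refine ⟨x'', x', ?_, ?_, ?_⟩
    · calc dist x'' x ≤ dist x'' x' + dist x x' := dist_triangle_right _ _ _ |>.trans_eq (by
            rw [dist_comm x x'])
        _ < ε + C₀ * ε := by
          have := Metric.mem_ball.1 hx''
          linarith
        _ = ρ := by rw [hρε]; ring
    · rw [dist_comm]
      exact hxx'.trans_lt (by rw [hρε]; linarith)
    · set z := (S.pow m).branch w x'
      set z'' := (S.pow m).branch w x''
      have e1 := hS.abs_phase_sub_sum_le hθ hθ1 hC₂ i n z'' z
      have e2 := hS.abs_phase_sub_sum_le hθ hθ1 hC₂ i' n z'' z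
      have e3 : (S.phase i x₀ z'' - S.phase i' x₀ z'') - (S.phase i x₀ z - S.phase i' x₀ z) =
          S.phase i z z'' - S.phase i' z z'' := by
        rw [← hS.phase_sub hθ hθ1 hC₂ i x₀ z'' z, ← hS.phase_sub hθ hθ1 hC₂ i' x₀ z'' z]; ring
      rw [e3] at hosc'
      simp only [hh, hk]
      have e4 : 2 * (C₂ / (1 - θ) * θ ^ n * dist z'' z) ≤ c / 2 * (c₁ * ε) := by
        calc 2 * (C₂ / (1 - θ) * θ ^ n * dist z'' z) = 2 * (C₂ / (1 - θ)) * θ ^ n * dist z'' z := by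
              ring
          _ ≤ c / 2 * (c₁ * ε) := by gcongr
      have e5 : c * c₁ / (2 * (C₀ + 1)) * ρ = c / 2 * (c₁ * ε) := by
        rw [hρε]; field_simp
      rw [e5]
      set P := S.phase i z z''
      set Q := S.phase i' z z''
      set d := C₂ / (1 - θ) * θ ^ n * dist z'' z
      set u := (S.pow n).r (Word.replicate n i) z''
      set u' := (S.pow n).r (Word.replicate n i) z
      set v := (S.pow n).r (Word.replicate n i') z''
      set v' := (S.pow n).r (Word.replicate n i') z
      have e7 : (S.pow m).r w x'' + u - ((S.pow m).r w x'' + v) -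
          ((S.pow m).r w x' + u' - ((S.pow m).r w x' + v')) =
          (P - Q) - ((P - (u - u')) - (Q - (v - v'))) := by ring
      rw [e7]
      have e8 := abs_sub_abs_le_abs_sub (P - Q) ((P - (u - u')) - (Q - (v - v')))
      have e9 := abs_sub (P - (u - u')) (Q - (v - v'))
      linarith
  refine ⟨n + m, by omega, h, k, ?_, hO⟩
  -- Equal words would have a zero difference, which does not oscillate.
  rintro rfl
  obtain ⟨x₁, x₂, -, -, hx⟩ := hO (Classical.arbitrary X) (ρ₁ / 2) (by positivity) (by linarith)
  simp only [sub_self, abs_zero] at hx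
  have : 0 < c * c₁ / (2 * (C₀ + 1)) * (ρ₁ / 2) := by positivity
  linarith

/-- Every open set contains a cylinder. -/
lemma exists_word_branch_mem [MeasurableSpace X] [OpensMeasurableSpace X] {D : ℝ}
    (hS : S.IsRegular θ C₁ C₂) (hθ : 0 ≤ θ) (hθ1 : θ < 1) (hC₁ : 0 ≤ C₁) (hC₂ : 0 ≤ C₂)
    (hD : ∀ x y : X, dist x y ≤ D) {μ : Measure X} (hμ : S.PreservesIntegral μ)
    (hpos : ∀ x ρ, 0 < ρ → 0 < μ (Metric.ball x ρ)) {z : X} {O : Set X} (hO : O ∈ nhds z) :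
    ∃ (m : ℕ) (w : Word ι m), ∀ x, (S.pow m).branch w x ∈ O := by
  obtain ⟨δ, hδ, hball⟩ := Metric.mem_nhds_iff.1 hO
  obtain ⟨m, hm⟩ : ∃ m : ℕ, θ ^ m * D < δ / 2 := by
    have h := (tendsto_pow_atTop_nhds_zero_of_lt_one hθ hθ1).mul_const D
    rw [zero_mul] at h
    exact (h.eventually (gt_mem_nhds (half_pos hδ))).exists
  have hf := (hμ.pow hS hθ hθ1 hC₁ hC₂ m).tsum_lintegral
    ((Metric.ball z (δ / 2)).indicator 1) (measurable_one.indicator measurableSet_ball)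
  -- If no branch of length m met the ball, preservation of the integral applied to its indicator
  -- would give it measure zero.
  obtain ⟨w, x, hx⟩ : ∃ (w : Word ι m) (x : X), (S.pow m).branch w x ∈ Metric.ball z (δ / 2) := by
    by_contra! h
    rw [lintegral_indicator_one measurableSet_ball] at hf
    refine (hpos z (δ / 2) (half_pos hδ)).ne ?_
    rw [← hf]
    simp [Set.indicator_of_notMem (h _ _)]
  refine ⟨m, w, fun y => hball ?_⟩
  have h1 := (hS.pow hθ hθ1 hC₁ hC₂ m).contr w y x
  have h2 : θ ^ m * dist y x ≤ θ ^ m * D := by gcongr; exact hD _ _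
  rw [Metric.mem_ball] at hx ⊢
  linarith [dist_triangle ((S.pow m).branch w y) ((S.pow m).branch w x) z]

end BranchSystem

/-! ### Expanding Markov maps as branch systems -/

namespace ExpandingMarkovMap

variable {E : Type*} [NormedAddCommGroup E] [NormedSpace ℝ E]
  {M : Type*} [PseudoMetricSpace M] [ChartedSpace E M] [IsManifold 𝓘(ℝ, E) ∞ M]
  [MeasurableSpace M] [BorelSpace M] {F : FinslerMetric E M} {Leb : Measure M} {L : Type*}

/-- The system of inverse branches of an expanding Markov map. -/
def branchSystem (T : ExpandingMarkovMap F Leb L) (r : M → ℝ) : BranchSystem M L where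
  branch := T.branch
  J := fun l x => T.J (T.branch l x)
  r := fun l x => r (T.branch l x)

lemma norm_mfderiv_branch (T : ExpandingMarkovMap F Leb L) (l : L) (x : M)
    (v : TangentSpace 𝓘(ℝ, E) x) :
    F.norm (T.toFun (T.branch l x)) (mfderiv 𝓘(ℝ, E) 𝓘(ℝ, E) T.toFun (T.branch l x)
      (mfderiv 𝓘(ℝ, E) 𝓘(ℝ, E) (T.branch l) x v)) = F.norm x v := by
  -- Generalizing over g avoids transporting tangent vectors between the equal base points T(h x)
  -- and x.
  have h1 : ∀ g : M → M, g = id → F.norm (g x) (mfderiv 𝓘(ℝ, E) 𝓘(ℝ, E) g x v) = F.norm x v := by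
    rintro g rfl
    rw [mfderiv_id]
    rfl
  have h2 := h1 (T.toFun ∘ T.branch l) (funext (T.toFun_branch l))
  rw [mfderiv_comp x ((((T.contMDiffOn_toFun l).contMDiffAt
    ((T.isOpen_piece l).mem_nhds (T.branch_mem l x))).mdifferentiableAt one_ne_zero))
    ((T.contMDiff_branch l).mdifferentiable one_ne_zero x)] at h2
  exact h2

lemma dist_branch_le (hF : ∀ x y, F.edist x y = EDist.edist x y) (T : ExpandingMarkovMap F Leb L)
    {κ : ℝ} (hκ : 0 < κ) (hexp : ∀ l, ∀ x ∈ T.piece l, ∀ v : TangentSpace 𝓘(ℝ, E) x,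
      κ * F.norm x v ≤ F.norm (T.toFun x) (mfderiv 𝓘(ℝ, E) 𝓘(ℝ, E) T.toFun x v))
    (l : L) (x y : M) : dist (T.branch l x) (T.branch l y) ≤ κ⁻¹ * dist x y := by
  have h := F.edist_map_le (T.contMDiff_branch l) (inv_nonneg.2 hκ.le) (fun z v => by
    have h1 := hexp l _ (T.branch_mem l z) (mfderiv 𝓘(ℝ, E) 𝓘(ℝ, E) (T.branch l) z v)
    rw [norm_mfderiv_branch] at h1
    rwa [le_inv_mul_iff₀ hκ]) (x := x) (y := y) (by rw [hF]; exact edist_ne_top _ _)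
  rwa [hF, hF, edist_dist, edist_dist, ← ENNReal.ofReal_mul (inv_nonneg.2 hκ.le),
    ENNReal.ofReal_le_ofReal_iff (by positivity)] at h

lemma exists_isRegular [FiniteDimensional ℝ E] (hF : ∀ x y, F.edist x y = EDist.edist x y)
    (T : ExpandingMarkovMap F Leb L) {r : M → ℝ} (hr : T.IsGoodRoof r) :
    ∃ θ C₁ C₂ : ℝ, 0 ≤ θ ∧ θ < 1 ∧ 0 ≤ C₁ ∧ 0 ≤ C₂ ∧ (T.branchSystem r).IsRegular θ C₁ C₂ := by
  obtain ⟨κ, hκ, hexp⟩ := T.expanding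
  obtain ⟨C₁, hC₁⟩ := T.distortion
  obtain ⟨C₂, hC₂⟩ := hr.bounded_deriv
  obtain ⟨ε₁, hε₁, hrε⟩ := hr.lower_bound
  have hκ0 : 0 < κ := one_pos.trans hκ
  refine ⟨κ⁻¹, max C₁ 0, max C₂ 0, inv_nonneg.2 hκ0.le, inv_lt_one_of_one_lt₀ hκ,
    le_max_right _ _, le_max_right _ _, fun l x => T.J_pos l _ (T.branch_mem l x),
    fun l x => hε₁.le.trans (hrε l _ (T.branch_mem l x)), T.dist_branch_le hF hκ0 hexp,
    fun l x y => ?_, fun l x y => ?_⟩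
  · have hx := T.J_pos l _ (T.branch_mem l x)
    have hy := T.J_pos l _ (T.branch_mem l y)
    have h := FinslerMetric.norm_sub_le_of_derivNorm_le hF
      (u := fun z => Real.log (T.J (T.branch l z)))
      ((T.contMDiffOn_log_J l).comp_contMDiff (T.contMDiff_branch l) (T.branch_mem l))
      (fun x => (hC₁ l x).trans (le_max_left C₁ 0)) x y
    have h2 := (le_abs_self _).trans h
    change T.J (T.branch l x) ≤ T.J (T.branch l y) * _
    rw [← Real.exp_log hx, ← Real.exp_log hy, ← Real.exp_add]
    exact Real.exp_le_exp.2 (by linarith)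
  · exact FinslerMetric.norm_sub_le_of_derivNorm_le hF (u := fun z => r (T.branch l z))
      ((hr.contMDiffOn l).comp_contMDiff (T.contMDiff_branch l) (T.branch_mem l))
      (fun x => (hC₂ l x).trans (le_max_left C₂ 0)) x y

/-- The change of variables formula for an inverse branch. -/
lemma lintegral_J_mul_comp_branch (T : ExpandingMarkovMap F Leb L) (l : L) {f : M → ℝ≥0∞}
    (hf : AEMeasurable f (Leb.restrict (T.piece l))) :
    ∫⁻ x, ENNReal.ofReal (T.J (T.branch l x)) * f (T.branch l x) ∂Leb =
      ∫⁻ x in T.piece l, f x ∂Leb := by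
  have hp := (T.isOpen_piece l).measurableSet
  have hbm : Measurable (T.branch l) := (T.contMDiff_branch l).continuous.measurable
  have hJc : ContinuousOn T.J (T.piece l) :=
    (Real.continuous_exp.comp_continuousOn (T.contMDiffOn_log_J l).continuousOn).congr
      fun x hx => (Real.exp_log (T.J_pos l x hx)).symm
  have hJm : AEMeasurable T.J (Leb.restrict (T.piece l)) := hJc.aemeasurable hp
  -- The preimage of B under the branch is T(B ∩ piece), so the Jacobian formula computes the image
  -- measure.
  have hmap : Leb.map (T.branch l) =
      (Leb.restrict (T.piece l)).withDensity fun x => ENNReal.ofReal (T.J x)⁻¹ := by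
    ext B hB
    have hset : T.branch l ⁻¹' B = T.toFun '' (B ∩ T.piece l) := by
      ext x
      constructor
      · exact fun hx => ⟨T.branch l x, ⟨hx, T.branch_mem l x⟩, T.toFun_branch l x⟩
      · rintro ⟨y, ⟨hyB, hyp⟩, rfl⟩
        rwa [Set.mem_preimage, T.branch_toFun l y hyp]
    rw [Measure.map_apply hbm hB, withDensity_apply _ hB, hset,
      T.jacobian l _ (hB.inter hp) Set.inter_subset_right, Measure.restrict_restrict hB]
  have hg : AEMeasurable (fun x => ENNReal.ofReal (T.J x) * f x) (Leb.restrict (T.piece l)) :=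
    hJm.ennreal_ofReal.mul hf
  have h1 : ∫⁻ x, ENNReal.ofReal (T.J (T.branch l x)) * f (T.branch l x) ∂Leb =
      ∫⁻ x, ENNReal.ofReal (T.J x) * f x ∂(Leb.map (T.branch l)) := by
    refine (lintegral_map' (f := fun x => ENNReal.ofReal (T.J x) * f x) ?_ hbm.aemeasurable).symm
    rw [hmap]
    exact hg.mono_ac (withDensity_absolutelyContinuous _ _)
  rw [h1, hmap, lintegral_withDensity_eq_lintegral_mul₀
    (f := fun x => ENNReal.ofReal (T.J x)⁻¹) hJm.inv.ennreal_ofReal hg]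
  refine setLIntegral_congr_fun hp fun x hx => ?_
  have hx0 := T.J_pos l x hx
  simp only [Pi.mul_apply]
  rw [← mul_assoc, ← ENNReal.ofReal_mul (by positivity), inv_mul_cancel₀ hx0.ne',
    ENNReal.ofReal_one, one_mul]

lemma tsum_setLIntegral_piece [Countable L] (T : ExpandingMarkovMap F Leb L) (f : M → ℝ≥0∞) :
    ∑' l, ∫⁻ x in T.piece l, f x ∂Leb = ∫⁻ x, f x ∂Leb := by
  rw [← lintegral_iUnion (fun l => (T.isOpen_piece l).measurableSet) T.disjoint_piece,
    Measure.restrict_eq_self_of_ae_mem]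
  rw [ae_iff]
  exact T.ae_mem_piece

lemma preservesIntegral [Countable L] (T : ExpandingMarkovMap F Leb L) (r : M → ℝ) :
    (T.branchSystem r).PreservesIntegral Leb := by
  refine ⟨fun l => (T.contMDiff_branch l).continuous.measurable, fun f hf => ?_⟩
  rw [← T.tsum_setLIntegral_piece f]
  exact tsum_congr fun l => T.lintegral_J_mul_comp_branch l hf.aemeasurable

/-- The exponential tails of the roof function give a uniform bound for the sums of the weights. -/
lemma exists_superSol [Countable L] [Nonempty M] [IsFiniteMeasure Leb] [Leb.IsOpenPosMeasure]
    (T : ExpandingMarkovMap F Leb L) {r : M → ℝ}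
    (hr : T.IsGoodRoof r) {θ C₁ C₂ D : ℝ} (hC₁ : 0 ≤ C₁) (hC₂ : 0 ≤ C₂)
    (hS : (T.branchSystem r).IsRegular θ C₁ C₂) (hD : ∀ x y : M, dist x y ≤ D) {σ₀ : ℝ}
    (hσ₀ : 0 < σ₀) (hexp : ∫⁻ x, ENNReal.ofReal (Real.exp (σ₀ * r x)) ∂Leb < ⊤) :
    ∃ K, 0 ≤ K ∧ (T.branchSystem r).SuperSol (-σ₀) K 1 := by
  set S := T.branchSystem r
  set B := Real.exp ((σ₀ * C₂ + C₁) * D)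
  have hwt : ∀ l x y, S.wt (-σ₀) l x ≤ B * S.wt (-σ₀) l y := by
    intro l x y
    have h1 := hS.J_le l x y
    have h2 := (abs_le.1 (hS.r_lip l x y)).2
    have h3 := hS.J_pos l y
    have h4 := hD x y
    have h5 := hS.J_pos l x
    simp only [BranchSystem.wt, neg_neg]
    calc Real.exp (σ₀ * S.r l x) * S.J l x ≤
        Real.exp (σ₀ * (S.r l y + C₂ * dist x y)) * (S.J l y * Real.exp (C₁ * dist x y)) := by
          gcongr
          linarith
      _ = Real.exp ((σ₀ * C₂ + C₁) * dist x y) * (Real.exp (σ₀ * S.r l y) * S.J l y) := by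
          rw [mul_add, Real.exp_add, add_mul, Real.exp_add, ← mul_assoc σ₀]; ring
      _ ≤ B * (Real.exp (σ₀ * S.r l y) * S.J l y) := by
          have : 0 ≤ σ₀ * C₂ + C₁ := by positivity
          gcongr
          exact Real.exp_le_exp.2 (by gcongr)
  set I := ∫⁻ x, ENNReal.ofReal (Real.exp (σ₀ * r x)) ∂Leb
  have hint : ∀ l, ∫⁻ y, ENNReal.ofReal (S.wt (-σ₀) l y) ∂Leb =
      ∫⁻ x in T.piece l, ENNReal.ofReal (Real.exp (σ₀ * r x)) ∂Leb := by
    intro l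
    have hm : AEMeasurable (fun x => ENNReal.ofReal (Real.exp (σ₀ * r x)))
        (Leb.restrict (T.piece l)) :=
      (Real.measurable_exp.comp_aemeasurable (((hr.contMDiffOn l).continuousOn.aemeasurable
        (T.isOpen_piece l).measurableSet).const_mul σ₀)).ennreal_ofReal
    rw [← T.lintegral_J_mul_comp_branch l hm]
    refine lintegral_congr fun y => ?_
    rw [← ENNReal.ofReal_mul (T.J_pos l _ (T.branch_mem l y)).le, mul_comm]
    simp only [BranchSystem.wt, neg_neg]
    rfl
  have hμ0 : Leb Set.univ ≠ 0 := isOpen_univ.measure_ne_zero Leb Set.univ_nonempty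
  have hμt : Leb Set.univ ≠ ⊤ := measure_ne_top _ _
  -- By bounded distortion each weight is at most B times its mean over the space; the integrals of
  -- the weights add up to the exponential moment.
  have key : ∀ x, ∑' l, ENNReal.ofReal (S.wt (-σ₀) l x) ≤
      ENNReal.ofReal B * I / Leb Set.univ := by
    intro x
    rw [ENNReal.le_div_iff_mul_le (Or.inl hμ0) (Or.inl hμt), ← ENNReal.tsum_mul_right,
      show I = _ from (T.tsum_setLIntegral_piece _).symm, ← ENNReal.tsum_mul_left]
    refine ENNReal.tsum_le_tsum fun l => ?_
    rw [← hint, ← lintegral_const_mul' _ _ ENNReal.ofReal_ne_top, ← lintegral_const]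
    refine lintegral_mono fun y => ?_
    rw [← ENNReal.ofReal_mul (Real.exp_pos _).le]
    exact ENNReal.ofReal_le_ofReal (hwt l x y)
  have hfin : ENNReal.ofReal B * I / Leb Set.univ ≠ ⊤ :=
    ENNReal.div_ne_top (ENNReal.mul_ne_top ENNReal.ofReal_ne_top hexp.ne) hμ0
  refine ⟨(ENNReal.ofReal B * I / Leb Set.univ).toReal, ENNReal.toReal_nonneg, fun x => ?_⟩
  simp only [Pi.one_apply, mul_one]
  rw [ENNReal.ofReal_toReal hfin]
  exact key x

end ExpandingMarkovMap

/-! ### The John property in metric form -/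

namespace FinslerMetric

variable {E : Type*} [NormedAddCommGroup E] [NormedSpace ℝ E]
  {M : Type*} [PseudoMetricSpace M] [ChartedSpace E M] [IsManifold 𝓘(ℝ, E) ∞ M]
  [MeasurableSpace M] [BorelSpace M] {F : FinslerMetric E M} {Leb : Measure M}

lemma IsJohnDomain.exists_dist_le (hM : F.IsJohnDomain Leb)
    (hF : ∀ x y, F.edist x y = EDist.edist x y) : ∃ D, ∀ x y : M, dist x y ≤ D := by
  obtain ⟨D, hD⟩ := hM.bounded
  refine ⟨max D 0, fun x y => ?_⟩
  have := (hD x y).trans (ENNReal.ofReal_le_ofReal (le_max_left D 0))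
  rwa [hF, edist_dist, ENNReal.ofReal_le_ofReal_iff (le_max_right _ _)] at this

lemma IsJohnDomain.exists_compact_ball (hM : F.IsJohnDomain Leb)
    (hF : ∀ x y, F.edist x y = EDist.edist x y) :
    ∃ C₀ > (0 : ℝ), ∃ ε₀ > (0 : ℝ), ∀ ε, 0 < ε → ε < ε₀ → ∀ x : M, ∃ x' : M,
      dist x x' ≤ C₀ * ε ∧ IsCompact (closure (Metric.ball x' ε)) := by
  obtain ⟨C₀, hC₀, ε₀, hε₀, h⟩ := hM.john
  refine ⟨C₀, hC₀, ε₀, hε₀, fun ε hε hεε₀ x => ?_⟩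
  obtain ⟨x', h1, h2⟩ := h ε hε hεε₀ x
  rw [hF, edist_dist, ENNReal.ofReal_le_ofReal_iff (by positivity)] at h1
  rw [ball_eq_metricBall hF] at h2
  exact ⟨x', h1, h2⟩

lemma IsJohnDomain.johnDoubling (hM : F.IsJohnDomain Leb)
    (hF : ∀ x y, F.edist x y = EDist.edist x y) : JohnDoubling Leb := by
  obtain ⟨C₀, hC₀, ε₀, hε₀, h⟩ := hM.exists_compact_ball hF
  refine ⟨C₀, hC₀, ε₀, hε₀, fun C hC => ?_⟩
  obtain ⟨A, hA, hdoub⟩ := hM.doubling C hC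
  refine ⟨A, hA, fun ε hε hεε₀ x => ?_⟩
  obtain ⟨x', h1, h2⟩ := h ε hε hεε₀ x
  refine ⟨x', h1, ?_⟩
  have := hdoub x' ε hε (by rwa [ball_eq_metricBall hF])
  rwa [ball_eq_metricBall hF, ball_eq_metricBall hF] at this

end FinslerMetric

/-! ### Non-integrability of good roof functions -/

namespace ExpandingMarkovMap

variable {E : Type*} [NormedAddCommGroup E] [NormedSpace ℝ E]
  {M : Type*} [PseudoMetricSpace M] [ChartedSpace E M] [IsManifold 𝓘(ℝ, E) ∞ M]
  [MeasurableSpace M] [BorelSpace M] {F : FinslerMetric E M} {Leb : Measure M} {L : Type*}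

/-- The image of a compactly contained ball under an inverse branch contains a ball. -/
lemma exists_ball_subset_image [T2Space M] (hF : ∀ x y, F.edist x y = EDist.edist x y)
    (T : ExpandingMarkovMap F Leb L) (l : L) :
    ∃ c > 0, ∀ (x : M) (ε : ℝ), 0 < ε → IsCompact (closure (Metric.ball x ε)) →
      Metric.ball (T.branch l x) (c * ε) ⊆ T.branch l '' Metric.ball x ε := by
  obtain ⟨C', hC'⟩ := T.bounded_deriv l
  set C := max C' 1
  have hC0 : 0 < C := lt_max_of_lt_right one_pos
  have hC : ∀ x ∈ T.piece l, ∀ v : TangentSpace 𝓘(ℝ, E) x,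
      F.norm (T.toFun x) (mfderiv 𝓘(ℝ, E) 𝓘(ℝ, E) T.toFun x v) ≤ C * F.norm x v := fun x hx v =>
    (hC' x hx v).trans (mul_le_mul_of_nonneg_right (le_max_left _ _) (apply_nonneg _ _))
  refine ⟨C⁻¹, inv_pos.2 hC0, fun x ε hε hcomp y hy => ?_⟩
  have hbc : Continuous (T.branch l) := (T.contMDiff_branch l).continuous
  have hy' : F.edist (T.branch l x) y < ENNReal.ofReal (C⁻¹ * ε) := by
    rw [hF, edist_lt_ofReal, dist_comm]; exact hy
  obtain ⟨γ, h0, h1, hγ, hlen⟩ := F.exists_path_of_edist_lt hy'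
  -- Compactness of the closed ball makes K closed in M, although the piece itself is only open.
  set K := T.branch l '' closure (Metric.ball x ε)
  have hKc : IsClosed K := (hcomp.image hbc).isClosed
  have hKp : K ⊆ T.piece l := by
    rintro _ ⟨z, -, rfl⟩; exact T.branch_mem l z
  have hmem : ∀ t ∈ Set.Icc (0 : ℝ) 1, Set.Icc 0 t ⊆ γ ⁻¹' K →
      γ t ∈ T.branch l '' Metric.ball x ε := by
    intro t ht hsub
    have hle := F.pathLength_comp_le (T.isOpen_piece l) (T.contMDiffOn_toFun l) hC0.le hC
      hγ.contMDiffOn ht.1 fun s hs => hKp (hsub hs)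
    rw [h0, T.toFun_branch] at hle
    have hlt : F.edist x (T.toFun (γ t)) < ENNReal.ofReal ε := by
      refine hle.trans_lt ?_
      calc ENNReal.ofReal C * F.pathLength γ 0 t
          ≤ ENNReal.ofReal C * F.pathLength γ 0 1 := by
            gcongr
            exact F.pathLength_mono γ le_rfl ht.2
        _ < ENNReal.ofReal C * ENNReal.ofReal (C⁻¹ * ε) :=
            ENNReal.mul_lt_mul_right (by simpa using hC0) ENNReal.ofReal_ne_top hlen
        _ = ENNReal.ofReal ε := by
            rw [← ENNReal.ofReal_mul hC0.le, mul_inv_cancel_left₀ hC0.ne']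
    rw [hF, edist_lt_ofReal, dist_comm] at hlt
    exact ⟨T.toFun (γ t), hlt, T.branch_toFun l _ (hKp (hsub ⟨ht.1, le_rfl⟩))⟩
  have hopen : IsOpen (T.branch l '' Metric.ball x ε) := by
    have : T.branch l '' Metric.ball x ε = T.piece l ∩ T.toFun ⁻¹' Metric.ball x ε := by
      ext z
      constructor
      · rintro ⟨w, hw, rfl⟩
        exact ⟨T.branch_mem l w, by rwa [Set.mem_preimage, T.toFun_branch]⟩
      · rintro ⟨hz, hz'⟩
        exact ⟨_, hz', T.branch_toFun l z hz⟩
    rw [this]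
    exact (T.contMDiffOn_toFun l).continuousOn.isOpen_inter_preimage (T.isOpen_piece l)
      Metric.isOpen_ball
  -- While γ stays in K, its image under T has length below ε and cannot leave the open ball. So γ
  -- lies in the open image of that ball and can be continued inside K.
  have hall : Set.Icc (0 : ℝ) 1 ⊆ γ ⁻¹' K := by
    refine IsClosed.Icc_subset_of_forall_mem_nhdsGT_of_Icc_subset
      ((hKc.preimage hγ.continuous).inter isClosed_Icc) ?_ ?_
    · rw [Set.mem_preimage, h0]
      exact ⟨x, subset_closure (Metric.mem_ball_self hε), rfl⟩
    · intro t ht hsub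
      have h2 := hmem t ⟨ht.1, ht.2.le⟩ hsub
      exact hγ.continuous.continuousWithinAt (Filter.mem_of_superset (hopen.mem_nhds h2)
        (Set.image_mono subset_closure))
  rw [← h1]
  exact hmem 1 ⟨zero_le_one, le_rfl⟩ hall

/-- The induction closes because the ball found around the image point lies in the compact image of
a compactly contained ball, so it is compactly contained as well. -/
lemma exists_ball_subset_image_word [T2Space M] (hF : ∀ x y, F.edist x y = EDist.edist x y)
    (T : ExpandingMarkovMap F Leb L) (r : M → ℝ) :
    ∀ {m : ℕ} (w : Word L m), ∃ c > 0, ∀ (x : M) (ε : ℝ), 0 < ε →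
      IsCompact (closure (Metric.ball x ε)) →
      Metric.ball (((T.branchSystem r).pow m).branch w x) (c * ε) ⊆
        ((T.branchSystem r).pow m).branch w '' Metric.ball x ε
  | 0, _ => ⟨1, one_pos, fun x ε _ _ => by
      rw [one_mul]
      exact fun y hy => ⟨y, hy, rfl⟩⟩
  | m + 1, w => by
    obtain ⟨c, hc, h⟩ := T.exists_ball_subset_image_word hF r (m := m) w.2
    obtain ⟨c', hc', h'⟩ := T.exists_ball_subset_image hF w.1
    refine ⟨c * c', by positivity, fun x ε hε hcomp => ?_⟩
    have h1 := h' x ε hε hcomp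
    have hcomp' : IsCompact (closure (Metric.ball (T.branch w.1 x) (c' * ε))) := by
      have h2 := hcomp.image (T.contMDiff_branch w.1).continuous
      exact h2.of_isClosed_subset isClosed_closure
        (closure_minimal (h1.trans (Set.image_mono subset_closure)) h2.isClosed)
    rw [mul_assoc]
    refine (h (T.branch w.1 x) (c' * ε) (by positivity) hcomp').trans ?_
    rintro _ ⟨y, hy, rfl⟩
    obtain ⟨z, hz, rfl⟩ := h1 hy
    exact ⟨z, hz, rfl⟩

/-- The j-th term is C^1 with Lipschitz constant C₂θ^j, so the series of differentials converges
locally uniformly in charts. -/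
lemma contMDiff_phase [FiniteDimensional ℝ E] (hF : ∀ x y, F.edist x y = EDist.edist x y)
    (T : ExpandingMarkovMap F Leb L) {r : M → ℝ} (hr : T.IsGoodRoof r) {θ C₁ C₂ : ℝ}
    (hS : (T.branchSystem r).IsRegular θ C₁ C₂) (hθ : 0 ≤ θ) (hθ1 : θ < 1) (hC₂ : 0 ≤ C₂)
    (l : L) (x₀ : M) : ContMDiff 𝓘(ℝ, E) 𝓘(ℝ, ℝ) 1 ((T.branchSystem r).phase l x₀) := by
  have hiter : ∀ j : ℕ, ContMDiff 𝓘(ℝ, E) 𝓘(ℝ, E) 1 (T.branch l)^[j] := fun j => by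
    induction j with
    | zero => exact contMDiff_id
    | succ j ih => exact ih.comp (T.contMDiff_branch l)
  have hrl : ContMDiff 𝓘(ℝ, E) 𝓘(ℝ, ℝ) 1 fun x => r (T.branch l x) :=
    (hr.contMDiffOn l).comp_contMDiff (T.contMDiff_branch l) (T.branch_mem l)
  refine FinslerMetric.contMDiff_tsum hF (fun j => (hrl.comp (hiter j)).sub contMDiff_const)
    ((summable_geometric_of_lt_one hθ hθ1).mul_left C₂) (fun j x y => ?_)
    fun x => hS.summable_phase hθ hθ1 hC₂ l x x₀
  have := hS.abs_r_iterate_sub_le hθ hC₂ l j x y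
  rwa [sub_sub_sub_cancel_right]

/-- Since the roof function is not cohomologous to a locally constant function, the phases of two
branches differ. -/
lemma exists_phase_ne [FiniteDimensional ℝ E] [Nonempty M] [Nonempty L]
    (hF : ∀ x y, F.edist x y = EDist.edist x y)
    (T : ExpandingMarkovMap F Leb L) {r : M → ℝ} (hr : T.IsGoodRoof r) {θ C₁ C₂ D : ℝ}
    (hS : (T.branchSystem r).IsRegular θ C₁ C₂) (hθ : 0 ≤ θ) (hθ1 : θ < 1) (hC₂ : 0 ≤ C₂)
    (hD : ∀ x y : M, dist x y ≤ D) (x₀ : M) :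
    ∃ l l' x, (T.branchSystem r).phase l x₀ x ≠ (T.branchSystem r).phase l' x₀ x := by
  by_contra! hall
  have h1θ : 0 < 1 - θ := by linarith
  obtain ⟨l₀⟩ := ‹Nonempty L›
  set S := T.branchSystem r
  set φ := S.phase l₀ x₀
  have hφ : ContMDiff 𝓘(ℝ, E) 𝓘(ℝ, ℝ) 1 φ := T.contMDiff_phase hF hr hS hθ hθ1 hC₂ l₀ x₀
  -- With a common phase φ, `phase_eq` at T y says that r y - φ(T y) + φ y depends only on the piece
  -- containing y.
  refine hr.not_cohomologous ⟨fun y => r y - φ (T.toFun y) + φ y, φ, fun l => ?_, ⟨hφ, ?_, ?_⟩,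
    fun l y _ => by ring⟩
  · refine ⟨S.r l x₀ + φ (T.branch l x₀), fun y hy => ?_⟩
    have h := hS.phase_eq hθ hθ1 hC₂ l x₀ (T.toFun y)
    have e : S.phase l x₀ = φ := funext (hall l l₀)
    have e2 : S.branch l (T.toFun y) = y := T.branch_toFun l y hy
    have e3 : S.r l (T.toFun y) = r y := congrArg r e2
    rw [e, e2, e3] at h
    have e4 : S.branch l x₀ = T.branch l x₀ := rfl
    rw [e4] at h
    linarith
  · refine ⟨C₂ / (1 - θ) * D, ?_⟩
    rintro _ ⟨x, rfl⟩
    exact (hS.abs_phase_le hθ hθ1 hC₂ l₀ x x₀).trans (by gcongr; exact hD _ _)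
  · refine ⟨C₂ / (1 - θ), ?_⟩
    rintro _ ⟨x, rfl⟩
    refine FinslerMetric.derivNorm_le_of_norm_sub_le hF hφ (by positivity) (fun x y => ?_) x
    rw [hS.phase_sub hθ hθ1 hC₂]
    exact hS.abs_phase_le hθ hθ1 hC₂ l₀ x y

/-- Uniform non-integrability of a good roof function. -/
lemma uniformNonIntegrability [FiniteDimensional ℝ E] [T2Space M] [Countable L] [Nonempty M]
    [Leb.IsOpenPosMeasure] (hM : F.IsJohnDomain Leb)
    (hF : ∀ x y, F.edist x y = EDist.edist x y)
    (T : ExpandingMarkovMap F Leb L) {r : M → ℝ} (hr : T.IsGoodRoof r) {θ C₁ C₂ D : ℝ}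
    (hS : (T.branchSystem r).IsRegular θ C₁ C₂) (hθ : 0 ≤ θ) (hθ1 : θ < 1) (hC₁ : 0 ≤ C₁)
    (hC₂ : 0 ≤ C₂) (hD : ∀ x y : M, dist x y ≤ D) :
    (T.branchSystem r).UniformNonIntegrability := by
  have hL : Nonempty L := by
    by_contra h
    rw [not_nonempty_iff] at h
    have h1 := T.ae_mem_piece
    rw [Set.iUnion_of_empty, Set.compl_empty] at h1
    exact isOpen_univ.measure_ne_zero Leb Set.univ_nonempty h1
  set x₀ := Classical.arbitrary M
  obtain ⟨l, l', x₁, hne⟩ := T.exists_phase_ne hF hr hS hθ hθ1 hC₂ hD x₀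
  set S := T.branchSystem r
  have hzero : ∀ l, S.phase l x₀ x₀ = 0 := fun l => by simp [BranchSystem.phase]
  -- The difference of the two phases vanishes at x₀ and not at x₁, so it is not constant.
  obtain ⟨z, O, hO, c, hc, ρ₀, hρ₀, hosc⟩ := FinslerMetric.exists_oscillation_of_ne hF
    ((T.contMDiff_phase hF hr hS hθ hθ1 hC₂ l x₀).sub
      (T.contMDiff_phase hF hr hS hθ hθ1 hC₂ l' x₀)) (p := x₁) (q := x₀) (by
      change S.phase l x₀ x₁ - S.phase l' x₀ x₁ ≠ S.phase l x₀ x₀ - S.phase l' x₀ x₀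
      rw [hzero, hzero, sub_self]
      exact sub_ne_zero.2 hne)
  obtain ⟨m, w, hw⟩ := BranchSystem.exists_word_branch_mem hS hθ hθ1 hC₁ hC₂ hD
    (T.preservesIntegral r) (fun x ρ hρ => Metric.measure_ball_pos Leb x hρ) hO
  obtain ⟨C₀, hC₀, ε₀, hε₀, hjohn⟩ := hM.exists_compact_ball hF
  obtain ⟨c₁, hc₁, hpull⟩ := T.exists_ball_subset_image_word hF r w
  refine BranchSystem.uniformNonIntegrability_of_phase hS hθ hθ1 hC₂ hc hρ₀ hosc hw hC₀ hc₁ hε₀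
    fun ε hε hεε₀ x => ?_
  obtain ⟨x', h1, h2⟩ := hjohn ε hε hεε₀ x
  exact ⟨x', h1, hpull x' ε hε h2⟩

end ExpandingMarkovMap

/-! ### Fibres, transfer operators and the conclusion -/

namespace ExpandingMarkovMap

section Fiber

variable {E : Type*} [NormedAddCommGroup E] [NormedSpace ℝ E]
  {M : Type*} [PseudoMetricSpace M] [ChartedSpace E M] [IsManifold 𝓘(ℝ, E) ∞ M]
  [MeasurableSpace M] [BorelSpace M] {F : FinslerMetric E M} {Leb : Measure M} {L : Type*}

/-- The preimages of a point are parametrized by the inverse branches. -/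
noncomputable def fiberEquiv (T : ExpandingMarkovMap F Leb L) (x : M) : L ≃ T.fiber x :=
  Equiv.ofBijective
    (fun l => ⟨T.branch l x, Set.mem_iUnion.2 ⟨l, T.branch_mem l x⟩, T.toFun_branch l x⟩) <| by
    refine ⟨fun l l' h => ?_, fun y => ?_⟩
    · by_contra hne
      have h1 : T.branch l x = T.branch l' x := congrArg Subtype.val h
      exact Set.disjoint_left.1 (T.disjoint_piece hne) (T.branch_mem l x)
        (h1 ▸ T.branch_mem l' x)
    · obtain ⟨l, hl⟩ := Set.mem_iUnion.1 y.2.1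
      exact ⟨l, Subtype.ext ((congrArg (T.branch l) y.2.2.symm).trans (T.branch_toFun l _ hl))⟩

lemma transfer_eq (T : ExpandingMarkovMap F Leb L) (r : M → ℝ) (s : ℂ) :
    T.transfer r s = (T.branchSystem r).transfer s := by
  funext v x
  exact ((T.fiberEquiv x).tsum_eq fun y : T.fiber x => T.transferTerm r s v y).symm

lemma summable_transferTerm_iff (T : ExpandingMarkovMap F Leb L) (r : M → ℝ) (s : ℂ) (v : M → ℂ)
    (x : M) : (Summable fun y : T.fiber x => T.transferTerm r s v y) ↔
      Summable fun l => (T.branchSystem r).coeff s l x * v ((T.branchSystem r).branch l x) :=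
  ((T.fiberEquiv x).summable_iff (f := fun y : T.fiber x => T.transferTerm r s v y)).symm

end Fiber

end ExpandingMarkovMap

lemma eLpNorm_two_le_of_lintegral_sq_le {X : Type*} [MeasurableSpace X] {μ : Measure X}
    {f : X → ℂ} {c : ℝ} (hc : 0 ≤ c)
    (h : ∫⁻ x, ENNReal.ofReal (‖f x‖ ^ 2) ∂μ ≤ ENNReal.ofReal (c ^ 2)) :
    eLpNorm f 2 μ ≤ ENNReal.ofReal c := by
  rw [eLpNorm_eq_lintegral_rpow_enorm_toReal two_ne_zero ENNReal.ofNat_ne_top]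
  have e : ∀ x, ‖f x‖ₑ ^ (2 : ℝ≥0∞).toReal = ENNReal.ofReal (‖f x‖ ^ 2) := fun x => by
    rw [ENNReal.toReal_ofNat, ENNReal.rpow_ofNat, ENNReal.ofReal_pow (norm_nonneg _), ofReal_norm]
  simp only [e]
  calc _ ≤ ENNReal.ofReal (c ^ 2) ^ (1 / (2 : ℝ≥0∞).toReal) := by gcongr
    _ = ENNReal.ofReal c := by
      rw [ENNReal.ofReal_pow hc, ENNReal.toReal_ofNat, ← ENNReal.rpow_ofNat, ← ENNReal.rpow_mul]
      norm_num

theorem mainTheorem10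
    {E : Type*} [NormedAddCommGroup E] [NormedSpace ℝ E] [FiniteDimensional ℝ E]
    {M : Type*} [TopologicalSpace M] [T2Space M] [SecondCountableTopology M]
    [ChartedSpace E M] [IsManifold 𝓘(ℝ, E) ∞ M] [MeasurableSpace M] [BorelSpace M]
    {L : Type*} [Countable L]
    (F : FinslerMetric E M) (Leb : Measure M) (hM : F.IsJohnDomain Leb)
    (T : ExpandingMarkovMap F Leb L) (r : M → ℝ) (hr : T.IsGoodRoof r)
    (σ₀ : ℝ) (hσ₀ : 0 < σ₀)
    (hexp : ∫⁻ x, ENNReal.ofReal (Real.exp (σ₀ * r x)) ∂Leb < ⊤) :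
    ∃ σ₀' : ℝ, 0 < σ₀' ∧ σ₀' ≤ σ₀ ∧ ∃ T₀ : ℝ, 0 < T₀ ∧ ∃ C : ℝ, 0 < C ∧
      ∃ β : ℝ, 0 < β ∧ β < 1 ∧
      ∀ σ t : ℝ, |σ| ≤ σ₀' → T₀ ≤ |t| → ∀ u : M → ℂ, F.MemC1 u → ∀ k : ℕ,
        (∀ x : M, Summable fun y : T.fiber x =>
          T.transferTerm r (σ + t * Complex.I) ((T.transfer r (σ + t * Complex.I))^[k] u) y) ∧
        MemLp ((T.transfer r (σ + t * Complex.I))^[k] u) 2 Leb ∧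
        eLpNorm ((T.transfer r (σ + t * Complex.I))^[k] u) 2 Leb ≤
          ENNReal.ofReal (C * β ^ k * F.normOne t u) := by
  have hfin : ∀ x y, F.edist x y ≠ ⊤ := fun x y => by
    obtain ⟨D, hD⟩ := hM.bounded
    exact ne_top_of_le_ne_top ENNReal.ofReal_ne_top (hD x y)
  -- The given topology is replaced by that of the Finsler pseudometric, after which the metric
  -- lemmas apply to the same manifold.
  obtain ⟨m, rfl, hF⟩ := F.exists_pseudoMetricSpace hfin
  have := hM.connected
  have := hM.finite
  have := hM.full_support
  obtain ⟨D, hD⟩ := hM.exists_dist_le hF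
  obtain ⟨θ, C₁, C₂, hθ, hθ1, hC₁, hC₂, hS⟩ := T.exists_isRegular hF hr
  obtain ⟨K, hK, hsup⟩ := T.exists_superSol hr hC₁ hC₂ hS hD hσ₀ hexp
  obtain ⟨σ₀', hσ, hσ', T₀, hT₀, C, hC, β, hβ, hβ1, hdecay⟩ :=
    BranchSystem.exists_decay hS hθ hθ1 hC₁ hC₂ (fun x ρ hρ => Metric.measure_ball_pos Leb x hρ)
      (hM.johnDoubling hF) (T.preservesIntegral r) hD hσ₀ hK hsup
      (T.uniformNonIntegrability hM hF hr hS hθ hθ1 hC₁ hC₂ hD)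
  refine ⟨σ₀', hσ, hσ', T₀, hT₀, C, hC, β, hβ, hβ1, fun σ t hσt ht u hu k => ?_⟩
  obtain ⟨ht1, hdec⟩ := hdecay σ t hσt ht
  have hN1 : 0 ≤ ⨆ x, F.derivNorm u x := Real.iSup_nonneg fun x => F.derivNorm_nonneg u x
  have hN2 : 0 ≤ ⨆ x, ‖u x‖ := Real.iSup_nonneg fun x => norm_nonneg _
  have ht0 : 0 < |t| := one_pos.trans_le ht1
  have hN : F.normOne t u = (⨆ x, ‖u x‖) + 1 / |t| * ⨆ x, F.derivNorm u x := by
    rw [FinslerMetric.normOne, max_eq_right ht1]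
  have hN0 : 0 ≤ F.normOne t u := by rw [hN]; positivity
  -- Because |t| ≥ 1, the norm `normOne` bounds sup ‖u‖ and |t| times it bounds the Lipschitz
  -- constant of u.
  obtain ⟨h1, h2, h3⟩ := hdec u (F.normOne t u) (fun x => by
      rw [hN]
      exact (le_ciSup hu.bdd x).trans (le_add_of_nonneg_right (by positivity))) (fun x y => by
      refine (FinslerMetric.norm_sub_le_of_derivNorm_le hF hu.contMDiff
        (fun x => le_ciSup hu.bdd_deriv x) x y).trans ?_
      rw [← mul_assoc]
      gcongr
      rw [hN, add_mul, mul_right_comm, one_div_mul_cancel ht0.ne', one_mul]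
      exact le_add_of_nonneg_left (by positivity)) k
  have h4 := eLpNorm_two_le_of_lintegral_sq_le (by positivity) h3
  rw [T.transfer_eq]
  exact ⟨fun x => (T.summable_transferTerm_iff r _ _ x).2 (h1 x),
    ⟨h2.aestronglyMeasurable, h4.trans_lt ENNReal.ofReal_lt_top⟩, h4⟩
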